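/- Let $U\subseteq\mathbb R^6$ be open, with coordinates $(x^1,x^2,x^3,y^1,y^2,y^3)$, let $W\subseteq\mathbb R^2$ be its image under $(x^1,x^2,x^3,y^1,y^2,y^3)\mapsto(x^1,x^3)$, and let $f=f(x^1,x^3)$ be a smooth function on $W$ with $f_3=\partial f/\partial x^3\neq0$ everywhere. Put $$\theta^1=dy^1+x^2dx^3,\quad \theta^2=dy^2+f\,dx^1,\quad \theta^3=dy^3+x^1dx^2,\quad \theta^4=\tfrac32f_3^2\,dx^1,$$ $$\theta^5=\tfrac32f_3\,dx^2-\tfrac12f_{33}\,\theta^1,\quad \theta^6=\tfrac32f_3^2\,dx^3+\tfrac12f_{13}\,\theta^2,$$ and let $g_{\mathcal D_f}=2\theta^1\theta^4+2\theta^2\theta^5+2\theta^3\theta^6$ (Bryant's metric of the rank $3$ distribution annihilated by $\theta^1,\theta^2,\theta^3$), with Schouten tensor $P=\tfrac14\big(Ric-\tfrac{Scal}{10}g_{\mathcal D_f}\big)$. An ambient metric for a metric $g_0$ on $U$ is a smooth, Ricci-flat semi-Riemannian metric $2d(\varrho t)dt+t^2g(x,\varrho)$ on $(0,\infty)\times U\times(-\epsilon,\epsilon)$,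 with coordinates $(t,x,\varrho)$, such that $g(x,0)=g_0(x)$; an ambient metric for the conformal class $[g_0]$ is an ambient metric for some $\mathrm e^{2\phi}g_0$ with $\phi\in C^\infty(U)$. Then $P=\sum_{i,j\in\{2,4,6\}}P_{ij}\theta^i\theta^j$ with smooth functions $P_{ij}=P_{ji}$ of $(x^1,x^3)$. Moreover, let $\epsilon>0$, let $S_{ij}=S_{ji}$, $i,j\in\{2,4,6\}$, be smooth functions of $(x^1,x^3,\varrho)$ on $W\times(-\epsilon,\epsilon)$, put $S=\sum_{i,j\in\{2,4,6\}}S_{ij}\theta^i\theta^j$, and let $$\tilde g_{f,S}=2d(\varrho t)dt+t^2\big(g_{\mathcal D_f}+2\varrho P+S(x^1,x^3,\varrho)\big)$$ on $(0,\infty)\times U\times(-\epsilon,\epsilon)$. Then: 1. $\tilde g_{f,S}$ is a smooth semi-Riemannian metric, and it is Ricci-flat if and only if all the functions $S_{ij}$ satisfy the linear PDE $$\varrho\,\frac{\partial^2S_{ij}}{\partial\varrho^2}-2\,\frac{\partial S_{ij}}{\partial\varrho}=0 .\qquad(*)$$ 2. $\tilde g_{f,S}$ is an ambient metric for the conformal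 class $[g_{\mathcal D_f}]$ if and only if all $S_{ij}$ satisfy $(*)$ and $S_{ij}(x^1,x^3,0)=0$. 3. The functions $S_{ij}$ satisfy $(*)$ and $S_{ij}(x^1,x^3,0)=0$ if and only if $S=\varrho^3Q$ with $Q=\sum_{i,j\in\{2,4,6\}}Q_{ij}(x^1,x^3)\,\theta^i\theta^j$ for some smooth functions $Q_{ij}=Q_{ji}$ on $W$. 4. For all smooth functions $Q_{ij}=Q_{ji}$ on $W$, the metric $2d(\varrho t)dt+t^2\big(g_{\mathcal D_f}+2\varrho P+\varrho^3Q\big)$, with $Q$ as in 3, is an ambient metric for $g_{\mathcal D_f}$. -/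

import Mathlib

open scoped ContDiff

noncomputable section

namespace BryantAmbient

/-! ## Semi-Riemannian geometry in a coordinate chart

A `(0,2)`-tensor field on (an open subset of) a coordinate space `ι → ℝ` is given by its matrix
of components with respect to the coordinates. -/

section Chart

variable {ι : Type*} [Fintype ι] [DecidableEq ι]

/-- The partial derivative of `F` in the direction of the `i`-th coordinate. -/
def pd (i : ι) (F : (ι → ℝ) → ℝ) (x : ι → ℝ) : ℝ :=
  fderiv ℝ F x (Pi.single i 1)

/-- Christoffel symbols `Γ^k_{ij}` of the metric `g`. -/
def christoffel (g : (ι → ℝ) → Matrix ι ι ℝ) (k i j : ι) (x : ι → ℝ) : ℝ :=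
  (1 / 2) * ∑ l, (g x)⁻¹ k l *
    (pd i (fun z => g z j l) x + pd j (fun z => g z i l) x - pd l (fun z => g z i j) x)

/-- Ricci tensor of the metric `g` (positive on round spheres):
`R_{ij} = ∂_k Γ^k_{ij} - ∂_j Γ^k_{ik} + Γ^k_{kl} Γ^l_{ij} - Γ^k_{jl} Γ^l_{ik}`. -/
def ricci (g : (ι → ℝ) → Matrix ι ι ℝ) (x : ι → ℝ) : Matrix ι ι ℝ :=
  Matrix.of fun i j =>
    ∑ k, (pd k (christoffel g k i j) x - pd j (christoffel g k i k) x
      + ∑ l, (christoffel g k k l x * christoffel g l i j x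
        - christoffel g k j l x * christoffel g l i k x))

/-- Scalar curvature of the metric `g`. -/
def scalarCurvature (g : (ι → ℝ) → Matrix ι ι ℝ) (x : ι → ℝ) : ℝ :=
  ∑ i, ∑ j, (g x)⁻¹ i j * ricci g x i j

/-- Schouten tensor `P = (Ric - Scal / (2 (n - 1)) g) / (n - 2)` in dimension `n`. -/
def schouten (g : (ι → ℝ) → Matrix ι ι ℝ) (x : ι → ℝ) : Matrix ι ι ℝ :=
  (1 / ((Fintype.card ι : ℝ) - 2)) •
    (ricci g x - (scalarCurvature g x / (2 * ((Fintype.card ι : ℝ) - 1))) • g x)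

/-- The bilinear form with matrix `A` is non-degenerate of index `k`: it has an orthonormal basis
(the columns of `M`) with exactly `k` vectors of square `-1`, the other ones having square `1`. -/
def HasIndex (A : Matrix ι ι ℝ) (k : ℕ) : Prop :=
  ∃ (M : Matrix ι ι ℝ) (σ : ι → ℝ), IsUnit M.det ∧ (∀ i, σ i = 1 ∨ σ i = -1) ∧
    {i | σ i = -1}.ncard = k ∧ M.transpose * A * M = Matrix.diagonal σ

/-- `g` is a smooth semi-Riemannian metric on the open set `Ω`: smooth, symmetric, and
non-degenerate of constant index. -/
structure IsSemiRiemannian (g : (ι → ℝ) → Matrix ι ι ℝ) (Ω : Set (ι → ℝ)) : Prop where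
  smooth : ∀ i j, ContDiffOn ℝ ∞ (fun x => g x i j) Ω
  symm : ∀ x ∈ Ω, (g x).IsSymm
  index : ∃ k : ℕ, ∀ x ∈ Ω, HasIndex (g x) k

/-- `g` is Ricci-flat on `Ω`. -/
def IsRicciFlat (g : (ι → ℝ) → Matrix ι ι ℝ) (Ω : Set (ι → ℝ)) : Prop :=
  ∀ x ∈ Ω, ricci g x = 0

end Chart

/-! ## Ambient metrics -/

/-- Indices of the coordinates `(t, x¹, …, xⁿ, ϱ)` on the ambient space. -/
abbrev AmbientIndex (n : ℕ) : Type := Unit ⊕ (Fin n ⊕ Unit)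

/-- The coordinate `t`. -/
def tCoord {n : ℕ} (z : AmbientIndex n → ℝ) : ℝ := z (.inl ())

/-- The coordinates `(x¹, …, xⁿ)`. -/
def xCoord {n : ℕ} (z : AmbientIndex n → ℝ) : Fin n → ℝ := fun i => z (.inr (.inl i))

/-- The coordinate `ϱ`. -/
def rhoCoord {n : ℕ} (z : AmbientIndex n → ℝ) : ℝ := z (.inr (.inr ()))

/-- The ambient space `(0, ∞) × U × (-ε, ε)`. -/
def ambientSpace {n : ℕ} (U : Set (Fin n → ℝ)) (ε : ℝ) : Set (AmbientIndex n → ℝ) :=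
  {z | 0 < tCoord z ∧ xCoord z ∈ U ∧ rhoCoord z ∈ Set.Ioo (-ε) ε}

/-- The tensor `2 d(ϱt) dt + t² g(x, ϱ) = 2 ϱ dt² + 2 t dϱ dt + t² g(x, ϱ)` associated with a
`ϱ`-dependent family `g(x, ϱ)`. -/
def ambientForm {n : ℕ} (g : (Fin n → ℝ) → ℝ → Matrix (Fin n) (Fin n) ℝ)
    (z : AmbientIndex n → ℝ) : Matrix (AmbientIndex n) (AmbientIndex n) ℝ :=
  Matrix.of fun a b =>
    match a, b with
    | .inl _, .inl _ => 2 * rhoCoord z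
    | .inl _, .inr (.inr _) => tCoord z
    | .inr (.inr _), .inl _ => tCoord z
    | .inr (.inl i), .inr (.inl j) => tCoord z ^ 2 * g (xCoord z) (rhoCoord z) i j
    | _, _ => 0

/-- `G` is a pre-ambient metric for `g₀` on `(0, ∞) × U × (-ε, ε)`: a smooth semi-Riemannian
metric of the form `2 d(ϱt) dt + t² g(x, ϱ)` with `g(x, 0) = g₀(x)`. -/
structure IsPreAmbientMetric {n : ℕ} (U : Set (Fin n → ℝ)) (ε : ℝ)
    (g₀ : (Fin n → ℝ) → Matrix (Fin n) (Fin n) ℝ)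
    (G : (AmbientIndex n → ℝ) → Matrix (AmbientIndex n) (AmbientIndex n) ℝ) : Prop where
  semiRiemannian : IsSemiRiemannian G (ambientSpace U ε)
  form : ∃ g : (Fin n → ℝ) → ℝ → Matrix (Fin n) (Fin n) ℝ,
    (∀ z ∈ ambientSpace U ε, G z = ambientForm g z) ∧ ∀ x ∈ U, g x 0 = g₀ x

/-- `G` is an ambient metric for `g₀`: a Ricci-flat pre-ambient metric for `g₀`. -/
structure IsAmbientMetric {n : ℕ} (U : Set (Fin n → ℝ)) (ε : ℝ)
    (g₀ : (Fin n → ℝ) → Matrix (Fin n) (Fin n) ℝ)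
    (G : (AmbientIndex n → ℝ) → Matrix (AmbientIndex n) (AmbientIndex n) ℝ) : Prop
    extends IsPreAmbientMetric U ε g₀ G where
  ricciFlat : IsRicciFlat G (ambientSpace U ε)

/-- `G` is an ambient metric for the conformal class `[g₀]`, i.e. for some metric `e^{2φ} g₀`
in that class. -/
def IsAmbientMetricForClass {n : ℕ} (U : Set (Fin n → ℝ)) (ε : ℝ)
    (g₀ : (Fin n → ℝ) → Matrix (Fin n) (Fin n) ℝ)
    (G : (AmbientIndex n → ℝ) → Matrix (AmbientIndex n) (AmbientIndex n) ℝ) : Prop :=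
  ∃ φ : (Fin n → ℝ) → ℝ, ContDiffOn ℝ ∞ φ U ∧
    IsAmbientMetric U ε (fun x => Real.exp (2 * φ x) • g₀ x) G

/-! ## Bryant's metrics

The coordinates on `ℝ⁶` are `(x¹, x², x³, y¹, y², y³)`, with indices `0, …, 5`. -/

/-- The coordinate differentials on `ℝ⁶`. -/
def dc (i : Fin 6) : Fin 6 → ℝ := Pi.single i 1

/-- `θ¹ = dy¹ + x² dx³`. -/
def theta1 (x : Fin 6 → ℝ) : Fin 6 → ℝ := dc 3 + x 1 • dc 2

/-- `θ² = dy² + f dx¹`. -/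
def theta2 (f : (Fin 6 → ℝ) → ℝ) (x : Fin 6 → ℝ) : Fin 6 → ℝ := dc 4 + f x • dc 0

/-- `θ³ = dy³ + x¹ dx²`. -/
def theta3 (x : Fin 6 → ℝ) : Fin 6 → ℝ := dc 5 + x 0 • dc 1

/-- `θ⁴ = (3/2) f₃² dx¹`. -/
def theta4 (f : (Fin 6 → ℝ) → ℝ) (x : Fin 6 → ℝ) : Fin 6 → ℝ :=
  ((3 / 2) * pd 2 f x ^ 2) • dc 0

/-- `θ⁵ = (3/2) f₃ dx² - (1/2) f₃₃ θ¹`. -/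
def theta5 (f : (Fin 6 → ℝ) → ℝ) (x : Fin 6 → ℝ) : Fin 6 → ℝ :=
  ((3 / 2) * pd 2 f x) • dc 1 - ((1 / 2) * pd 2 (pd 2 f) x) • theta1 x

/-- `θ⁶ = (3/2) f₃² dx³ + (1/2) f₁₃ θ² + (3/2) f₃ f₂ dx² + (1/2) (f₃ f₂₃ - f₂ f₃₃) θ¹
+ (1/2) (f₂ f₁₃ - f₃ f₁₂) θ³`. -/
def theta6 (f : (Fin 6 → ℝ) → ℝ) (x : Fin 6 → ℝ) : Fin 6 → ℝ :=
  ((3 / 2) * pd 2 f x ^ 2) • dc 2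
    + ((1 / 2) * pd 0 (pd 2 f) x) • theta2 f x
    + ((3 / 2) * pd 2 f x * pd 1 f x) • dc 1
    + ((1 / 2) * (pd 2 f x * pd 1 (pd 2 f) x - pd 1 f x * pd 2 (pd 2 f) x)) • theta1 x
    + ((1 / 2) * (pd 1 f x * pd 0 (pd 2 f) x - pd 2 f x * pd 0 (pd 1 f) x)) • theta3 x

/-- `2 α β = α ⊗ β + β ⊗ α` for covectors `α`, `β`. -/
def twoSym (α β : Fin 6 → ℝ) : Matrix (Fin 6) (Fin 6) ℝ :=
  Matrix.vecMulVec α β + Matrix.vecMulVec β α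

/-- Bryant's metric `g_{D_f} = 2 θ¹ θ⁴ + 2 θ² θ⁵ + 2 θ³ θ⁶` of the rank 3 distribution `D_f`. -/
def bryantMetric (f : (Fin 6 → ℝ) → ℝ) (x : Fin 6 → ℝ) : Matrix (Fin 6) (Fin 6) ℝ :=
  twoSym (theta1 x) (theta4 f x) + twoSym (theta2 f x) (theta5 f x)
    + twoSym (theta3 x) (theta6 f x)

/-- The covectors `θ²`, `θ⁴`, `θ⁶`, indexed by `0, 1, 2`. -/
def theta246 (f : (Fin 6 → ℝ) → ℝ) (x : Fin 6 → ℝ) (a : Fin 3) : Fin 6 → ℝ :=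
  ![theta2 f x, theta4 f x, theta6 f x] a

/-- The tensor `∑ q_{ij} θ^i ⊗ θ^j` over `i, j ∈ {2, 4, 6}`; for symmetric `q` it is
`q₂₂ (θ²)² + 2 q₂₄ θ² θ⁴ + 2 q₂₆ θ² θ⁶ + q₄₄ (θ⁴)² + 2 q₄₆ θ⁴ θ⁶ + q₆₆ (θ⁶)²`. -/
def tensor246 (f : (Fin 6 → ℝ) → ℝ) (q : Matrix (Fin 3) (Fin 3) ℝ) (x : Fin 6 → ℝ) :
    Matrix (Fin 6) (Fin 6) ℝ :=
  ∑ a, ∑ b, q a b • Matrix.vecMulVec (theta246 f x a) (theta246 f x b)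

/-- The projection `(x¹, x², x³, y¹, y², y³) ↦ (x¹, x³)`. -/
def proj13 (x : Fin 6 → ℝ) : ℝ × ℝ := (x 0, x 2)

/-- The function `f(x¹, x³)`, viewed as a function of all six coordinates. -/
def pull13 (f : ℝ × ℝ → ℝ) (x : Fin 6 → ℝ) : ℝ := f (proj13 x)

/-- `g̃_{f,S} = 2 d(ϱt) dt + t² (g_{D_f} + 2 ϱ P + S(x¹, x³, ϱ))`, where `P` is the Schouten tensor
of `g_{D_f}` and `S = ∑ S_{ij} θ^i θ^j` over `i, j ∈ {2, 4, 6}`. -/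
def ambientOf (f : ℝ × ℝ → ℝ) (S : ℝ × ℝ → ℝ → Matrix (Fin 3) (Fin 3) ℝ) :
    (AmbientIndex 6 → ℝ) → Matrix (AmbientIndex 6) (AmbientIndex 6) ℝ :=
  ambientForm fun x ρ =>
    bryantMetric (pull13 f) x + (2 * ρ) • schouten (bryantMetric (pull13 f)) x
      + tensor246 (pull13 f) (S (proj13 x) ρ) x

/-- `Q = (Q_{ij}(x¹, x³))` is a symmetric matrix of smooth functions on `W`. -/
def IsSmoothCoeff (W : Set (ℝ × ℝ)) (Q : ℝ × ℝ → Matrix (Fin 3) (Fin 3) ℝ) : Prop :=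
  (∀ p ∈ W, (Q p).IsSymm) ∧ ∀ a b, ContDiffOn ℝ ∞ (fun p => Q p a b) W

/-- `S = (S_{ij}(x¹, x³, ϱ))` is a symmetric matrix of smooth functions on `W × (-ε, ε)`. -/
def IsSmoothFamily (W : Set (ℝ × ℝ)) (ε : ℝ)
    (S : ℝ × ℝ → ℝ → Matrix (Fin 3) (Fin 3) ℝ) : Prop :=
  (∀ p ∈ W, ∀ ρ ∈ Set.Ioo (-ε) ε, (S p ρ).IsSymm) ∧
    ∀ a b, ContDiffOn ℝ ∞ (fun q : (ℝ × ℝ) × ℝ => S q.1 q.2 a b) (W ×ˢ Set.Ioo (-ε) ε)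

/-- All `S_{ij}` satisfy `ϱ ∂²S_{ij}/∂ϱ² - 2 ∂S_{ij}/∂ϱ = 0` on `W × (-ε, ε)`. -/
def SolvesPDE (W : Set (ℝ × ℝ)) (ε : ℝ)
    (S : ℝ × ℝ → ℝ → Matrix (Fin 3) (Fin 3) ℝ) : Prop :=
  ∀ a b, ∀ p ∈ W, ∀ ρ ∈ Set.Ioo (-ε) ε,
    ρ * deriv (deriv fun r => S p r a b) ρ - 2 * deriv (fun r => S p r a b) ρ = 0

/-- The initial condition `S_{ij}(x¹, x³, 0) = 0` on `W`. -/
def VanishesInitially (W : Set (ℝ × ℝ)) (S : ℝ × ℝ → ℝ → Matrix (Fin 3) (Fin 3) ℝ) : Prop :=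
  ∀ p ∈ W, S p 0 = 0

end BryantAmbient

end

/-! Order the coframe as (θ², θ⁴, θ⁶ | θ⁵, θ¹, θ³). The metric then pairs the two halves, and the
vectors dual to the second half span a totally null field of 3-planes N, the common kernel of θ²,
θ⁴, θ⁶. Three properties of N carry the argument. It is parallel. The differentials dx¹ and dx³
annihilate it, so functions of (x¹, x³) are constant along N. In the chosen frame, differentiation
along N acts trivially on TU/N. `IsNullFrame` records this structure, and `isNullFrame_bryant`
verifies it from explicit connection matrices.

Let H be a symmetric tensor in θ², θ⁴, θ⁶ with coefficients depending on (x¹, x³, ϱ). Then g⁻¹H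
takes values in N and vanishes on N. Hence adding H to g does not change the volume form, and its
effect on the Levi-Civita connection of g(·, ϱ) lies in a single block, with values in N. In the
Ricci tensor of 2 d(ϱt) dt + t² (g + H) all terms nonlinear in H therefore drop out, as do the
derivatives of H along the base. What remains is Ric(g) + ϱ H'' - (m - 1) H', where m = 3 is half
the dimension (`frameRicci_nullAmbientConn`).

The same structure forces Ric(g) to have components only in θ², θ⁴, θ⁶
(`IsNullFrame.frameRicci_eq`), so the scalar curvature vanishes and Ric(g) = 4P. For H = 2ϱP + S the
term -2 · 2P cancels Ric(g), and Ricci-flatness becomes ϱ S'' - 2 S' = 0, the equation (*).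

Three further points complete the proof. The curvature is defined through coordinate Christoffel
symbols; `IsLeviCivitaFrame.christoffel_eq` and `IsLeviCivitaFrame.ricci_eq` transfer it to frames.
The ambient Gram matrix has complementary subspaces in duality, one of them null whatever H is, so
it has index 4 without any smallness of S. If the initial metric is e^{2φ} g, its pairing of the two
halves forces e^{2φ} = 1, hence S = 0 at ϱ = 0; the smooth solutions of (*) vanishing there are the
multiples of ϱ³ (`exists_cubic_of_ode`). -/

namespace BryantAmbient

set_option linter.unusedSectionVars false

/-! ### Coordinate partial derivatives. -/

section PartialDerivatives

variable {ι : Type*} [Fintype ι] [DecidableEq ι] {Ω : Set (ι → ℝ)} {F G : (ι → ℝ) → ℝ}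
  {x : ι → ℝ}

theorem pd_congr (hΩ : IsOpen Ω) (h : ∀ y ∈ Ω, F y = G y) (hx : x ∈ Ω) (i : ι) :
    pd i F x = pd i G x := by
  unfold pd
  rw [Filter.EventuallyEq.fderiv_eq (Filter.eventuallyEq_of_mem (hΩ.mem_nhds hx) h)]

theorem pd_const (i : ι) (c : ℝ) (x : ι → ℝ) : pd i (fun _ => c) x = 0 := by
  simp [pd]

theorem pd_add (i : ι) (hF : DifferentiableAt ℝ F x) (hG : DifferentiableAt ℝ G x) :
    pd i (fun y => F y + G y) x = pd i F x + pd i G x := by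
  unfold pd; rw [fderiv_fun_add hF hG]; rfl

theorem pd_sub (i : ι) (hF : DifferentiableAt ℝ F x) (hG : DifferentiableAt ℝ G x) :
    pd i (fun y => F y - G y) x = pd i F x - pd i G x := by
  unfold pd; rw [fderiv_fun_sub hF hG]; rfl

theorem pd_neg (i : ι) : pd i (fun y => -F y) x = -pd i F x := by
  unfold pd; rw [fderiv_fun_neg]; rfl

theorem pd_mul (i : ι) (hF : DifferentiableAt ℝ F x) (hG : DifferentiableAt ℝ G x) :
    pd i (fun y => F y * G y) x = pd i F x * G x + F x * pd i G x := by
  unfold pd; rw [fderiv_fun_mul hF hG]; simp; ring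

theorem pd_const_mul (i : ι) (c : ℝ) : pd i (fun y => c * F y) x = c * pd i F x := by
  unfold pd
  have h : (fun y => c * F y) = c • F := rfl
  rw [h, fderiv_const_smul_field]; simp

theorem pd_sum {α : Type*} (s : Finset α) {F : α → (ι → ℝ) → ℝ} (i : ι)
    (hF : ∀ a ∈ s, DifferentiableAt ℝ (F a) x) :
    pd i (fun y => ∑ a ∈ s, F a y) x = ∑ a ∈ s, pd i (F a) x := by
  unfold pd; rw [fderiv_fun_sum hF]; simp

theorem pd_coord (i j : ι) : pd i (fun y => y j) x = if i = j then 1 else 0 := by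
  unfold pd
  have : (fun y : ι → ℝ => y j) = (ContinuousLinearMap.proj j : (ι → ℝ) →L[ℝ] ℝ) := rfl
  rw [this, ContinuousLinearMap.fderiv]
  simp [Pi.single_apply, eq_comm]

theorem diffAt_of_contDiffOn (hF : ContDiffOn ℝ ∞ F Ω) (hΩ : IsOpen Ω) (hx : x ∈ Ω) :
    DifferentiableAt ℝ F x :=
  (hF.contDiffAt (hΩ.mem_nhds hx)).differentiableAt (by simp)

theorem contDiffOn_pd (hF : ContDiffOn ℝ ∞ F Ω) (hΩ : IsOpen Ω) (i : ι) :
    ContDiffOn ℝ ∞ (pd i F) Ω := by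
  have h := hF.fderiv_of_isOpen hΩ (m := ∞) (by simp)
  exact h.clm_apply contDiffOn_const

theorem pd_comm (hF : ContDiffOn ℝ ∞ F Ω) (hΩ : IsOpen Ω) (hx : x ∈ Ω) (i j : ι) :
    pd i (pd j F) x = pd j (pd i F) x := by
  have h := hF.contDiffAt (hΩ.mem_nhds hx)
  have hs : IsSymmSndFDerivAt ℝ F x := h.isSymmSndFDerivAt
    (by rw [minSmoothness_of_isRCLikeNormedField]; exact WithTop.coe_le_coe.2 (le_top : (2 : ℕ∞) ≤ ⊤))
  have hd : DifferentiableAt ℝ (fderiv ℝ F) x :=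
    (h.fderiv_right (m := ∞) (by simp)).differentiableAt (by simp)
  have key : ∀ a b : ι, pd a (pd b F) x
      = fderiv ℝ (fderiv ℝ F) x (Pi.single a 1) (Pi.single b 1) := by
    intro a b
    unfold BryantAmbient.pd
    rw [fderiv_clm_apply hd (differentiableAt_const _)]
    simp
  rw [key, key, hs]

end PartialDerivatives

/-! ### Leibniz rules for matrix-valued functions. -/

section MatrixDerivatives

variable {ι κ μ ν : Type*} [Fintype ι] [DecidableEq ι] [Fintype μ]
  {Ω : Set (ι → ℝ)} {x : ι → ℝ}

/-- The entrywise partial derivative of a matrix valued function. -/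
noncomputable def pdMat (i : ι) (A : (ι → ℝ) → Matrix κ ν ℝ) (x : ι → ℝ) : Matrix κ ν ℝ :=
  Matrix.of fun a b => pd i (fun y => A y a b) x

/-- A matrix valued function with smooth entries. -/
def SmoothMat (Ω : Set (ι → ℝ)) (A : (ι → ℝ) → Matrix κ ν ℝ) : Prop :=
  ∀ a b, ContDiffOn ℝ ∞ (fun x => A x a b) Ω

theorem SmoothMat.mul {A : (ι → ℝ) → Matrix κ μ ℝ} {B : (ι → ℝ) → Matrix μ ν ℝ}
    (hA : SmoothMat Ω A) (hB : SmoothMat Ω B) : SmoothMat Ω (fun x => A x * B x) := by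
  intro a b
  simp only [Matrix.mul_apply]
  exact ContDiffOn.sum fun k _ => (hA a k).mul (hB k b)

theorem SmoothMat.add {A B : (ι → ℝ) → Matrix κ ν ℝ}
    (hA : SmoothMat Ω A) (hB : SmoothMat Ω B) : SmoothMat Ω (fun x => A x + B x) :=
  fun a b => (hA a b).add (hB a b)

theorem SmoothMat.transpose {A : (ι → ℝ) → Matrix κ ν ℝ}
    (hA : SmoothMat Ω A) : SmoothMat Ω (fun x => (A x).transpose) :=
  fun a b => hA b a

theorem SmoothMat.pdMat {A : (ι → ℝ) → Matrix κ ν ℝ} (hΩ : IsOpen Ω)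
    (hA : SmoothMat Ω A) (i : ι) : SmoothMat Ω (BryantAmbient.pdMat i A) :=
  fun a b => contDiffOn_pd (hA a b) hΩ i

theorem pdMat_congr {A B : (ι → ℝ) → Matrix κ ν ℝ} (hΩ : IsOpen Ω)
    (h : ∀ y ∈ Ω, A y = B y) (hx : x ∈ Ω) (i : ι) : pdMat i A x = pdMat i B x := by
  ext a b
  exact pd_congr hΩ (fun y hy => by rw [h y hy]) hx i

theorem pdMat_mul {A : (ι → ℝ) → Matrix κ μ ℝ} {B : (ι → ℝ) → Matrix μ ν ℝ} (hΩ : IsOpen Ω)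
    (hA : SmoothMat Ω A) (hB : SmoothMat Ω B) (hx : x ∈ Ω) (i : ι) :
    pdMat i (fun y => A y * B y) x = pdMat i A x * B x + A x * pdMat i B x := by
  ext a b
  simp only [pdMat, Matrix.of_apply, Matrix.mul_apply, Matrix.add_apply]
  rw [pd_sum (F := fun k y => A y a k * B y k b) _ _ fun k _ =>
    (diffAt_of_contDiffOn (hA a k) hΩ hx).fun_mul (diffAt_of_contDiffOn (hB k b) hΩ hx),
    ← Finset.sum_add_distrib]
  exact Finset.sum_congr rfl fun k _ => pd_mul i (diffAt_of_contDiffOn (hA a k) hΩ hx)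
    (diffAt_of_contDiffOn (hB k b) hΩ hx)

theorem pdMat_add {A B : (ι → ℝ) → Matrix κ ν ℝ} (hΩ : IsOpen Ω)
    (hA : SmoothMat Ω A) (hB : SmoothMat Ω B) (hx : x ∈ Ω) (i : ι) :
    pdMat i (fun y => A y + B y) x = pdMat i A x + pdMat i B x := by
  ext a b
  exact pd_add i (diffAt_of_contDiffOn (hA a b) hΩ hx) (diffAt_of_contDiffOn (hB a b) hΩ hx)

end MatrixDerivatives

/-! ### Moving frames: Levi-Civita connection and Ricci tensor. -/

section Frames

variable {ι κ : Type*} [Fintype ι] [DecidableEq ι] [Fintype κ] [DecidableEq κ]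

/-- The derivative of `F` in the direction of the `c`-th vector of the frame `E`. -/
noncomputable def frameDeriv (E : (ι → ℝ) → Matrix ι κ ℝ) (c : κ) (F : (ι → ℝ) → ℝ) (x : ι → ℝ) : ℝ :=
  ∑ k, E x k c * pd k F x

/-- The matrices `γ x c` describe the Levi-Civita connection of the metric `g = eᵀ h e` in the
coframe `e` with dual frame `E`: `∇_{E_c} E_b = ∑ a, γ x c a b • E_a`. -/
structure IsLeviCivitaFrame (Ω : Set (ι → ℝ)) (g : (ι → ℝ) → Matrix ι ι ℝ)
    (e : (ι → ℝ) → Matrix κ ι ℝ) (E : (ι → ℝ) → Matrix ι κ ℝ) (h : (ι → ℝ) → Matrix κ κ ℝ)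
    (γ : (ι → ℝ) → κ → Matrix κ κ ℝ) : Prop where
  isOpen : IsOpen Ω
  smooth_coframe : SmoothMat Ω e
  smooth_frame : SmoothMat Ω E
  smooth_gram : SmoothMat Ω h
  smooth_conn : ∀ c, SmoothMat Ω fun x => γ x c
  frame_mul_coframe : ∀ x ∈ Ω, E x * e x = 1
  coframe_mul_frame : ∀ x ∈ Ω, e x * E x = 1
  metric_eq : ∀ x ∈ Ω, g x = (e x).transpose * h x * e x
  gram_symm : ∀ x ∈ Ω, (h x).transpose = h x
  isUnit_det : ∀ x ∈ Ω, IsUnit (g x).det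
  compatible : ∀ x ∈ Ω, ∀ c a b, frameDeriv E c (fun y => h y a b) x =
    (h x * γ x c + (γ x c).transpose * h x) a b
  torsionFree : ∀ x ∈ Ω, ∀ a i j, pd i (fun y => e y a j) x - pd j (fun y => e y a i) x =
    ∑ c, ∑ d, e x c i * e x d j * (γ x d a c - γ x c a d)

/-- The components of the Ricci tensor in a frame, in terms of the connection matrices. -/
noncomputable def frameRicci (E : (ι → ℝ) → Matrix ι κ ℝ) (γ : (ι → ℝ) → κ → Matrix κ κ ℝ) (x : ι → ℝ) :
    Matrix κ κ ℝ :=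
  Matrix.of fun b d => ∑ a, frameDeriv E a (fun y => γ y d a b) x
    - frameDeriv E d (fun y => ∑ a, γ y a a b) x
    + ∑ c, (∑ a, γ x a a c) * γ x d c b - ∑ a, ∑ c, γ x a c d * γ x c a b

/-- The connection matrices in the direction of the `i`-th coordinate. -/
noncomputable def connForm (e : (ι → ℝ) → Matrix κ ι ℝ) (γ : (ι → ℝ) → κ → Matrix κ κ ℝ) (i : ι) (x : ι → ℝ) :
    Matrix κ κ ℝ :=
  ∑ c, e x c i • γ x c

/-- The Christoffel symbols obtained from the connection matrices by a change of frame. -/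
noncomputable def frameChristoffel (e : (ι → ℝ) → Matrix κ ι ℝ) (E : (ι → ℝ) → Matrix ι κ ℝ)
    (γ : (ι → ℝ) → κ → Matrix κ κ ℝ) (i : ι) (x : ι → ℝ) : Matrix ι ι ℝ :=
  E x * (pdMat i e x + connForm e γ i x * e x)

variable {Ω : Set (ι → ℝ)} {g : (ι → ℝ) → Matrix ι ι ℝ} {e : (ι → ℝ) → Matrix κ ι ℝ}
  {E : (ι → ℝ) → Matrix ι κ ℝ} {h : (ι → ℝ) → Matrix κ κ ℝ} {γ : (ι → ℝ) → κ → Matrix κ κ ℝ}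
  {x : ι → ℝ}

theorem connForm_apply (i : ι) (a b : κ) :
    connForm e γ i x a b = ∑ c, e x c i * γ x c a b := by
  simp [connForm, Matrix.sum_apply]

theorem pd_eq_sum_frameDeriv (hEe : E x * e x = 1) (F : (ι → ℝ) → ℝ) (i : ι) :
    pd i F x = ∑ c, e x c i * frameDeriv E c F x := by
  have h1 : ∀ k, ∑ c, E x k c * e x c i = if k = i then 1 else 0 := fun k => by
    rw [← Matrix.mul_apply, hEe, Matrix.one_apply]
  simp only [frameDeriv, Finset.mul_sum]
  rw [Finset.sum_comm]
  have h2 : ∀ k, ∑ c, e x c i * (E x k c * pd k F x) = (if k = i then 1 else 0) * pd k F x := by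
    intro k
    rw [← h1 k, Finset.sum_mul]
    exact Finset.sum_congr rfl fun c _ => by ring
  simp [h2]

theorem frameDeriv_congr {F G : (ι → ℝ) → ℝ} (hΩ : IsOpen Ω) (h : ∀ y ∈ Ω, F y = G y)
    (hx : x ∈ Ω) (c : κ) : frameDeriv E c F x = frameDeriv E c G x :=
  Finset.sum_congr rfl fun k _ => by rw [pd_congr hΩ h hx k]

namespace IsLeviCivitaFrame

variable (H : IsLeviCivitaFrame Ω g e E h γ)
include H

theorem smooth_connForm (i : ι) : SmoothMat Ω (connForm e γ i) := by
  intro a b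
  simp only [connForm_apply]
  exact ContDiffOn.sum fun c _ => (H.smooth_coframe c i).mul (H.smooth_conn c a b)

theorem coframe_mul_frameChristoffel (hx : x ∈ Ω) (i : ι) :
    e x * frameChristoffel e E γ i x = pdMat i e x + connForm e γ i x * e x := by
  rw [frameChristoffel, ← Matrix.mul_assoc, H.coframe_mul_frame x hx, Matrix.one_mul]

/-- Torsion-freeness in the coframe says exactly that ∂ᵢeⱼ + ωᵢeⱼ is symmetric in i and j;
multiplying by `E` preserves this. -/
theorem frameChristoffel_symm (hx : x ∈ Ω) (i j k : ι) :
    frameChristoffel e E γ i x k j = frameChristoffel e E γ j x k i := by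
  simp only [frameChristoffel, Matrix.mul_apply (M := E x)]
  refine Finset.sum_congr rfl fun a _ => ?_
  congr 1
  have ht := H.torsionFree x hx a i j
  simp only [Matrix.add_apply, pdMat, Matrix.of_apply, Matrix.mul_apply, connForm_apply,
    Finset.sum_mul]
  have h1 : ∑ c, ∑ d, e x c i * e x d j * (γ x d a c - γ x c a d) =
      ∑ b, ∑ c, e x c j * γ x c a b * e x b i - ∑ b, ∑ c, e x c i * γ x c a b * e x b j := by
    rw [Finset.sum_comm (f := fun b c => e x c i * γ x c a b * e x b j), ← Finset.sum_sub_distrib]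
    refine Finset.sum_congr rfl fun c _ => ?_
    rw [← Finset.sum_sub_distrib]
    exact Finset.sum_congr rfl fun d _ => by ring
  linarith

theorem pdMat_gram (hx : x ∈ Ω) (i : ι) :
    pdMat i h x = h x * connForm e γ i x + (connForm e γ i x).transpose * h x := by
  ext a b
  simp only [pdMat, Matrix.of_apply]
  rw [pd_eq_sum_frameDeriv (H.frame_mul_coframe x hx)]
  simp only [H.compatible x hx]
  simp only [connForm, Matrix.transpose_sum, Matrix.transpose_smul, Finset.mul_sum, Finset.sum_mul,
    Matrix.mul_smul, Matrix.smul_mul, Matrix.add_apply,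
    Matrix.sum_apply, Matrix.smul_apply, smul_eq_mul, mul_add, Finset.sum_add_distrib]

theorem metric_symm (hx : x ∈ Ω) (i j : ι) : g x i j = g x j i := by
  have : (g x).transpose = g x := by
    rw [H.metric_eq x hx]
    simp [Matrix.transpose_mul, H.gram_symm x hx, Matrix.mul_assoc]
  exact congrFun (congrFun this j) i

/-- In the derivative of eᵀhe, replace ∂e by eΓ - ωe. The terms in ω cancel against those produced
by compatibility with `h`, leaving metric compatibility in coordinates. -/
theorem pdMat_metric (hx : x ∈ Ω) (i : ι) :
    pdMat i g x = g x * frameChristoffel e E γ i x + (frameChristoffel e E γ i x).transpose * g x := by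
  have h1 : pdMat i g x = pdMat i (fun y => (e y).transpose * h y * e y) x :=
    pdMat_congr H.isOpen H.metric_eq hx i
  have h2 : pdMat i (fun y => (e y).transpose) x = (pdMat i e x).transpose := rfl
  have h3 := H.coframe_mul_frameChristoffel hx i
  have h4 : pdMat i e x = e x * frameChristoffel e E γ i x - connForm e γ i x * e x := by
    rw [h3]; abel
  rw [h1, pdMat_mul H.isOpen (H.smooth_coframe.transpose.mul H.smooth_gram) H.smooth_coframe hx,
    pdMat_mul H.isOpen H.smooth_coframe.transpose H.smooth_gram hx, h2, H.pdMat_gram hx,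
    H.metric_eq x hx, h4]
  simp only [Matrix.transpose_sub, Matrix.transpose_mul, Matrix.add_mul, Matrix.mul_add,
    Matrix.sub_mul, Matrix.mul_sub, Matrix.mul_assoc]
  abel

/-- Uniqueness of the Levi-Civita connection: inserting ∂g = gΓ + Γᵀg into the Koszul formula and
using the symmetry of Γ, four of the six terms cancel and the other two agree. -/
theorem christoffel_eq (hx : x ∈ Ω) (k i j : ι) :
    christoffel g k i j x = frameChristoffel e E γ i x k j := by
  have hp : ∀ i j l, pd i (fun z => g z j l) x =
      ∑ m, g x j m * frameChristoffel e E γ i x m l +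
        ∑ m, frameChristoffel e E γ i x m j * g x m l := by
    intro i j l
    have := congrFun (congrFun (H.pdMat_metric hx i) j) l
    simpa [pdMat, Matrix.mul_apply] using this
  have hsum : ∀ l, pd i (fun z => g z j l) x + pd j (fun z => g z i l) x
      - pd l (fun z => g z i j) x = 2 * ∑ m, g x l m * frameChristoffel e E γ i x m j := by
    intro l
    simp only [hp]
    have e1 : ∀ m, frameChristoffel e E γ l x m j = frameChristoffel e E γ j x m l :=
      fun m => H.frameChristoffel_symm hx l j m
    have e2 : ∀ m, frameChristoffel e E γ l x m i = frameChristoffel e E γ i x m l :=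
      fun m => H.frameChristoffel_symm hx l i m
    have e3 : ∀ m, frameChristoffel e E γ j x m i = frameChristoffel e E γ i x m j :=
      fun m => H.frameChristoffel_symm hx j i m
    have e4 : ∀ m, g x m l = g x l m := fun m => H.metric_symm hx m l
    have e5 : ∀ m, g x m j = g x j m := fun m => H.metric_symm hx m j
    simp only [e1, e2, e3, e4, e5]
    have e6 : ∑ m, g x j m * frameChristoffel e E γ i x m l =
        ∑ m, frameChristoffel e E γ i x m l * g x j m :=
      Finset.sum_congr rfl fun m _ => mul_comm _ _
    have e7 : ∑ m, frameChristoffel e E γ i x m j * g x l m =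
        ∑ m, g x l m * frameChristoffel e E γ i x m j :=
      Finset.sum_congr rfl fun m _ => mul_comm _ _
    rw [e6, e7]
    ring
  simp only [christoffel, hsum]
  have : ∀ m, ∑ l, (g x)⁻¹ k l * g x l m = if k = m then 1 else 0 := fun m => by
    rw [← Matrix.mul_apply, Matrix.nonsing_inv_mul _ (H.isUnit_det x hx), Matrix.one_apply]
  have e8 : ∑ l, (g x)⁻¹ k l * (2 * ∑ m, g x l m * frameChristoffel e E γ i x m j) =
      2 * ∑ m, (∑ l, (g x)⁻¹ k l * g x l m) * frameChristoffel e E γ i x m j := by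
    simp only [Finset.mul_sum, Finset.sum_mul]
    rw [Finset.sum_comm]
    exact Finset.sum_congr rfl fun m _ => Finset.sum_congr rfl fun l _ => by ring
  rw [e8]
  simp [this]

theorem smooth_frameChristoffel (i : ι) : SmoothMat Ω (frameChristoffel e E γ i) :=
  H.smooth_frame.mul ((H.smooth_coframe.pdMat H.isOpen i).add
    ((H.smooth_connForm i).mul H.smooth_coframe))

/-- Differentiate eΓᵢ = ∂ᵢe + ωᵢe and eliminate each ∂ⱼe by the same identity. -/
theorem pdMat_frameChristoffel (hx : x ∈ Ω) (i j : ι) :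
    e x * pdMat j (frameChristoffel e E γ i) x =
      pdMat j (pdMat i e) x + pdMat j (connForm e γ i) x * e x
        + connForm e γ i x * e x * frameChristoffel e E γ j x
        - connForm e γ i x * connForm e γ j x * e x
        - e x * frameChristoffel e E γ j x * frameChristoffel e E γ i x
        + connForm e γ j x * e x * frameChristoffel e E γ i x := by
  have h1 : pdMat j (fun y => e y * frameChristoffel e E γ i y) x =
      pdMat j (fun y => pdMat i e y + connForm e γ i y * e y) x :=
    pdMat_congr H.isOpen (fun y hy => H.coframe_mul_frameChristoffel hy i) hx j
  rw [pdMat_mul H.isOpen H.smooth_coframe (H.smooth_frameChristoffel i) hx,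
    pdMat_add H.isOpen (H.smooth_coframe.pdMat H.isOpen i)
      ((H.smooth_connForm i).mul H.smooth_coframe) hx,
    pdMat_mul H.isOpen (H.smooth_connForm i) H.smooth_coframe hx] at h1
  have h4 : pdMat j e x = e x * frameChristoffel e E γ j x - connForm e γ j x * e x := by
    rw [H.coframe_mul_frameChristoffel hx j]; abel
  rw [h4] at h1
  have h5 := eq_sub_of_add_eq' h1
  rw [h5]
  simp only [Matrix.sub_mul, Matrix.mul_sub, Matrix.mul_assoc]
  abel

/-- Curvature is tensorial: Γ and ω are related by the gauge transformation `e`. After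
antisymmetrization the second derivatives of `e` cancel, as do the mixed products of Γ and ω. -/
theorem curvature_eq (hx : x ∈ Ω) (k j : ι) :
    pdMat k (frameChristoffel e E γ j) x - pdMat j (frameChristoffel e E γ k) x
      + frameChristoffel e E γ k x * frameChristoffel e E γ j x
      - frameChristoffel e E γ j x * frameChristoffel e E γ k x =
    E x * (pdMat k (connForm e γ j) x - pdMat j (connForm e γ k) x
      + connForm e γ k x * connForm e γ j x - connForm e γ j x * connForm e γ k x) * e x := by
  have hc : pdMat k (pdMat j e) x = pdMat j (pdMat k e) x := by
    ext a b
    exact pd_comm (H.smooth_coframe a b) H.isOpen hx k j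
  have key : e x * (pdMat k (frameChristoffel e E γ j) x - pdMat j (frameChristoffel e E γ k) x
      + frameChristoffel e E γ k x * frameChristoffel e E γ j x
      - frameChristoffel e E γ j x * frameChristoffel e E γ k x) =
    (pdMat k (connForm e γ j) x - pdMat j (connForm e γ k) x
      + connForm e γ k x * connForm e γ j x - connForm e γ j x * connForm e γ k x) * e x := by
    simp only [Matrix.mul_sub, Matrix.mul_add, H.pdMat_frameChristoffel hx, hc,
      Matrix.sub_mul, Matrix.add_mul, Matrix.mul_assoc]
    abel
  rw [Matrix.mul_assoc, ← key, ← Matrix.mul_assoc, H.frame_mul_coframe x hx, Matrix.one_mul]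

/-- The curvature of the connection in the frame. -/
theorem connForm_curvature (hx : x ∈ Ω) (k j : ι) (a b : κ) :
    (pdMat k (connForm e γ j) x - pdMat j (connForm e γ k) x
      + connForm e γ k x * connForm e γ j x - connForm e γ j x * connForm e γ k x) a b =
    ∑ p, e x p k * ∑ q, e x q j * (frameDeriv E p (fun y => γ y q a b) x
      - frameDeriv E q (fun y => γ y p a b) x
      + ∑ c, (γ x p a c * γ x q c b - γ x q a c * γ x p c b)
      + ∑ d, (γ x q d p - γ x p d q) * γ x d a b) := by
  have hpd : ∀ k j, pd k (fun y => connForm e γ j y a b) x =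
      ∑ d, (pd k (fun y => e y d j) x * γ x d a b + e x d j * pd k (fun y => γ y d a b) x) := by
    intro k j
    simp only [connForm_apply]
    rw [pd_sum (F := fun d y => e y d j * γ y d a b) _ _ fun d _ =>
      (diffAt_of_contDiffOn (H.smooth_coframe d j) H.isOpen hx).fun_mul
        (diffAt_of_contDiffOn (H.smooth_conn d a b) H.isOpen hx)]
    exact Finset.sum_congr rfl fun d _ =>
      pd_mul k (diffAt_of_contDiffOn (H.smooth_coframe d j) H.isOpen hx)
        (diffAt_of_contDiffOn (H.smooth_conn d a b) H.isOpen hx)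
  -- The derivatives falling on the coframe combine into its exterior derivative, which
  -- torsion-freeness turns into the bracket term of the curvature.
  have t1 : ∑ d, pd k (fun y => e y d j) x * γ x d a b
      - ∑ d, pd j (fun y => e y d k) x * γ x d a b =
      ∑ p, e x p k * ∑ q, e x q j * ∑ d, (γ x q d p - γ x p d q) * γ x d a b := by
    rw [← Finset.sum_sub_distrib]
    simp only [← sub_mul, H.torsionFree x hx, Finset.mul_sum, Finset.sum_mul]
    rw [Finset.sum_comm]
    refine Finset.sum_congr rfl fun p _ => ?_
    rw [Finset.sum_comm]
    exact Finset.sum_congr rfl fun q _ => Finset.sum_congr rfl fun d _ => by ring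
  have t2 : ∑ d, e x d j * pd k (fun y => γ y d a b) x =
      ∑ p, e x p k * ∑ q, e x q j * frameDeriv E p (fun y => γ y q a b) x := by
    simp only [pd_eq_sum_frameDeriv (H.frame_mul_coframe x hx) _ k, Finset.mul_sum]
    rw [Finset.sum_comm]
    exact Finset.sum_congr rfl fun q _ => Finset.sum_congr rfl fun d _ => by ring
  have t3 : ∑ d, e x d k * pd j (fun y => γ y d a b) x =
      ∑ p, e x p k * ∑ q, e x q j * frameDeriv E q (fun y => γ y p a b) x := by
    simp only [pd_eq_sum_frameDeriv (H.frame_mul_coframe x hx) _ j]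
  have t4 : (connForm e γ k x * connForm e γ j x) a b - (connForm e γ j x * connForm e γ k x) a b =
      ∑ p, e x p k * ∑ q, e x q j * ∑ c, (γ x p a c * γ x q c b - γ x q a c * γ x p c b) := by
    simp only [Matrix.mul_apply, connForm_apply, Finset.mul_sum, Finset.sum_mul,
      ← Finset.sum_sub_distrib]
    have l1 : ∀ u v : ι, ∑ c, ∑ q, ∑ p, (e x p u * γ x p a c) * (e x q v * γ x q c b) =
        ∑ p, ∑ q, ∑ c, (e x p u * γ x p a c) * (e x q v * γ x q c b) := by
      intro u v
      rw [Finset.sum_comm_cycle]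
      refine Finset.sum_congr rfl fun p _ => ?_
      rw [Finset.sum_comm]
    have l2 := l1 k j
    have l3 := l1 j k
    simp only [Finset.sum_sub_distrib, mul_sub]
    rw [l2, l3, Finset.sum_comm (f := fun p q => ∑ c, e x p j * γ x p a c * (e x q k * γ x q c b))]
    simp only [mul_assoc, mul_left_comm]
  simp only [Matrix.sub_apply, Matrix.add_apply, pdMat, Matrix.of_apply, hpd,
    Finset.sum_add_distrib, mul_add, mul_sub, Finset.sum_sub_distrib] at *
  linarith

/-- The coordinate Ricci tensor is the trace of the curvature matrices. Conjugation by `e` and `E`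
turns this into the trace in the frame. -/
theorem ricci_eq (hx : x ∈ Ω) : ricci g x = (e x).transpose * frameRicci E γ x * e x := by
  ext i j
  have hsymm : ∀ k i j, ∀ y ∈ Ω, christoffel g k i j y = frameChristoffel e E γ j y k i :=
    fun k i j y hy => by rw [H.christoffel_eq hy, H.frameChristoffel_symm hy]
  have h1 : ricci g x i j = ∑ k, (pdMat k (frameChristoffel e E γ j) x
      - pdMat j (frameChristoffel e E γ k) x
      + frameChristoffel e E γ k x * frameChristoffel e E γ j x
      - frameChristoffel e E γ j x * frameChristoffel e E γ k x) k i := by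
    simp only [ricci, Matrix.of_apply]
    refine Finset.sum_congr rfl fun k _ => ?_
    rw [pd_congr H.isOpen (hsymm k i j) hx, pd_congr H.isOpen (hsymm k i k) hx]
    simp only [Matrix.sub_apply, Matrix.add_apply, Matrix.mul_apply, pdMat, Matrix.of_apply,
      Finset.sum_sub_distrib, H.christoffel_eq hx]
    have a1 : ∀ l, frameChristoffel e E γ i x l j = frameChristoffel e E γ j x l i :=
      fun l => H.frameChristoffel_symm hx i j l
    have a2 : ∀ l, frameChristoffel e E γ i x l k = frameChristoffel e E γ k x l i :=
      fun l => H.frameChristoffel_symm hx i k l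
    simp only [a1, a2]
    ring
  have hδ : ∀ a p, ∑ k, E x k a * e x p k = if p = a then 1 else 0 := fun a p => by
    have := congrFun (congrFun (H.coframe_mul_frame x hx) p) a
    rw [Matrix.mul_apply, Matrix.one_apply] at this
    rw [← this]
    exact Finset.sum_congr rfl fun k _ => mul_comm _ _
  rw [h1]
  simp only [H.curvature_eq hx]
  simp only [Matrix.mul_apply (N := e x), Matrix.mul_apply (M := E x), H.connForm_curvature hx]
  set Cv : κ → κ → κ → κ → ℝ := fun p q a b => frameDeriv E p (fun y => γ y q a b) x
      - frameDeriv E q (fun y => γ y p a b) x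
      + ∑ c, (γ x p a c * γ x q c b - γ x q a c * γ x p c b)
      + ∑ d, (γ x q d p - γ x p d q) * γ x d a b with hCv
  have hR : ∀ b q, ∑ a, Cv a q a b = frameRicci E γ x b q := by
    intro b q
    simp only [hCv, frameRicci, Matrix.of_apply, Finset.sum_add_distrib, Finset.sum_sub_distrib,
      sub_mul]
    have r1 : ∑ a, frameDeriv E q (fun y => γ y a a b) x =
        frameDeriv E q (fun y => ∑ a, γ y a a b) x := by
      simp only [frameDeriv]
      rw [Finset.sum_comm]
      refine Finset.sum_congr rfl fun k _ => ?_
      rw [pd_sum (F := fun a y => γ y a a b) _ _ fun a _ =>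
        diffAt_of_contDiffOn (H.smooth_conn a a b) H.isOpen hx, Finset.mul_sum]
    have r2 : ∑ a, ∑ c, γ x a a c * γ x q c b = ∑ c, (∑ a, γ x a a c) * γ x q c b := by
      rw [Finset.sum_comm]
      simp only [Finset.sum_mul]
    -- One of the commutator terms and one of the bracket terms are equal up to exchanging the two
    -- summation indices. They enter with opposite signs, which is why `frameRicci` has a single
    -- subtracted quadratic sum.
    have r3 : ∑ a, ∑ c, γ x q a c * γ x a c b = ∑ a, ∑ c, γ x q c a * γ x c a b :=
      Finset.sum_comm
    rw [r1, r2, r3]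
    ring
  have hk : ∀ a b, ∑ k, E x k a * ∑ p, e x p k * ∑ q, e x q j * Cv p q a b =
      ∑ q, e x q j * Cv a q a b := by
    intro a b
    have hm : ∀ k, E x k a * ∑ p, e x p k * ∑ q, e x q j * Cv p q a b =
        ∑ p, E x k a * e x p k * ∑ q, e x q j * Cv p q a b := fun k => by
      rw [Finset.mul_sum]
      exact Finset.sum_congr rfl fun p _ => (mul_assoc _ _ _).symm
    rw [Finset.sum_congr rfl fun k _ => hm k, Finset.sum_comm]
    simp only [← Finset.sum_mul, hδ]
    simp
  calc ∑ k, ∑ b, (∑ a, E x k a * ∑ p, e x p k * ∑ q, e x q j * Cv p q a b) * e x b i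
      = ∑ b, (∑ a, ∑ k, E x k a * ∑ p, e x p k * ∑ q, e x q j * Cv p q a b) * e x b i := by
        rw [Finset.sum_comm]
        refine Finset.sum_congr rfl fun b _ => ?_
        rw [← Finset.sum_mul, Finset.sum_comm]
    _ = ∑ b, (∑ q, e x q j * ∑ a, Cv a q a b) * e x b i := by
        refine Finset.sum_congr rfl fun b _ => ?_
        rw [Finset.sum_congr rfl fun a _ => hk a b, Finset.sum_comm]
        simp only [Finset.mul_sum]
    _ = _ := by
        simp only [hR, Matrix.mul_apply, Matrix.transpose_apply, Finset.sum_mul]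
        rw [Finset.sum_comm]
        exact Finset.sum_congr rfl fun q _ => Finset.sum_congr rfl fun b _ => by ring

end IsLeviCivitaFrame

end Frames

/-! ### Non-degenerate forms of split signature. -/

section Index

variable {ι α : Type*} [Fintype ι] [DecidableEq ι] [Fintype α] [DecidableEq α]

theorem HasIndex.isUnit_det {A : Matrix ι ι ℝ} {k : ℕ} (h : HasIndex A k) : IsUnit A.det := by
  obtain ⟨M, σ, -, hσ, -, hA⟩ := h
  have h1 := congrArg Matrix.det hA
  rw [Matrix.det_mul, Matrix.det_mul, Matrix.det_diagonal] at h1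
  have h2 : ∏ i, σ i ≠ 0 := Finset.prod_ne_zero_iff.2 fun i _ => by
    rcases hσ i with h | h <;> rw [h] <;> norm_num
  rw [isUnit_iff_ne_zero]
  rintro h0
  rw [h0] at h1
  exact h2 (by rw [← h1]; ring)

/-- A symmetric form on a space which is the direct sum of an isotropic subspace (spanned by the
columns of `Q`) and of a subspace in duality with it has split signature. -/
theorem hasIndex_of_isotropic {A : Matrix ι ι ℝ} (P Q : Matrix ι α ℝ) (s : ι ≃ α ⊕ α)
    (hA : A.transpose = A) (hPQ : P.transpose * A * Q = 1) (hQQ : Q.transpose * A * Q = 0) :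
    HasIndex A (Fintype.card α) := by
  set X := P.transpose * A * P with hX
  have hXt : X.transpose = X := by
    rw [hX]; simp [Matrix.transpose_mul, hA, Matrix.mul_assoc]
  have hQP : Q.transpose * A * P = 1 := by
    have := congrArg Matrix.transpose hPQ
    simpa [Matrix.transpose_mul, hA, Matrix.mul_assoc] using this
  have form : ∀ Y Z : Matrix α α ℝ, (P + Q * Y).transpose * A * (P + Q * Z) =
      X + Z + Y.transpose := by
    intro Y Z
    have : (P + Q * Y).transpose * A * (P + Q * Z) =
        P.transpose * A * P + P.transpose * A * Q * Z + Y.transpose * (Q.transpose * A * P)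
          + Y.transpose * (Q.transpose * A * Q) * Z := by
      simp only [Matrix.transpose_add, Matrix.transpose_mul, Matrix.add_mul, Matrix.mul_add,
        Matrix.mul_assoc]
      abel
    rw [this, hPQ, hQP, hQQ]
    simp [hX]
  -- The columns of P + QY and P + QZ have Gram blocks X + Y + Yᵀ, X + Z + Zᵀ and X + Z + Yᵀ. These
  -- symmetric choices make them 1, -1 and 0.
  set Y := (1 / 2 : ℝ) • (1 - X) with hY
  set Z := (1 / 2 : ℝ) • (-1 - X) with hZ
  set N : Matrix ι (α ⊕ α) ℝ := Matrix.fromCols (P + Q * Y) (P + Q * Z) with hN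
  set τ : α ⊕ α → ℝ := Sum.elim (fun _ => 1) (fun _ => -1) with hτ
  have hND : N.transpose * A * N = Matrix.diagonal τ := by
    rw [hN, Matrix.transpose_fromCols, Matrix.fromRows_mul, Matrix.fromRows_mul_fromCols]
    simp only [form]
    rw [hτ, ← Matrix.fromBlocks_diagonal]
    congr 1
    · simp only [hY, Matrix.transpose_smul, Matrix.transpose_sub, Matrix.transpose_one, hXt]
      ext i j
      simp [Matrix.one_apply, Matrix.diagonal_apply]
      ring
    · simp only [hY, hZ, Matrix.transpose_smul, Matrix.transpose_sub, Matrix.transpose_one, hXt]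
      ext i j
      simp [Matrix.one_apply]
      ring
    · simp only [hY, hZ, Matrix.transpose_smul, Matrix.transpose_sub, Matrix.transpose_neg,
        Matrix.transpose_one, hXt]
      ext i j
      simp [Matrix.one_apply]
      ring
    · simp only [hZ, Matrix.transpose_smul, Matrix.transpose_sub, Matrix.transpose_neg,
        Matrix.transpose_one, hXt]
      ext i j
      simp [Matrix.one_apply, Matrix.diagonal_apply]
      split_ifs <;> ring
  set M : Matrix ι ι ℝ := N.submatrix id s with hM
  have hMD : M.transpose * A * M = Matrix.diagonal fun i => τ (s i) := by
    have : M.transpose * A * M = (N.transpose * A * N).submatrix s s := by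
      ext i j
      simp [hM, Matrix.mul_apply]
    rw [this, hND, Matrix.submatrix_diagonal_equiv]
    rfl
  have hτ1 : ∀ i, τ i = 1 ∨ τ i = -1 := by
    rintro (i | i) <;> simp [hτ]
  refine ⟨M, fun i => τ (s i), ?_, fun i => hτ1 _, ?_, hMD⟩
  · have h1 := congrArg Matrix.det hMD
    rw [Matrix.det_mul, Matrix.det_mul, Matrix.det_diagonal] at h1
    have h2 : ∏ i, τ (s i) ≠ 0 := Finset.prod_ne_zero_iff.2 fun i _ => by
      rcases hτ1 (s i) with h | h <;> rw [h] <;> norm_num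
    rw [isUnit_iff_ne_zero]
    intro h0
    rw [h0] at h1
    exact h2 (by rw [← h1]; ring)
  · have h3 : {i | τ (s i) = -1} = s ⁻¹' (Set.range Sum.inr) := by
      ext i
      rcases h : s i with a | a
      · simp [h, hτ]; norm_num
      · simp [h, hτ]
    rw [h3, Set.ncard_preimage_of_injective_subset_range s.injective
      (by simp [s.surjective.range_eq]), ← Set.image_univ,
      Set.ncard_image_of_injective _ Sum.inr_injective, Set.ncard_univ, Nat.card_eq_fintype_card]

end Index

/-! ### Functions of a subset of the coordinates. -/

section Basic

variable {ι : Type*} [Fintype ι] [DecidableEq ι] {Ω : Set (ι → ℝ)} {J : Set ι}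
  {F G : (ι → ℝ) → ℝ}

/-- A smooth function on `Ω` which locally depends only on the coordinates in `J`. -/
structure IsBasic (Ω : Set (ι → ℝ)) (J : Set ι) (F : (ι → ℝ) → ℝ) : Prop where
  smooth : ContDiffOn ℝ ∞ F Ω
  pd_eq_zero : ∀ x ∈ Ω, ∀ i ∉ J, pd i F x = 0

theorem IsBasic.diffAt (hF : IsBasic Ω J F) (hΩ : IsOpen Ω) {x : ι → ℝ} (hx : x ∈ Ω) :
    DifferentiableAt ℝ F x := diffAt_of_contDiffOn hF.smooth hΩ hx

theorem isBasic_const (c : ℝ) : IsBasic Ω J fun _ => c :=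
  ⟨contDiffOn_const, fun x _ i _ => pd_const i c x⟩

theorem IsBasic.add (hΩ : IsOpen Ω) (hF : IsBasic Ω J F) (hG : IsBasic Ω J G) :
    IsBasic Ω J fun x => F x + G x :=
  ⟨hF.smooth.add hG.smooth, fun x hx i hi => by
    rw [pd_add i (hF.diffAt hΩ hx) (hG.diffAt hΩ hx), hF.pd_eq_zero x hx i hi,
      hG.pd_eq_zero x hx i hi, add_zero]⟩

theorem IsBasic.sub (hΩ : IsOpen Ω) (hF : IsBasic Ω J F) (hG : IsBasic Ω J G) :
    IsBasic Ω J fun x => F x - G x :=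
  ⟨hF.smooth.sub hG.smooth, fun x hx i hi => by
    rw [pd_sub i (hF.diffAt hΩ hx) (hG.diffAt hΩ hx), hF.pd_eq_zero x hx i hi,
      hG.pd_eq_zero x hx i hi, sub_zero]⟩

theorem IsBasic.mul (hΩ : IsOpen Ω) (hF : IsBasic Ω J F) (hG : IsBasic Ω J G) :
    IsBasic Ω J fun x => F x * G x :=
  ⟨hF.smooth.mul hG.smooth, fun x hx i hi => by
    rw [pd_mul i (hF.diffAt hΩ hx) (hG.diffAt hΩ hx), hF.pd_eq_zero x hx i hi,
      hG.pd_eq_zero x hx i hi]; ring⟩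

theorem IsBasic.sum (hΩ : IsOpen Ω) {α : Type*} {s : Finset α} {F : α → (ι → ℝ) → ℝ}
    (hF : ∀ a ∈ s, IsBasic Ω J (F a)) : IsBasic Ω J fun x => ∑ a ∈ s, F a x :=
  ⟨ContDiffOn.sum fun a ha => (hF a ha).smooth, fun x hx i hi => by
    rw [pd_sum s i fun a ha => (hF a ha).diffAt hΩ hx]
    exact Finset.sum_eq_zero fun a ha => (hF a ha).pd_eq_zero x hx i hi⟩

theorem IsBasic.congr (hΩ : IsOpen Ω) (hF : IsBasic Ω J F) (h : ∀ x ∈ Ω, G x = F x) :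
    IsBasic Ω J G :=
  ⟨hF.smooth.congr h, fun x hx i hi => by
    rw [pd_congr hΩ h hx, hF.pd_eq_zero x hx i hi]⟩

/-- Since partial derivatives commute, differentiation in any direction keeps a function independent
of the remaining coordinates. -/
theorem IsBasic.pd (hΩ : IsOpen Ω) (hF : IsBasic Ω J F) (j : ι) : IsBasic Ω J (pd j F) :=
  ⟨contDiffOn_pd hF.smooth hΩ j, fun x hx i hi => by
    rw [pd_comm hF.smooth hΩ hx, pd_congr hΩ (fun y hy => hF.pd_eq_zero y hy i hi) hx, pd_const]⟩

end Basic

/-! ### Frames adapted to a parallel null distribution. -/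

section NullFrame

variable {ι α : Type*} [Fintype ι] [DecidableEq ι] [Fintype α] [DecidableEq α]

/-- The split form on `ℝ^α ⊕ ℝ^α` pairing the two summands. -/
def splitForm (α : Type*) [DecidableEq α] : Matrix (α ⊕ α) (α ⊕ α) ℝ := Matrix.fromBlocks 0 1 1 0

/-- A coframe `e` with dual frame `E` and with Levi-Civita connection `γ` for the metric
`eᵀ * splitForm * e`, such that the isotropic distribution spanned by the second half of the frame
is parallel and the coefficients depend only on coordinates (those in `J`) that are constant along
that distribution. -/
structure IsNullFrame (U : Set (ι → ℝ)) (J : Set ι) (e : (ι → ℝ) → Matrix (α ⊕ α) ι ℝ)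
    (E : (ι → ℝ) → Matrix ι (α ⊕ α) ℝ) (γ : (ι → ℝ) → α ⊕ α → Matrix (α ⊕ α) (α ⊕ α) ℝ) : Prop where
  isOpen : IsOpen U
  smooth_coframe : SmoothMat U e
  smooth_frame : SmoothMat U E
  frame_mul_coframe : ∀ x ∈ U, E x * e x = 1
  coframe_mul_frame : ∀ x ∈ U, e x * E x = 1
  torsionFree : ∀ x ∈ U, ∀ a i j, pd i (fun y => e y a j) x - pd j (fun y => e y a i) x =
    ∑ c, ∑ d, e x c i * e x d j * (γ x d a c - γ x c a d)
  skew : ∀ x ∈ U, ∀ c, splitForm α * γ x c + (γ x c).transpose * splitForm α = 0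
  parallel : ∀ x ∈ U, ∀ c a b, γ x c (.inl a) (.inr b) = 0
  flat : ∀ x ∈ U, ∀ c a b, γ x (.inr c) (.inl a) (.inl b) = 0
  basic_conn : ∀ c a b, IsBasic U J fun x => γ x c a b
  basic_frame : ∀ k ∈ J, ∀ c, IsBasic U J fun x => E x k (.inl c)
  frame_inr : ∀ x ∈ U, ∀ k ∈ J, ∀ c, E x k (.inr c) = 0

variable {U : Set (ι → ℝ)} {J : Set ι} {e : (ι → ℝ) → Matrix (α ⊕ α) ι ℝ}
    {E : (ι → ℝ) → Matrix ι (α ⊕ α) ℝ} {γ : (ι → ℝ) → α ⊕ α → Matrix (α ⊕ α) (α ⊕ α) ℝ}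

/-- In every coordinate direction one factor vanishes: the component of the frame vector if the
coordinate lies in `J`, the derivative of `F` otherwise. Applied to the null half of the frame, this
makes basic functions constant along the null distribution. -/
theorem IsBasic.frameDeriv_inr {κ : Type*} [Fintype κ] {E : (ι → ℝ) → Matrix ι κ ℝ}
    {F : (ι → ℝ) → ℝ} (hF : IsBasic U J F) {x : ι → ℝ} (hx : x ∈ U) {c : κ}
    (hE : ∀ k ∈ J, E x k c = 0) : frameDeriv E c F x = 0 := by
  refine Finset.sum_eq_zero fun k _ => ?_
  by_cases hk : k ∈ J
  · rw [hE k hk, zero_mul]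
  · rw [hF.pd_eq_zero x hx k hk, mul_zero]

theorem IsBasic.frameDeriv {κ : Type*} [Fintype κ] {E : (ι → ℝ) → Matrix ι κ ℝ}
    {F : (ι → ℝ) → ℝ} (hΩ : IsOpen U) (hF : IsBasic U J F) {c : κ}
    (hE : ∀ k ∈ J, IsBasic U J fun x => E x k c) : IsBasic U J (frameDeriv E c F) := by
  refine IsBasic.sum hΩ fun k _ => ?_
  by_cases hk : k ∈ J
  · exact (hE k hk).mul hΩ (hF.pd hΩ k)
  · refine (isBasic_const 0).congr hΩ fun x hx => ?_
    rw [hF.pd_eq_zero x hx k hk, mul_zero]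

theorem splitForm_transpose : (splitForm α).transpose = splitForm α := by
  simp [splitForm, Matrix.fromBlocks_transpose]

theorem hasIndex_of_frame {κ : Type*} [Fintype κ] [DecidableEq κ] {e : Matrix κ ι ℝ}
    {E : Matrix ι κ ℝ} (heE : e * E = 1) (s : ι ≃ α ⊕ α) {h : Matrix κ κ ℝ}
    (hh : h.transpose = h) (P Q : Matrix κ α ℝ) (hPQ : P.transpose * h * Q = 1)
    (hQQ : Q.transpose * h * Q = 0) :
    HasIndex (e.transpose * h * e) (Fintype.card α) := by
  have key : ∀ X Y : Matrix κ α ℝ, (E * X).transpose * (e.transpose * h * e) * (E * Y) =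
      X.transpose * h * Y := by
    intro X Y
    have h1 : (E * X).transpose * (e.transpose * h * e) * (E * Y) =
        X.transpose * (e * E).transpose * h * ((e * E) * Y) := by
      simp only [Matrix.transpose_mul, Matrix.mul_assoc]
    rw [h1, heE]
    simp
  refine hasIndex_of_isotropic (E * P) (E * Q) s ?_ ?_ ?_
  · simp [Matrix.transpose_mul, Matrix.mul_assoc, hh]
  · rw [key, hPQ]
  · rw [key, hQQ]

theorem hasIndex_of_splitForm {e : Matrix (α ⊕ α) ι ℝ} {E : Matrix ι (α ⊕ α) ℝ}
    (heE : e * E = 1) (s : ι ≃ α ⊕ α) :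
    HasIndex (e.transpose * splitForm α * e) (Fintype.card α) := by
  refine hasIndex_of_frame heE s splitForm_transpose (Matrix.fromRows 1 0 : Matrix (α ⊕ α) α ℝ)
    (Matrix.fromRows 0 1 : Matrix (α ⊕ α) α ℝ) ?_ ?_ <;>
  simp [splitForm, Matrix.mul_assoc, Matrix.fromBlocks_mul_fromRows, Matrix.transpose_fromRows,
    Matrix.fromCols_mul_fromRows]

/-- The Gram matrix is constant, so metric compatibility reduces to the skewness of the connection
matrices. -/
theorem IsNullFrame.isLeviCivitaFrame (N : IsNullFrame U J e E γ) (s : ι ≃ α ⊕ α)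
    {g : (ι → ℝ) → Matrix ι ι ℝ} (hg : ∀ x ∈ U, g x = (e x).transpose * splitForm α * e x) :
    IsLeviCivitaFrame U g e E (fun _ => splitForm α) γ where
  isOpen := N.isOpen
  smooth_coframe := N.smooth_coframe
  smooth_frame := N.smooth_frame
  smooth_gram := fun _ _ => contDiffOn_const
  smooth_conn := fun c a b => (N.basic_conn c a b).smooth
  frame_mul_coframe := N.frame_mul_coframe
  coframe_mul_frame := N.coframe_mul_frame
  metric_eq := hg
  gram_symm := fun _ _ => splitForm_transpose
  isUnit_det := fun x hx => by
    rw [hg x hx]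
    exact (hasIndex_of_splitForm (N.coframe_mul_frame x hx) s).isUnit_det
  compatible := fun x hx c a b => by
    rw [N.skew x hx c]
    simp [BryantAmbient.frameDeriv, pd_const]
  torsionFree := N.torsionFree

end NullFrame

/-! ### Functions on the ambient space pulled back from the base. -/

section AmbientCoordinates

variable {n : ℕ} {U : Set (Fin n → ℝ)} {ε : ℝ} {J : Set (Fin n)}

/-- The projection to the coordinates `x` as a continuous linear map. -/
noncomputable def xCoordL (n : ℕ) : (AmbientIndex n → ℝ) →L[ℝ] (Fin n → ℝ) :=
  ContinuousLinearMap.pi fun i => ContinuousLinearMap.proj (.inr (.inl i))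

theorem isOpen_ambientSpace (hU : IsOpen U) : IsOpen (ambientSpace U ε) := by
  have h1 : Continuous fun z : AmbientIndex n → ℝ => tCoord z := continuous_apply _
  have h2 : Continuous fun z : AmbientIndex n → ℝ => xCoord z := (xCoordL n).continuous
  have h3 : Continuous fun z : AmbientIndex n → ℝ => rhoCoord z := continuous_apply _
  exact (isOpen_lt continuous_const h1).inter ((hU.preimage h2).inter (isOpen_Ioo.preimage h3))

theorem contDiffOn_comp_xCoord {F : (Fin n → ℝ) → ℝ} (hF : ContDiffOn ℝ ∞ F U) :
    ContDiffOn ℝ ∞ (fun z => F (xCoord z)) (ambientSpace U ε) :=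
  hF.comp (xCoordL n).contDiff.contDiffOn fun _ hz => hz.2.1

theorem contDiff_tCoord : ContDiff ℝ ∞ (tCoord : (AmbientIndex n → ℝ) → ℝ) :=
  contDiff_apply ℝ ℝ _

theorem contDiff_rhoCoord : ContDiff ℝ ∞ (rhoCoord : (AmbientIndex n → ℝ) → ℝ) :=
  contDiff_apply ℝ ℝ _

theorem pd_comp_xCoord {F : (Fin n → ℝ) → ℝ} {z : AmbientIndex n → ℝ}
    (hF : DifferentiableAt ℝ F (xCoord z)) (i : AmbientIndex n) :
    pd i (fun z => F (xCoord z)) z = fderiv ℝ F (xCoord z) (xCoord (Pi.single i 1)) := by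
  have h : fderiv ℝ (fun z => F (xCoord z)) z = (fderiv ℝ F (xCoord z)).comp (xCoordL n) :=
    (hF.hasFDerivAt.comp z (xCoordL n).hasFDerivAt).fderiv
  rw [pd, h]
  rfl

theorem pd_comp_xCoord_x {F : (Fin n → ℝ) → ℝ} {z : AmbientIndex n → ℝ}
    (hF : DifferentiableAt ℝ F (xCoord z)) (k : Fin n) :
    pd (.inr (.inl k)) (fun z => F (xCoord z)) z = pd k F (xCoord z) := by
  rw [pd_comp_xCoord hF, pd]
  congr 1
  ext i
  simp [xCoord, Pi.single_apply]

theorem pd_comp_xCoord_t {F : (Fin n → ℝ) → ℝ} {z : AmbientIndex n → ℝ}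
    (hF : DifferentiableAt ℝ F (xCoord z)) :
    pd (.inl ()) (fun z => F (xCoord z)) z = 0 := by
  rw [pd_comp_xCoord hF]
  have : xCoord (Pi.single (.inl ()) 1 : AmbientIndex n → ℝ) = 0 := by
    ext i; simp [xCoord]
  rw [this, map_zero]

theorem pd_comp_xCoord_rho {F : (Fin n → ℝ) → ℝ} {z : AmbientIndex n → ℝ}
    (hF : DifferentiableAt ℝ F (xCoord z)) :
    pd (.inr (.inr ())) (fun z => F (xCoord z)) z = 0 := by
  rw [pd_comp_xCoord hF]
  have : xCoord (Pi.single (.inr (.inr ())) 1 : AmbientIndex n → ℝ) = 0 := by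
    ext i; simp [xCoord]
  rw [this, map_zero]

/-- The coordinates in `J` together with `ϱ`. -/
def ambientActive (J : Set (Fin n)) : Set (AmbientIndex n) :=
  insert (.inr (.inr ())) ((fun j => .inr (.inl j)) '' J)

theorem IsBasic.comp_xCoord (hU : IsOpen U) {F : (Fin n → ℝ) → ℝ} (hF : IsBasic U J F) :
    IsBasic (ambientSpace U ε) (ambientActive J) fun z => F (xCoord z) := by
  refine ⟨contDiffOn_comp_xCoord hF.smooth, ?_⟩
  rintro z hz (⟨⟩ | k | ⟨⟩) hi
  · exact pd_comp_xCoord_t (hF.diffAt hU hz.2.1)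
  · rw [pd_comp_xCoord_x (hF.diffAt hU hz.2.1)]
    exact hF.pd_eq_zero _ hz.2.1 k fun hk => hi (Or.inr ⟨k, hk, rfl⟩)
  · exact absurd (Or.inl rfl) hi

theorem IsBasic.pd_t {F : (AmbientIndex n → ℝ) → ℝ}
    (hF : IsBasic (ambientSpace U ε) (ambientActive J) F) {z : AmbientIndex n → ℝ}
    (hz : z ∈ ambientSpace U ε) : BryantAmbient.pd (.inl ()) F z = 0 :=
  hF.pd_eq_zero z hz _ (by simp [ambientActive])

end AmbientCoordinates

/-! ### The adapted frame of an ambient metric and its candidate connection. -/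

section AmbientFrame

variable {n : ℕ} {κ : Type*} [Fintype κ] [DecidableEq κ]

/-- The coframe `dt, e, dϱ` on the ambient space. -/
def ambientCoframe (e : (Fin n → ℝ) → Matrix κ (Fin n) ℝ) (z : AmbientIndex n → ℝ) :
    Matrix (Unit ⊕ (κ ⊕ Unit)) (AmbientIndex n) ℝ :=
  Matrix.fromBlocks 1 0 0 (Matrix.fromBlocks (e (xCoord z)) 0 0 1)

/-- The frame dual to `ambientCoframe`. -/
def ambientFrame (E : (Fin n → ℝ) → Matrix (Fin n) κ ℝ) (z : AmbientIndex n → ℝ) :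
    Matrix (AmbientIndex n) (Unit ⊕ (κ ⊕ Unit)) ℝ :=
  Matrix.fromBlocks 1 0 0 (Matrix.fromBlocks (E (xCoord z)) 0 0 1)

/-- The Gram matrix of an ambient metric in the frame `ambientFrame`. -/
def ambientGram (t ρ : ℝ) (h : Matrix κ κ ℝ) :
    Matrix (Unit ⊕ (κ ⊕ Unit)) (Unit ⊕ (κ ⊕ Unit)) ℝ :=
  Matrix.of fun a b =>
    match a, b with
    | .inl _, .inl _ => 2 * ρ
    | .inl _, .inr (.inr _) => t
    | .inr (.inr _), .inl _ => t
    | .inr (.inl i), .inr (.inl j) => t ^ 2 * h i j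
    | _, _ => 0

/-- The connection matrix of an ambient metric in the direction `∂_t`. -/
noncomputable def ambientConnT (κ : Type*) [DecidableEq κ] (t : ℝ) :
    Matrix (Unit ⊕ (κ ⊕ Unit)) (Unit ⊕ (κ ⊕ Unit)) ℝ :=
  Matrix.of fun a b =>
    match a, b with
    | .inr (.inl a), .inr (.inl b) => if a = b then t⁻¹ else 0
    | .inr (.inr _), .inr (.inr _) => t⁻¹
    | _, _ => 0

/-- The connection matrix of an ambient metric in the direction of the `c`-th vector of the frame
on the base. -/
noncomputable def ambientConnX (t ρ : ℝ) (h K A : Matrix κ κ ℝ) (C : Matrix κ κ ℝ) (c : κ) :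
    Matrix (Unit ⊕ (κ ⊕ Unit)) (Unit ⊕ (κ ⊕ Unit)) ℝ :=
  Matrix.of fun a b =>
    match a, b with
    | .inl _, .inr (.inl b) => -(1 / 2) * t * K c b
    | .inr (.inl a), .inl _ => if a = c then t⁻¹ else 0
    | .inr (.inl a), .inr (.inl b) => C a b
    | .inr (.inl a), .inr (.inr _) => A a c
    | .inr (.inr _), .inr (.inl b) => -h c b + ρ * K c b
    | _, _ => 0

/-- The connection matrix of an ambient metric in the direction `∂_ϱ`. -/
noncomputable def ambientConnRho (t : ℝ) (A : Matrix κ κ ℝ) :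
    Matrix (Unit ⊕ (κ ⊕ Unit)) (Unit ⊕ (κ ⊕ Unit)) ℝ :=
  Matrix.of fun a b =>
    match a, b with
    | .inr (.inl a), .inr (.inl b) => A a b
    | .inr (.inr _), .inl _ => t⁻¹
    | _, _ => 0

/-- The connection matrices of an ambient metric in the frame `ambientFrame`, where `h` is the Gram
matrix of `g(x, ϱ)`, where `K` is its derivative with respect to `ϱ`, where `A = ½ h⁻¹ K` and where
`C` describes the connection of `g(·, ϱ)`. -/
noncomputable def ambientConn (t ρ : ℝ) (h K A : Matrix κ κ ℝ) (C : κ → Matrix κ κ ℝ) :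
    Unit ⊕ (κ ⊕ Unit) → Matrix (Unit ⊕ (κ ⊕ Unit)) (Unit ⊕ (κ ⊕ Unit)) ℝ
  | .inl _ => ambientConnT κ t
  | .inr (.inl c) => ambientConnX t ρ h K A (C c) c
  | .inr (.inr _) => ambientConnRho t A

theorem ambientForm_eq {g : (Fin n → ℝ) → ℝ → Matrix (Fin n) (Fin n) ℝ}
    {e : (Fin n → ℝ) → Matrix κ (Fin n) ℝ} {z : AmbientIndex n → ℝ} {h : Matrix κ κ ℝ}
    (hg : g (xCoord z) (rhoCoord z) = (e (xCoord z)).transpose * h * e (xCoord z)) :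
    ambientForm g z = (ambientCoframe e z).transpose * ambientGram (tCoord z) (rhoCoord z) h
      * ambientCoframe e z := by
  ext (a | a | a) (b | b | b) <;>
  simp [ambientForm, ambientCoframe, ambientGram, Matrix.mul_apply, Fintype.sum_sum_type, hg,
    Finset.mul_sum, Finset.sum_mul]
  exact Finset.sum_congr rfl fun i _ => Finset.sum_congr rfl fun j _ => by ring

theorem ambientFrame_mul_coframe {e : (Fin n → ℝ) → Matrix κ (Fin n) ℝ}
    {E : (Fin n → ℝ) → Matrix (Fin n) κ ℝ} {z : AmbientIndex n → ℝ}
    (h : E (xCoord z) * e (xCoord z) = 1) : ambientFrame E z * ambientCoframe e z = 1 := by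
  simp [ambientFrame, ambientCoframe, Matrix.fromBlocks_multiply, h]

theorem ambientCoframe_mul_frame {e : (Fin n → ℝ) → Matrix κ (Fin n) ℝ}
    {E : (Fin n → ℝ) → Matrix (Fin n) κ ℝ} {z : AmbientIndex n → ℝ}
    (h : e (xCoord z) * E (xCoord z) = 1) : ambientCoframe e z * ambientFrame E z = 1 := by
  simp [ambientFrame, ambientCoframe, Matrix.fromBlocks_multiply, h]

theorem ambientGram_transpose {t ρ : ℝ} {h : Matrix κ κ ℝ} (hh : h.transpose = h) :
    (ambientGram t ρ h).transpose = ambientGram t ρ h := by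
  have hs : ∀ i j, h i j = h j i := fun i j => congrFun (congrFun hh j) i
  ext (a | a | a) (b | b | b) <;> simp [ambientGram]
  exact Or.inl (hs _ _)

variable {E : (Fin n → ℝ) → Matrix (Fin n) κ ℝ} {F : (AmbientIndex n → ℝ) → ℝ}
  {z : AmbientIndex n → ℝ}

theorem frameDeriv_ambientFrame_t (u : Unit) :
    frameDeriv (ambientFrame E) (.inl u) F z = pd (.inl ()) F z := by
  simp [frameDeriv, ambientFrame, Fintype.sum_sum_type]

theorem frameDeriv_ambientFrame_rho (u : Unit) :
    frameDeriv (ambientFrame E) (.inr (.inr u)) F z = pd (.inr (.inr ())) F z := by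
  simp [frameDeriv, ambientFrame, Fintype.sum_sum_type]

theorem frameDeriv_ambientFrame_x (c : κ) :
    frameDeriv (ambientFrame E) (.inr (.inl c)) F z =
      ∑ k, E (xCoord z) k c * pd (.inr (.inl k)) F z := by
  simp [frameDeriv, ambientFrame, Fintype.sum_sum_type]

theorem frameDeriv_comp_xCoord {F : (Fin n → ℝ) → ℝ} (hF : DifferentiableAt ℝ F (xCoord z))
    (c : κ) : frameDeriv (ambientFrame E) (.inr (.inl c)) (fun z => F (xCoord z)) z =
      frameDeriv E c F (xCoord z) := by
  rw [frameDeriv_ambientFrame_x]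
  simp only [pd_comp_xCoord_x hF]
  rfl

end AmbientFrame

/-! ### Index of the ambient metric. -/

section HasIndexAmbient

variable {n : ℕ} {α : Type*} [Fintype α] [DecidableEq α]

/-- The null subspace is spanned by ∂_ϱ and the second half of the frame, and the dual one by ∂_t
and the first half; the factors t⁻¹ and t⁻² normalize the pairing. `H` appears only in the products
within the dual subspace, so it affects neither non-degeneracy nor the index. -/
theorem hasIndex_ambientGram {e : (Fin n → ℝ) → Matrix (α ⊕ α) (Fin n) ℝ}
    {E : (Fin n → ℝ) → Matrix (Fin n) (α ⊕ α) ℝ} {z : AmbientIndex n → ℝ}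
    (heE : e (xCoord z) * E (xCoord z) = 1) (s : Fin n ≃ α ⊕ α) {t ρ : ℝ} (ht : 0 < t)
    {H : Matrix α α ℝ} (hH : H.transpose = H) :
    HasIndex ((ambientCoframe e z).transpose *
      ambientGram t ρ (splitForm α + Matrix.fromBlocks H 0 0 0) * ambientCoframe e z)
      (1 + Fintype.card α) := by
  have s' : AmbientIndex n ≃ (Unit ⊕ α) ⊕ (Unit ⊕ α) :=
    ((Equiv.refl Unit).sumCongr ((s.sumCongr (Equiv.refl Unit)).trans
      ((Equiv.sumAssoc _ _ _).trans ((Equiv.refl α).sumCongr (Equiv.sumComm _ _))))).trans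
      (Equiv.sumAssoc Unit α (Unit ⊕ α)).symm
  have hcard : 1 + Fintype.card α = Fintype.card (Unit ⊕ α) := by simp
  have ht' : t ≠ 0 := ht.ne'
  rw [hcard]
  refine hasIndex_of_frame (ambientCoframe_mul_frame heE) s' (ambientGram_transpose ?_)
    (Matrix.of fun a b => match a, b with
      | .inl _, .inl _ => 1
      | .inr (.inl (.inl a)), .inr b => if a = b then 1 else 0
      | _, _ => 0)
    (Matrix.of fun a b => match a, b with
      | .inr (.inr _), .inl _ => t⁻¹
      | .inr (.inl (.inr a)), .inr b => if a = b then (t ^ 2)⁻¹ else 0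
      | _, _ => 0) ?_ ?_
  · simp [splitForm_transpose, Matrix.fromBlocks_transpose, hH]
  · ext (a | a) (b | b) <;>
    simp [ambientGram, splitForm, Matrix.mul_apply, Fintype.sum_sum_type, ht', Matrix.one_apply]
  · ext (a | a) (b | b) <;>
    simp [ambientGram, splitForm, Matrix.mul_apply, Fintype.sum_sum_type]

end HasIndexAmbient

/-! ### Levi-Civita connection of the ambient metric of a null perturbation. -/

section AmbientRicci

variable {n : ℕ} {α : Type*} [Fintype α] [DecidableEq α]

/-- The covariant derivative, in the direction of the `c`-th vector of the frame, of the tensor with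
matrix `H` in the first half of a coframe. -/
noncomputable def nullNabla (E : (Fin n → ℝ) → Matrix (Fin n) (α ⊕ α) ℝ)
    (γ : (Fin n → ℝ) → α ⊕ α → Matrix (α ⊕ α) (α ⊕ α) ℝ)
    (H : (AmbientIndex n → ℝ) → Matrix α α ℝ) (z : AmbientIndex n → ℝ) (c : α) : Matrix α α ℝ :=
  Matrix.of fun a b => frameDeriv (ambientFrame E) (.inr (.inl (.inl c))) (fun y => H y a b) z
    - ∑ d, (H z a d * γ (xCoord z) (.inl c) (.inl d) (.inl b)
      + γ (xCoord z) (.inl c) (.inl d) (.inl a) * H z d b)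

/-- The difference between the connections of `splitForm + H` and of `splitForm`. -/
noncomputable def nullDiff (E : (Fin n → ℝ) → Matrix (Fin n) (α ⊕ α) ℝ)
    (γ : (Fin n → ℝ) → α ⊕ α → Matrix (α ⊕ α) (α ⊕ α) ℝ)
    (H : (AmbientIndex n → ℝ) → Matrix α α ℝ) (z : AmbientIndex n → ℝ) :
    α ⊕ α → Matrix (α ⊕ α) (α ⊕ α) ℝ
  | .inl c => Matrix.fromBlocks 0 0 (Matrix.of fun a b => (1 / 2) *
      (nullNabla E γ H z c a b + nullNabla E γ H z b a c - nullNabla E γ H z a b c)) 0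
  | .inr _ => 0

/-- The connection matrices of the metric `2 d(ϱt) dt + t² eᵀ (splitForm + H) e`. -/
noncomputable def nullAmbientConn (E : (Fin n → ℝ) → Matrix (Fin n) (α ⊕ α) ℝ)
    (γ : (Fin n → ℝ) → α ⊕ α → Matrix (α ⊕ α) (α ⊕ α) ℝ)
    (H K : (AmbientIndex n → ℝ) → Matrix α α ℝ) (z : AmbientIndex n → ℝ) :
    Unit ⊕ ((α ⊕ α) ⊕ Unit) → Matrix (Unit ⊕ ((α ⊕ α) ⊕ Unit)) (Unit ⊕ ((α ⊕ α) ⊕ Unit)) ℝ :=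
  ambientConn (tCoord z) (rhoCoord z) (splitForm α + Matrix.fromBlocks (H z) 0 0 0)
    (Matrix.fromBlocks (K z) 0 0 0) (Matrix.fromBlocks 0 0 ((1 / 2 : ℝ) • K z) 0)
    fun c => γ (xCoord z) c + nullDiff E γ H z c

variable {U : Set (Fin n → ℝ)} {J : Set (Fin n)} {ε : ℝ}
  {e : (Fin n → ℝ) → Matrix (α ⊕ α) (Fin n) ℝ} {E : (Fin n → ℝ) → Matrix (Fin n) (α ⊕ α) ℝ}
  {γ : (Fin n → ℝ) → α ⊕ α → Matrix (α ⊕ α) (α ⊕ α) ℝ}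
  {H K : (AmbientIndex n → ℝ) → Matrix α α ℝ} {z : AmbientIndex n → ℝ}

/-- A symmetric matrix `H` of functions of the active coordinates and of `ϱ`, with derivative `K`
with respect to `ϱ`. -/
structure IsNullFamily (U : Set (Fin n → ℝ)) (J : Set (Fin n)) (ε : ℝ)
    (H K : (AmbientIndex n → ℝ) → Matrix α α ℝ) : Prop where
  basic : ∀ a b, IsBasic (ambientSpace U ε) (ambientActive J) fun z => H z a b
  basic_deriv : ∀ a b, IsBasic (ambientSpace U ε) (ambientActive J) fun z => K z a b
  symm : ∀ z ∈ ambientSpace U ε, (H z).transpose = H z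
  symm_deriv : ∀ z ∈ ambientSpace U ε, (K z).transpose = K z
  deriv : ∀ z ∈ ambientSpace U ε, ∀ a b,
    pd (.inr (.inr ())) (fun y => H y a b) z = K z a b

theorem IsNullFrame.basic_ambientFrame (N : IsNullFrame U J e E γ) (c : α) :
    ∀ k ∈ ambientActive J, IsBasic (ambientSpace U ε) (ambientActive J)
      fun z => ambientFrame E z k (.inr (.inl (.inl c))) := by
  rintro _ (rfl | ⟨k, hk, rfl⟩)
  · exact isBasic_const 0
  · exact (N.basic_frame k hk c).comp_xCoord N.isOpen

theorem IsNullFrame.ambientFrame_inr (N : IsNullFrame U J e E γ) (hz : z ∈ ambientSpace U ε)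
    (c : α) : ∀ k ∈ ambientActive J, ambientFrame E z k (.inr (.inl (.inr c))) = 0 := by
  rintro _ (rfl | ⟨k, hk, rfl⟩)
  · rfl
  · exact N.frame_inr _ hz.2.1 k hk c

theorem isBasic_nullNabla (N : IsNullFrame U J e E γ)
    (hH : ∀ a b, IsBasic (ambientSpace U ε) (ambientActive J) fun z => H z a b) (c a b : α) :
    IsBasic (ambientSpace U ε) (ambientActive J) fun z => nullNabla E γ H z c a b := by
  have hΩ := isOpen_ambientSpace (ε := ε) N.isOpen
  have hγ : ∀ d b, IsBasic (ambientSpace U ε) (ambientActive J)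
      fun z => γ (xCoord z) (.inl c) (.inl d) (.inl b) := fun d b =>
    (N.basic_conn (.inl c) (.inl d) (.inl b)).comp_xCoord N.isOpen
  exact ((hH a b).frameDeriv hΩ (N.basic_ambientFrame c)).sub hΩ
    (IsBasic.sum hΩ fun d _ => ((hH a d).mul hΩ (hγ d b)).add hΩ ((hγ d a).mul hΩ (hH d b)))

theorem isBasic_nullDiff (N : IsNullFrame U J e E γ)
    (hH : ∀ a b, IsBasic (ambientSpace U ε) (ambientActive J) fun z => H z a b) (c a b : α ⊕ α) :
    IsBasic (ambientSpace U ε) (ambientActive J) fun z => nullDiff E γ H z c a b := by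
  have hΩ := isOpen_ambientSpace (ε := ε) N.isOpen
  rcases c with c | c
  · rcases a with a | a <;> rcases b with b | b
    · exact isBasic_const 0
    · exact isBasic_const 0
    · exact (isBasic_const (1 / 2)).mul hΩ (((isBasic_nullNabla N hH c a b).add hΩ
        (isBasic_nullNabla N hH b a c)).sub hΩ (isBasic_nullNabla N hH a b c))
    · exact isBasic_const 0
  · exact isBasic_const 0

theorem smooth_nullAmbientConn (N : IsNullFrame U J e E γ) (hH : IsNullFamily U J ε H K)
    (c : Unit ⊕ ((α ⊕ α) ⊕ Unit)) :
    SmoothMat (ambientSpace U ε) fun z => nullAmbientConn E γ H K z c := by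
  have ht : ContDiffOn ℝ ∞ (fun z : AmbientIndex n → ℝ => (tCoord z)⁻¹) (ambientSpace U ε) :=
    contDiff_tCoord.contDiffOn.inv fun z hz => hz.1.ne'
  have hK : ∀ a b : α ⊕ α, ContDiffOn ℝ ∞ (fun z => Matrix.fromBlocks (K z) 0 0 0 a b)
      (ambientSpace U ε) := by
    rintro (a | a) (b | b)
    · exact (hH.basic_deriv a b).smooth
    all_goals exact contDiffOn_const
  have hA : ∀ a b : α ⊕ α, ContDiffOn ℝ ∞ (fun z => Matrix.fromBlocks 0 0 ((1 / 2 : ℝ) • K z) 0 a b)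
      (ambientSpace U ε) := by
    rintro (a | a) (b | b)
    · exact contDiffOn_const
    · exact contDiffOn_const
    · exact contDiffOn_const.mul (hH.basic_deriv a b).smooth
    · exact contDiffOn_const
  have hh : ∀ a b, ContDiffOn ℝ ∞
      (fun z => (splitForm α + Matrix.fromBlocks (H z) 0 0 0 : Matrix (α ⊕ α) (α ⊕ α) ℝ) a b)
      (ambientSpace U ε) := by
    intro a b
    refine contDiffOn_const.add ?_
    rcases a with a | a <;> rcases b with b | b
    · exact (hH.basic a b).smooth
    all_goals exact contDiffOn_const
  have hC : ∀ c a b, ContDiffOn ℝ ∞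
      (fun z => (γ (xCoord z) c + nullDiff E γ H z c) a b) (ambientSpace U ε) := fun c a b =>
    ((N.basic_conn c a b).comp_xCoord N.isOpen).smooth.add
      (isBasic_nullDiff N hH.basic c a b).smooth
  have ht1 : ContDiffOn ℝ ∞ (tCoord : (AmbientIndex n → ℝ) → ℝ) (ambientSpace U ε) :=
    contDiff_tCoord.contDiffOn
  have hρ : ContDiffOn ℝ ∞ (rhoCoord : (AmbientIndex n → ℝ) → ℝ) (ambientSpace U ε) :=
    contDiff_rhoCoord.contDiffOn
  intro a b
  rcases c with c | c | c <;> rcases a with a | a | a <;> rcases b with b | b | b <;>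
    simp only [nullAmbientConn, ambientConn, ambientConnT, ambientConnX, ambientConnRho,
      Matrix.of_apply]
  all_goals first
    | exact contDiffOn_const
    | exact ht
    | exact hC _ _ _
    | exact hA _ _
    | exact (contDiffOn_const.mul ht1).mul (hK _ _)
    | exact (hh _ _).neg.add (hρ.mul (hK _ _))
    | (split_ifs <;> first | exact ht | exact contDiffOn_const)

/-- The connection of `splitForm + H` is torsion-free if that of `splitForm` is. -/
theorem nullDiff_symm
    (hd : ∀ c a b, nullNabla E γ H z c a b = nullNabla E γ H z c b a) (a b c : α ⊕ α) :
    nullDiff E γ H z c a b = nullDiff E γ H z b a c := by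
  rcases a with a | a <;> rcases b with b | b <;> rcases c with c | c <;>
    simp [nullDiff, Matrix.fromBlocks]
  rw [hd a b c]
  ring

theorem nullNabla_symm (hΩ : IsOpen U) (hH : IsNullFamily U J ε H K) (hz : z ∈ ambientSpace U ε)
    (c a b : α) : nullNabla E γ H z c a b = nullNabla E γ H z c b a := by
  have hs : ∀ y ∈ ambientSpace U ε, ∀ a b, H y a b = H y b a := fun y hy a b =>
    congrFun (congrFun (hH.symm y hy) b) a
  simp only [nullNabla, Matrix.of_apply]
  rw [frameDeriv_congr (isOpen_ambientSpace hΩ) (fun y hy => hs y hy a b) hz]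
  congr 1
  refine Finset.sum_congr rfl fun d _ => ?_
  rw [hs z hz a d, hs z hz d b]
  ring

/-- The connection of `splitForm + H` is compatible with the metric. -/
theorem nullDiff_compatible (N : IsNullFrame U J e E γ) (hH : IsNullFamily U J ε H K)
    (hz : z ∈ ambientSpace U ε) (c a b : α ⊕ α) :
    frameDeriv (ambientFrame E) (.inr (.inl c))
      (fun y => (Matrix.fromBlocks (H y) 0 0 0 : Matrix (α ⊕ α) (α ⊕ α) ℝ) a b) z =
    ((splitForm α + Matrix.fromBlocks (H z) 0 0 0) * (γ (xCoord z) c + nullDiff E γ H z c)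
      + (γ (xCoord z) c + nullDiff E γ H z c).transpose *
        (splitForm α + Matrix.fromBlocks (H z) 0 0 0) : Matrix (α ⊕ α) (α ⊕ α) ℝ) a b := by
  have hsk := N.skew _ hz.2.1 c
  have hnn : ∀ c a b, nullNabla E γ H z c a b = nullNabla E γ H z c b a :=
    nullNabla_symm N.isOpen hH hz
  have hp := N.parallel _ hz.2.1 c
  -- The products of `splitForm` with γ cancel by skewness. The products of `H` with `nullDiff`
  -- vanish too, because `nullDiff` takes values in the null distribution, which `H` annihilates.
  -- There remains the identity defining `nullDiff` by the Koszul formula.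
  have key : (splitForm α + Matrix.fromBlocks (H z) 0 0 0) * (γ (xCoord z) c + nullDiff E γ H z c)
      + (γ (xCoord z) c + nullDiff E γ H z c).transpose *
        (splitForm α + Matrix.fromBlocks (H z) 0 0 0) =
      Matrix.fromBlocks (H z) 0 0 0 * γ (xCoord z) c
        + (γ (xCoord z) c).transpose * Matrix.fromBlocks (H z) 0 0 0
        + (splitForm α * nullDiff E γ H z c + (nullDiff E γ H z c).transpose * splitForm α)
        + (Matrix.fromBlocks (H z) 0 0 0 * nullDiff E γ H z c
          + (nullDiff E γ H z c).transpose * Matrix.fromBlocks (H z) 0 0 0) := by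
    simp only [Matrix.add_mul, Matrix.mul_add, Matrix.transpose_add]
    rw [← sub_eq_zero]
    rw [← hsk]
    abel
  have h0 : ∀ a b : α ⊕ α, (∀ a' b', ¬(a = .inl a' ∧ b = .inl b')) →
      frameDeriv (ambientFrame E) (.inr (.inl c))
      (fun y => (Matrix.fromBlocks (H y) 0 0 0 : Matrix (α ⊕ α) (α ⊕ α) ℝ) a b) z = 0 := by
    rintro (a | a) (b | b) hab
    · exact absurd ⟨rfl, rfl⟩ (hab a b)
    all_goals simp [frameDeriv, pd_const]
  rw [key]
  rcases c with c | c
  · rcases a with a | a <;> rcases b with b | b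
    · simp [Matrix.mul_apply, Fintype.sum_sum_type, splitForm, nullDiff, Matrix.one_apply]
      rw [hnn a b c, hnn b a c]
      have := hnn c a b
      simp only [nullNabla, Matrix.of_apply, Finset.sum_add_distrib] at *
      linarith
    · rw [h0 _ _ (by simp)]
      simp [Matrix.mul_apply, Fintype.sum_sum_type, splitForm, nullDiff, Matrix.one_apply, hp]
    · rw [h0 _ _ (by simp)]
      simp [Matrix.mul_apply, Fintype.sum_sum_type, splitForm, nullDiff, Matrix.one_apply, hp]
    · rw [h0 _ _ (by simp)]
      simp [Matrix.mul_apply, Fintype.sum_sum_type, splitForm, nullDiff, Matrix.one_apply, hp]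
  -- In a null direction both sides vanish: `H` is constant along it, `nullDiff` is zero, and γ
  -- preserves the splitting modulo the null half.
  · have hf := N.flat _ hz.2.1 c
    rcases a with a | a <;> rcases b with b | b
    · have := (hH.basic a b).frameDeriv_inr hz (N.ambientFrame_inr hz c)
      simpa [Matrix.mul_apply, Fintype.sum_sum_type, splitForm, nullDiff, Matrix.one_apply, hf]
        using this
    · rw [h0 _ _ (by simp)]
      simp [Matrix.mul_apply, Fintype.sum_sum_type, splitForm, nullDiff, hp]
    · rw [h0 _ _ (by simp)]
      simp [Matrix.mul_apply, Fintype.sum_sum_type, splitForm, nullDiff, hp]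
    · rw [h0 _ _ (by simp)]
      simp [Matrix.mul_apply, Fintype.sum_sum_type, splitForm, nullDiff, hp]

end AmbientRicci

section AmbientRicci

variable {n : ℕ} {α : Type*} [Fintype α] [DecidableEq α]
variable {U : Set (Fin n → ℝ)} {J : Set (Fin n)} {ε : ℝ}
  {e : (Fin n → ℝ) → Matrix (α ⊕ α) (Fin n) ℝ} {E : (Fin n → ℝ) → Matrix (Fin n) (α ⊕ α) ℝ}
  {γ : (Fin n → ℝ) → α ⊕ α → Matrix (α ⊕ α) (α ⊕ α) ℝ}
  {H K : (AmbientIndex n → ℝ) → Matrix α α ℝ} {z : AmbientIndex n → ℝ}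

theorem smooth_ambientCoframe {κ : Type*} [Fintype κ] [DecidableEq κ]
    {e : (Fin n → ℝ) → Matrix κ (Fin n) ℝ} (he : SmoothMat U e) :
    SmoothMat (ambientSpace U ε) (ambientCoframe e) := by
  rintro (a | a | a) (b | b | b)
  all_goals first
    | exact contDiffOn_const
    | exact contDiffOn_comp_xCoord (he a b)

theorem smooth_ambientFrame {κ : Type*} [Fintype κ] [DecidableEq κ]
    {E : (Fin n → ℝ) → Matrix (Fin n) κ ℝ} (hE : SmoothMat U E) :
    SmoothMat (ambientSpace U ε) (ambientFrame E) := by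
  rintro (a | a | a) (b | b | b)
  all_goals first
    | exact contDiffOn_const
    | exact contDiffOn_comp_xCoord (hE a b)

/-- The Gram matrix of `2 d(ϱt) dt + t² eᵀ (splitForm + H) e`. -/
def nullAmbientGram (H : (AmbientIndex n → ℝ) → Matrix α α ℝ) (z : AmbientIndex n → ℝ) :
    Matrix (Unit ⊕ ((α ⊕ α) ⊕ Unit)) (Unit ⊕ ((α ⊕ α) ⊕ Unit)) ℝ :=
  ambientGram (tCoord z) (rhoCoord z) (splitForm α + Matrix.fromBlocks (H z) 0 0 0)

theorem isBasic_fromBlocks (hH : ∀ a b, IsBasic (ambientSpace U ε) (ambientActive J)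
    fun z => H z a b) (a b : α ⊕ α) : IsBasic (ambientSpace U ε) (ambientActive J)
      fun z => (Matrix.fromBlocks (H z) 0 0 0 : Matrix (α ⊕ α) (α ⊕ α) ℝ) a b := by
  rcases a with a | a <;> rcases b with b | b
  · exact hH a b
  all_goals exact isBasic_const 0

theorem smooth_nullAmbientGram (hH : ∀ a b, IsBasic (ambientSpace U ε) (ambientActive J)
    fun z => H z a b) : SmoothMat (ambientSpace U ε) (nullAmbientGram H) := by
  have ht : ContDiffOn ℝ ∞ (tCoord : (AmbientIndex n → ℝ) → ℝ) (ambientSpace U ε) :=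
    contDiff_tCoord.contDiffOn
  have hρ : ContDiffOn ℝ ∞ (rhoCoord : (AmbientIndex n → ℝ) → ℝ) (ambientSpace U ε) :=
    contDiff_rhoCoord.contDiffOn
  rintro (a | a | a) (b | b | b)
  all_goals first
    | exact contDiffOn_const
    | exact ht
    | exact contDiffOn_const.mul hρ
    | exact (ht.pow 2).mul (contDiffOn_const.add (isBasic_fromBlocks hH a b).smooth)

theorem pd_tCoord_sq_mul {F : (AmbientIndex n → ℝ) → ℝ} (hF : DifferentiableAt ℝ F z)
    (i : AmbientIndex n) : pd i (fun y => tCoord y ^ 2 * F y) z =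
      2 * tCoord z * (if i = .inl () then 1 else 0) * F z + tCoord z ^ 2 * pd i F z := by
  have ht : DifferentiableAt ℝ (tCoord : (AmbientIndex n → ℝ) → ℝ) z :=
    contDiff_tCoord.contDiffAt.differentiableAt (by simp)
  have h1 : pd i (fun y : AmbientIndex n → ℝ => tCoord y) z = if i = .inl () then 1 else 0 :=
    pd_coord i _
  have h2 : (fun y : AmbientIndex n → ℝ => tCoord y ^ 2 * F y) =
      fun y => (tCoord y * tCoord y) * F y := by
    ext y; ring
  rw [h2, pd_mul i (ht.fun_mul ht) hF, pd_mul i ht ht, h1]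
  ring

/-- The derivatives of `ambientGram` in the directions of the frame, where `K` is the derivative of
`h` with respect to `ϱ` and where `D c` is its derivative in the direction `c`. -/
def ambientGramDeriv {κ : Type*} (t : ℝ) (h K : Matrix κ κ ℝ) (D : κ → Matrix κ κ ℝ) :
    Unit ⊕ (κ ⊕ Unit) → Matrix (Unit ⊕ (κ ⊕ Unit)) (Unit ⊕ (κ ⊕ Unit)) ℝ :=
  fun c => Matrix.of fun a b =>
    match c, a, b with
    | .inl _, .inl _, .inr (.inr _) => 1
    | .inl _, .inr (.inr _), .inl _ => 1
    | .inl _, .inr (.inl i), .inr (.inl j) => 2 * t * h i j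
    | .inr (.inl c), .inr (.inl i), .inr (.inl j) => t ^ 2 * D c i j
    | .inr (.inr _), .inl _, .inl _ => 2
    | .inr (.inr _), .inr (.inl i), .inr (.inl j) => t ^ 2 * K i j
    | _, _, _ => 0

/-- The algebraic half of metric compatibility, with t and ϱ treated as plain numbers. The
components involving ∂_t or ∂_ϱ follow from hA = ½K and the symmetry of h and K; the base block is
passed on unchanged as hC + Cᵀh. -/
theorem ambientGram_mul_conn {κ : Type*} [Fintype κ] [DecidableEq κ] {t : ℝ} (ht : t ≠ 0) (ρ : ℝ)
    {h K A : Matrix κ κ ℝ} (C : κ → Matrix κ κ ℝ) (hh : h.transpose = h) (hK : K.transpose = K)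
    (hA : h * A = (1 / 2 : ℝ) • K) (c : Unit ⊕ (κ ⊕ Unit)) :
    ambientGram t ρ h * ambientConn t ρ h K A C c
      + (ambientConn t ρ h K A C c).transpose * ambientGram t ρ h =
    ambientGramDeriv t h K (fun c => h * C c + (C c).transpose * h) c := by
  have hs : ∀ i j, h i j = h j i := fun i j => congrFun (congrFun hh j) i
  have hKs : ∀ i j, K i j = K j i := fun i j => congrFun (congrFun hK j) i
  have hA' : ∀ i j, ∑ l, h i l * A l j = (1 / 2) * K i j := fun i j => by
    rw [← Matrix.mul_apply, hA]; rfl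
  have hA1 : ∀ i j, ∑ l, t ^ 2 * h i l * A l j = t ^ 2 * ((1 / 2) * K i j) := fun i j => by
    rw [← hA', Finset.mul_sum]
    exact Finset.sum_congr rfl fun l _ => by ring
  have hA2 : ∀ i j, ∑ l, A l i * (t ^ 2 * h l j) = t ^ 2 * ((1 / 2) * K i j) := fun i j => by
    rw [hKs, ← hA', Finset.mul_sum]
    exact Finset.sum_congr rfl fun l _ => by rw [hs l j]; ring
  ext a b
  rcases c with c | c | c <;> rcases a with a | a | a <;> rcases b with b | b | b <;>
  simp only [ambientGram, ambientConn, ambientConnT, ambientConnX, ambientConnRho, ambientGramDeriv,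
    Matrix.add_apply, Matrix.transpose_apply, Matrix.of_apply, Matrix.mul_apply,
    Fintype.sum_sum_type, Finset.univ_unique, Finset.sum_singleton, mul_zero, zero_mul, add_zero,
    zero_add, Finset.sum_const_zero, mul_ite, ite_mul, Finset.sum_ite_eq',
    Finset.mem_univ, if_true, hA1, hA2]
  · exact mul_inv_cancel₀ ht
  · field_simp; ring
  · exact inv_mul_cancel₀ ht
  · field_simp; ring
  · rw [hs a c, hKs c a]; field_simp; ring
  · rw [mul_add, Finset.mul_sum, Finset.mul_sum]
    congr 1 <;> exact Finset.sum_congr rfl fun l _ => by ring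
  · rw [hKs a c]; ring
  · ring
  · field_simp; norm_num
  · ring

/-- The analytic half: the actual derivatives of the Gram matrix are matched with
`ambientGramDeriv`. In base directions this rests on `nullDiff_compatible`. -/
theorem nullAmbient_compatible (N : IsNullFrame U J e E γ) (hH : IsNullFamily U J ε H K)
    (hz : z ∈ ambientSpace U ε) (c a b : Unit ⊕ ((α ⊕ α) ⊕ Unit)) :
    frameDeriv (ambientFrame E) c (fun y => nullAmbientGram H y a b) z =
      (nullAmbientGram H z * nullAmbientConn E γ H K z c
        + (nullAmbientConn E γ H K z c).transpose * nullAmbientGram H z) a b := by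
  have hΩ := isOpen_ambientSpace (ε := ε) N.isOpen
  have ht0 : tCoord z ≠ 0 := hz.1.ne'
  have hhs : (splitForm α + Matrix.fromBlocks (H z) 0 0 0).transpose =
      splitForm α + Matrix.fromBlocks (H z) 0 0 0 := by
    simp [splitForm_transpose, Matrix.fromBlocks_transpose, hH.symm z hz]
  have hKs : (Matrix.fromBlocks (K z) 0 0 0 : Matrix (α ⊕ α) (α ⊕ α) ℝ).transpose =
      Matrix.fromBlocks (K z) 0 0 0 := by
    simp [Matrix.fromBlocks_transpose, hH.symm_deriv z hz]
  have hA : (splitForm α + Matrix.fromBlocks (H z) 0 0 0) *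
      Matrix.fromBlocks 0 0 ((1 / 2 : ℝ) • K z) 0 =
      (1 / 2 : ℝ) • (Matrix.fromBlocks (K z) 0 0 0 : Matrix (α ⊕ α) (α ⊕ α) ℝ) := by
    simp [splitForm, Matrix.fromBlocks_add, Matrix.fromBlocks_multiply, Matrix.fromBlocks_smul]
  have hdF : ∀ a b : α ⊕ α, DifferentiableAt ℝ (fun y => (splitForm α +
      Matrix.fromBlocks (H y) 0 0 0 : Matrix (α ⊕ α) (α ⊕ α) ℝ) a b) z := fun a b =>
    ((isBasic_const (splitForm α a b)).add hΩ (isBasic_fromBlocks hH.basic a b)).diffAt hΩ hz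
  have hpd : ∀ i (a b : α ⊕ α), pd i (fun y => tCoord y ^ 2 * (splitForm α a b +
      (Matrix.fromBlocks (H y) 0 0 0 : Matrix (α ⊕ α) (α ⊕ α) ℝ) a b)) z =
      2 * tCoord z * (if i = .inl () then 1 else 0) * (splitForm α +
      Matrix.fromBlocks (H z) 0 0 0 : Matrix (α ⊕ α) (α ⊕ α) ℝ) a b + tCoord z ^ 2 *
      pd i (fun y => (Matrix.fromBlocks (H y) 0 0 0 : Matrix (α ⊕ α) (α ⊕ α) ℝ) a b) z := by
    intro i a b
    have := pd_add (F := fun _ => splitForm α a b) i (differentiableAt_const _)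
      ((isBasic_fromBlocks hH.basic a b).diffAt hΩ hz)
    rw [pd_const, zero_add] at this
    rw [← this]
    exact pd_tCoord_sq_mul (hdF a b) i
  have hpt : ∀ a b : α ⊕ α, pd (.inl ()) (fun y => (Matrix.fromBlocks (H y) 0 0 0 :
      Matrix (α ⊕ α) (α ⊕ α) ℝ) a b) z = 0 := fun a b =>
    (isBasic_fromBlocks hH.basic a b).pd_t hz
  have hpρ : ∀ a b : α ⊕ α, pd (.inr (.inr ())) (fun y => (Matrix.fromBlocks (H y) 0 0 0 :
      Matrix (α ⊕ α) (α ⊕ α) ℝ) a b) z = (Matrix.fromBlocks (K z) 0 0 0 :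
      Matrix (α ⊕ α) (α ⊕ α) ℝ) a b := by
    rintro (a | a) (b | b)
    · exact hH.deriv z hz a b
    all_goals exact pd_const _ _ _
  have hpx : ∀ c a b : α ⊕ α, ∑ k, E (xCoord z) k c * (tCoord z ^ 2 * pd (.inr (.inl k))
      (fun y => (Matrix.fromBlocks (H y) 0 0 0 : Matrix (α ⊕ α) (α ⊕ α) ℝ) a b) z) =
      tCoord z ^ 2 * ((splitForm α + Matrix.fromBlocks (H z) 0 0 0) *
      (γ (xCoord z) c + nullDiff E γ H z c) + (γ (xCoord z) c + nullDiff E γ H z c).transpose *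
        (splitForm α + Matrix.fromBlocks (H z) 0 0 0) : Matrix (α ⊕ α) (α ⊕ α) ℝ) a b := by
    intro c a b
    rw [← nullDiff_compatible N hH hz c a b, frameDeriv_ambientFrame_x, Finset.mul_sum]
    exact Finset.sum_congr rfl fun k _ => by ring
  have hpdt : ∀ i, pd i (fun y : AmbientIndex n → ℝ => tCoord y) z =
    if i = .inl () then 1 else 0 := fun i => pd_coord i _
  have hpdρ : ∀ i, pd i (fun y : AmbientIndex n → ℝ => rhoCoord y) z =
    if i = .inr (.inr ()) then 1 else 0 := fun i => pd_coord i _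
  unfold nullAmbientConn
  rw [nullAmbientGram, ambientGram_mul_conn ht0 _ _ hhs hKs hA]
  rcases c with c | c | c
  · rw [frameDeriv_ambientFrame_t]
    rcases a with a | a | a <;> rcases b with b | b | b <;>
    simp [nullAmbientGram, ambientGram, ambientGramDeriv, pd_const, pd_const_mul, hpdρ, hpdt, hpd,
      hpt]
  · rw [frameDeriv_ambientFrame_x]
    rcases a with a | a | a <;> rcases b with b | b | b <;>
    simp [nullAmbientGram, ambientGram, ambientGramDeriv, pd_const, pd_const_mul, hpdρ, hpdt, hpd,
      hpx]
  · rw [frameDeriv_ambientFrame_rho]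
    rcases a with a | a | a <;> rcases b with b | b | b <;>
    simp [nullAmbientGram, ambientGram, ambientGramDeriv, pd_const, pd_const_mul, hpdρ, hpdt, hpd,
      hpρ]

end AmbientRicci

/-! ### Ricci tensor of an ambient metric in an adapted frame. -/

section AmbientFrameRicci

variable {n : ℕ} {κ : Type*} [Fintype κ] [DecidableEq κ]
  {E : (Fin n → ℝ) → Matrix (Fin n) κ ℝ} {z : AmbientIndex n → ℝ}

theorem frameDeriv_const {ι : Type*} [Fintype ι] [DecidableEq ι] (E : (ι → ℝ) → Matrix ι κ ℝ)
    (c : κ) (r : ℝ) (x : ι → ℝ) : frameDeriv E c (fun _ => r) x = 0 := by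
  simp [frameDeriv, pd_const]

theorem pd_inv_tCoord (hz : tCoord z ≠ 0) (i : AmbientIndex n) :
    pd i (fun y => (tCoord y)⁻¹) z = if i = .inl () then -(tCoord z ^ 2)⁻¹ else 0 := by
  have ht : DifferentiableAt ℝ (tCoord : (AmbientIndex n → ℝ) → ℝ) z :=
    contDiff_tCoord.contDiffAt.differentiableAt (by simp)
  have h1 : pd i (fun y : AmbientIndex n → ℝ => tCoord y) z = if i = .inl () then 1 else 0 :=
    pd_coord i _
  have h2 : pd i (fun y => (tCoord y)⁻¹) z = -(tCoord z ^ 2)⁻¹ * pd i tCoord z := by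
    have := ((hasDerivAt_inv hz).comp_hasFDerivAt z ht.hasFDerivAt).fderiv
    exact congrArg (fun l => l (Pi.single i 1)) this
  rw [h2, h1]
  split_ifs <;> simp

theorem frameDeriv_inv_tCoord_x (hz : tCoord z ≠ 0) (c : κ) :
    frameDeriv (ambientFrame E) (.inr (.inl c)) (fun y => (tCoord y)⁻¹) z = 0 := by
  simp [frameDeriv_ambientFrame_x, pd_inv_tCoord hz]

theorem frameDeriv_ite {ι : Type*} [Fintype ι] [DecidableEq ι] (E : (ι → ℝ) → Matrix ι κ ℝ)
    (c : κ) (F : (ι → ℝ) → ℝ) (x : ι → ℝ) (p : Prop) [Decidable p] :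
    frameDeriv E c (fun y => if p then F y else 0) x = if p then frameDeriv E c F x else 0 := by
  split_ifs with h
  · rfl
  · exact frameDeriv_const E c 0 x

/-- dt and dϱ are closed and the base coframe depends on neither t nor ϱ, so only the base torsion
can survive. `D` has the same torsion as `C`, which lets the perturbed connection be traded for the
original one. -/
theorem ambientConn_torsion {t ρ : ℝ} {h K A : Matrix κ κ ℝ} {C D : κ → Matrix κ κ ℝ}
    (hh : h.transpose = h) (hK : K.transpose = K)
    (hC : ∀ a c d, C d a c - C c a d = D d a c - D c a d) (a c d : Unit ⊕ (κ ⊕ Unit)) :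
    ambientConn t ρ h K A C d a c - ambientConn t ρ h K A C c a d =
      match a, c, d with
      | .inr (.inl a), .inr (.inl c), .inr (.inl d) => D d a c - D c a d
      | _, _, _ => 0 := by
  have hs : ∀ i j, h i j = h j i := fun i j => congrFun (congrFun hh j) i
  have hKs : ∀ i j, K i j = K j i := fun i j => congrFun (congrFun hK j) i
  rcases c with c | c | c <;> rcases a with a | a | a <;> rcases d with d | d | d <;>
  simp only [ambientConn, ambientConnT, ambientConnX, ambientConnRho, Matrix.of_apply, sub_self,
    hC]
  · rw [hKs c d]; ring
  · rw [hKs c d, hs c d]; ring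

variable {h K A L : (AmbientIndex n → ℝ) → Matrix κ κ ℝ} {C : (AmbientIndex n → ℝ) → κ → Matrix κ κ ℝ}

theorem sum_frameDeriv_ambientConn (ht : tCoord z ≠ 0)
    (hA : ∀ b, ∑ a, frameDeriv (ambientFrame E) (.inr (.inl a)) (fun y => A y a b) z = 0)
    (hhd : ∀ a b, DifferentiableAt ℝ (fun y => h y a b) z)
    (hKd : ∀ a b, DifferentiableAt ℝ (fun y => K y a b) z)
    (hhρ : ∀ a b, pd (.inr (.inr ())) (fun y => h y a b) z = K z a b)
    (hKt : ∀ a b, pd (.inl ()) (fun y => K y a b) z = 0) (b d : Unit ⊕ (κ ⊕ Unit)) :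
    ∑ a, frameDeriv (ambientFrame E) a (fun y => ambientConn (tCoord y) (rhoCoord y) (h y) (K y)
      (A y) (C y) d a b) z =
      match b, d with
      | .inr (.inl b), .inr (.inl d) => -(1 / 2) * K z d b
        + rhoCoord z * pd (.inr (.inr ())) (fun y => K y d b) z
        + ∑ a, frameDeriv (ambientFrame E) (.inr (.inl a)) (fun y => C y d a b) z
      | _, _ => 0 := by
  have htd : DifferentiableAt ℝ (fun y : AmbientIndex n → ℝ => tCoord y) z :=
    contDiff_tCoord.contDiffAt.differentiableAt (by simp)
  have hρd : DifferentiableAt ℝ (fun y : AmbientIndex n → ℝ => rhoCoord y) z :=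
    contDiff_rhoCoord.contDiffAt.differentiableAt (by simp)
  have hpdt : pd (.inl ()) (fun y : AmbientIndex n → ℝ => tCoord y) z = 1 := by
    rw [show (fun y : AmbientIndex n → ℝ => tCoord y) = fun y => y (.inl ()) from rfl, pd_coord]
    simp
  have hpdρ : pd (.inr (.inr ())) (fun y : AmbientIndex n → ℝ => rhoCoord y) z = 1 := by
    rw [show (fun y : AmbientIndex n → ℝ => rhoCoord y) = fun y => y (.inr (.inr ())) from rfl,
      pd_coord]
    simp
  have e1 : ∀ b d, pd (.inl ()) (fun y => -(1 / 2) * tCoord y * K y d b) z =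
      -(1 / 2) * K z d b := by
    intro b d
    rw [pd_mul _ (htd.const_mul _) (hKd d b), pd_const_mul, hpdt, hKt]
    ring
  -- The derivative of -h cancels that of the explicit factor ϱ, because h' = K.
  have e2 : ∀ b d, pd (.inr (.inr ())) (fun y => -h y d b + rhoCoord y * K y d b) z =
      rhoCoord z * pd (.inr (.inr ())) (fun y => K y d b) z := by
    intro b d
    rw [pd_add _ (hhd d b).fun_neg (hρd.fun_mul (hKd d b)), pd_neg, pd_mul _ hρd (hKd d b), hpdρ,
      hhρ]
    ring
  rcases b with b | b | b <;> rcases d with d | d | d <;>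
  simp only [ambientConn, ambientConnT, ambientConnX, ambientConnRho, Matrix.of_apply,
    Fintype.sum_sum_type, Finset.univ_unique, Finset.sum_singleton, frameDeriv_const,
    frameDeriv_ite, frameDeriv_inv_tCoord_x ht, ite_self, Finset.sum_const_zero, add_zero,
    hA, frameDeriv_ambientFrame_t, frameDeriv_ambientFrame_rho,
    pd_inv_tCoord ht, reduceCtorEq, if_false, e1, e2]
  ring

/-- The trace is the logarithmic derivative of the volume density. With n = `Fintype.card κ` this
density is t^(n+1) times a factor that does not depend on ϱ when tr A = 0. -/
theorem sum_ambientConn_trace {t ρ : ℝ} {h K A : Matrix κ κ ℝ} {C : κ → Matrix κ κ ℝ}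
    (hA : ∑ c, A c c = 0) (b : Unit ⊕ (κ ⊕ Unit)) :
    ∑ a, ambientConn t ρ h K A C a a b =
      match b with
      | .inl _ => (Fintype.card κ + 1) * t⁻¹
      | .inr (.inl b) => ∑ c, C c c b
      | .inr (.inr _) => 0 := by
  rcases b with b | b | b <;>
  simp [ambientConn, ambientConnT, ambientConnX, ambientConnRho, Fintype.sum_sum_type, hA]
  ring

theorem sum_ambientConn_sq {t ρ : ℝ} (ht : t ≠ 0) {h K A : Matrix κ κ ℝ} {C : κ → Matrix κ κ ℝ}
    (hh : h.transpose = h) (hK : K.transpose = K) (hhA : h * A = (1 / 2 : ℝ) • K)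
    (hA : ∑ c, A c c = 0) (hKA : K * A = 0)
    (hAA : ∑ a, ∑ c, A c a * A a c = 0) (hAC : ∀ b, ∑ a, ∑ c, A c a * C c a b = 0)
    (b d : Unit ⊕ (κ ⊕ Unit)) :
    ∑ a, ∑ c, ambientConn t ρ h K A C a c d * ambientConn t ρ h K A C c a b =
      match b, d with
      | .inl _, .inl _ => (Fintype.card κ + 1) * (t⁻¹ * t⁻¹)
      | .inr (.inl b), .inl _ => t⁻¹ * ∑ c, C c c b
      | .inl _, .inr (.inl d) => t⁻¹ * ∑ c, C c c d
      | .inr (.inl b), .inr (.inl d) => ∑ a, ∑ c, C a c d * C c a b - 2 * K d b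
      | _, _ => 0 := by
  have hs : ∀ i j, h i j = h j i := fun i j => congrFun (congrFun hh j) i
  have hKs : ∀ i j, K i j = K j i := fun i j => congrFun (congrFun hK j) i
  -- Here h A = ½K gives the answer, and K A = 0 removes the contribution of ϱ.
  have hm : ∀ d b, ∑ a, (-h a d + ρ * K a d) * A a b = -(1 / 2) * K d b := by
    intro d b
    have h1 : ∑ a, h d a * A a b = (1 / 2) * K d b := by
      rw [← Matrix.mul_apply, hhA]; rfl
    have h2 : ∑ a, K d a * A a b = 0 := by rw [← Matrix.mul_apply, hKA]; rfl
    have : ∑ a, (-h a d + ρ * K a d) * A a b =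
        -∑ a, h d a * A a b + ρ * ∑ a, K d a * A a b := by
      rw [Finset.mul_sum, ← Finset.sum_neg_distrib, ← Finset.sum_add_distrib]
      exact Finset.sum_congr rfl fun a _ => by rw [hs a d, hKs a d]; ring
    rw [this, h1, h2]
    ring
  have hm' : ∀ d b, ∑ a, A a b * (-h a d + ρ * K a d) = -(1 / 2) * K d b := by
    intro d b
    rw [← hm]
    exact Finset.sum_congr rfl fun a _ => mul_comm _ _
  have hAC' : ∀ b, ∑ a, ∑ c, C a c b * A a c = 0 := by
    intro b
    rw [Finset.sum_comm, ← hAC b]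
    exact Finset.sum_congr rfl fun a _ => Finset.sum_congr rfl fun c _ => mul_comm _ _
  rcases b with b | b | b <;> rcases d with d | d | d <;>
  simp only [ambientConn, ambientConnT, ambientConnX, ambientConnRho, Matrix.of_apply,
    Fintype.sum_sum_type, Finset.univ_unique, Finset.sum_singleton, mul_zero, zero_mul, add_zero,
    zero_add, Finset.sum_const_zero, mul_ite, ite_mul, Finset.sum_ite_eq, Finset.sum_ite_eq',
    Finset.mem_univ, if_true, Finset.sum_add_distrib, hAA, hAC, hAC', hm, hm', ← Finset.mul_sum,
    ← Finset.sum_mul, hA]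
  · simp only [Finset.sum_const, Finset.card_univ, nsmul_eq_mul]
    ring
  · ring
  · rw [hKs b d]
    field_simp
    ring

/-- The Ricci tensor of an ambient metric, under trace, divergence and nilpotency conditions on the
derivative of `g(x, ϱ)` with respect to `ϱ`. -/
theorem frameRicci_ambientConn {Ω : Set (AmbientIndex n → ℝ)} (hΩ : IsOpen Ω) (hzΩ : z ∈ Ω)
    (ht : tCoord z ≠ 0) (hh : (h z).transpose = h z) (hK : (K z).transpose = K z)
    (hhA : h z * A z = (1 / 2 : ℝ) • K z)
    (hCt : ∀ b, pd (.inl ()) (fun y => ∑ c, C y c c b) z = 0)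
    (hCρ : ∀ b, pd (.inr (.inr ())) (fun y => ∑ c, C y c c b) z = 0)
    (hCA : ∀ b, ∑ c, (∑ a, C z a a c) * A z c b = 0)
    (hA : ∀ y ∈ Ω, ∑ c, A y c c = 0) (hKA : K z * A z = 0)
    (hAA : ∑ a, ∑ c, A z c a * A z a c = 0) (hAC : ∀ b, ∑ a, ∑ c, A z c a * C z c a b = 0)
    (hdA : ∀ b, ∑ a, frameDeriv (ambientFrame E) (.inr (.inl a)) (fun y => A y a b) z = 0)
    (hhd : ∀ a b, DifferentiableAt ℝ (fun y => h y a b) z)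
    (hKd : ∀ a b, DifferentiableAt ℝ (fun y => K y a b) z)
    (hhρ : ∀ a b, pd (.inr (.inr ())) (fun y => h y a b) z = K z a b)
    (hKt : ∀ a b, pd (.inl ()) (fun y => K y a b) z = 0) (b d : Unit ⊕ (κ ⊕ Unit)) :
    frameRicci (ambientFrame E) (fun y => ambientConn (tCoord y) (rhoCoord y) (h y) (K y) (A y)
      (C y)) z b d =
      match b, d with
      | .inr (.inl b), .inr (.inl d) =>
        ∑ a, frameDeriv (ambientFrame E) (.inr (.inl a)) (fun y => C y d a b) z
        - frameDeriv (ambientFrame E) (.inr (.inl d)) (fun y => ∑ a, C y a a b) z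
        + ∑ c, (∑ a, C z a a c) * C z d c b
        - ∑ a, ∑ c, C z a c d * C z c a b
        + rhoCoord z * pd (.inr (.inr ())) (fun y => K y d b) z
        - (Fintype.card κ / 2 - 1) * K z d b
      | _, _ => 0 := by
  simp only [frameRicci, Matrix.of_apply]
  rw [frameDeriv_congr hΩ (fun y hy => sum_ambientConn_trace (hA y hy) b) hzΩ,
    sum_frameDeriv_ambientConn ht hdA hhd hKd hhρ hKt,
    sum_ambientConn_sq ht hh hK hhA (hA z hzΩ) hKA hAA hAC]
  simp only [sum_ambientConn_trace (hA z hzΩ)]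
  have e : pd (.inl ()) (fun y : AmbientIndex n → ℝ => ((Fintype.card κ : ℝ) + 1) * (tCoord y)⁻¹) z
      = -((Fintype.card κ : ℝ) + 1) * (tCoord z ^ 2)⁻¹ := by
    rw [pd_const_mul, pd_inv_tCoord ht, if_pos rfl]
    ring
  have e' : ∀ c : κ, frameDeriv (ambientFrame E) (.inr (.inl c))
      (fun y : AmbientIndex n → ℝ => ((Fintype.card κ : ℝ) + 1) * (tCoord y)⁻¹) z = 0 := by
    intro c
    simp [frameDeriv_ambientFrame_x, pd_const_mul, pd_inv_tCoord ht]
  have e'' : pd (.inr (.inr ())) (fun y : AmbientIndex n → ℝ =>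
      ((Fintype.card κ : ℝ) + 1) * (tCoord y)⁻¹) z = 0 := by
    rw [pd_const_mul, pd_inv_tCoord ht]
    simp
  -- In the base block K has the coefficient -½ from the divergence, -(n + 1)/2 from the trace and
  -- +2 from the square, where n = `Fintype.card κ`; together this is -(n/2 - 1).
  rcases b with b | b | b <;> rcases d with d | d | d <;>
  simp only [ambientConn, ambientConnT, ambientConnX, ambientConnRho, Matrix.of_apply,
    Fintype.sum_sum_type, Finset.univ_unique, Finset.sum_singleton, frameDeriv_const, e, e', e'',
    frameDeriv_ambientFrame_t, frameDeriv_ambientFrame_rho, mul_zero, zero_mul, add_zero,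
    Finset.sum_const_zero, sub_zero, mul_ite, Finset.sum_ite_eq',
    Finset.mem_univ, if_true, hCt, hCρ, hCA, zero_add, zero_sub]
  all_goals
    field_simp
    ring

end AmbientFrameRicci

/-- Only the rows of the base coframe have non-constant entries, and these depend on the base
coordinates alone; the structure equations of the base thus carry over. -/
theorem ambientCoframe_torsionFree {n : ℕ} {κ : Type*} [Fintype κ] [DecidableEq κ]
    {e : (Fin n → ℝ) → Matrix κ (Fin n) ℝ} {z : AmbientIndex n → ℝ}
    (he : ∀ a k, DifferentiableAt ℝ (fun x => e x a k) (xCoord z)) {S : κ → κ → κ → ℝ}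
    (hS : ∀ a i j, pd i (fun y => e y a j) (xCoord z) - pd j (fun y => e y a i) (xCoord z) =
      ∑ c, ∑ d, e (xCoord z) c i * e (xCoord z) d j * S a c d)
    {T : Unit ⊕ (κ ⊕ Unit) → Unit ⊕ (κ ⊕ Unit) → Unit ⊕ (κ ⊕ Unit) → ℝ}
    (hT : ∀ a c d, T a c d = match a, c, d with
      | .inr (.inl a), .inr (.inl c), .inr (.inl d) => S a c d
      | _, _, _ => 0)
    (a : Unit ⊕ (κ ⊕ Unit)) (i j : AmbientIndex n) :
    pd i (fun y => ambientCoframe e y a j) z - pd j (fun y => ambientCoframe e y a i) z =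
      ∑ c, ∑ d, ambientCoframe e z c i * ambientCoframe e z d j * T a c d := by
  have hpt : ∀ (u : Unit) a k, pd (.inl u) (fun y => e (xCoord y) a k) z = 0 := fun _ a k =>
    pd_comp_xCoord_t (he a k)
  have hpρ : ∀ (u : Unit) a k, pd (.inr (.inr u)) (fun y => e (xCoord y) a k) z = 0 :=
    fun _ a k => pd_comp_xCoord_rho (he a k)
  have hpx : ∀ a k i, pd (.inr (.inl i)) (fun y => e (xCoord y) a k) z =
      pd i (fun x => e x a k) (xCoord z) := fun a k i => pd_comp_xCoord_x (he a k) i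
  have hpa : ∀ i (u : Unit) j, pd i (fun y => ambientCoframe e y (.inl u) j) z = 0 := by
    rintro i ⟨⟩ (b | b | b) <;> exact pd_const _ _ _
  have hpb : ∀ i (u : Unit) j, pd i (fun y => ambientCoframe e y (.inr (.inr u)) j) z = 0 := by
    rintro i ⟨⟩ (b | b | b) <;> exact pd_const _ _ _
  rcases a with a | a | a
  · simp only [hpa, hT, mul_zero, Finset.sum_const_zero, sub_zero]
  · simp only [Fintype.sum_sum_type, hT, mul_zero, Finset.sum_const_zero, add_zero, zero_add]
    rcases i with i | i | i <;> rcases j with j | j | j <;>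
    simp only [pd_const, ambientCoframe, Matrix.fromBlocks_apply₁₁, Matrix.fromBlocks_apply₁₂,
      Matrix.fromBlocks_apply₂₁, Matrix.fromBlocks_apply₂₂, Matrix.zero_apply, mul_zero, zero_mul,
      Finset.sum_const_zero, sub_zero, hpt, hpρ, hpx, hS]
  · simp only [hpb, hT, mul_zero, Finset.sum_const_zero, sub_zero]

/-! ### Linearity of the Ricci tensor in a null perturbation. -/

section NullAmbientRicci

variable {n : ℕ} {α : Type*} [Fintype α] [DecidableEq α]
variable {U : Set (Fin n → ℝ)} {J : Set (Fin n)} {ε : ℝ}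
  {e : (Fin n → ℝ) → Matrix (α ⊕ α) (Fin n) ℝ} {E : (Fin n → ℝ) → Matrix (Fin n) (α ⊕ α) ℝ}
  {γ : (Fin n → ℝ) → α ⊕ α → Matrix (α ⊕ α) (α ⊕ α) ℝ}
  {H K : (AmbientIndex n → ℝ) → Matrix α α ℝ} {z : AmbientIndex n → ℝ}
  {G : (AmbientIndex n → ℝ) → Matrix (AmbientIndex n) (AmbientIndex n) ℝ}

theorem nullAmbient_torsionFree (N : IsNullFrame U J e E γ) (hH : IsNullFamily U J ε H K)
    (hz : z ∈ ambientSpace U ε) (a : Unit ⊕ ((α ⊕ α) ⊕ Unit)) (i j : AmbientIndex n) :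
    pd i (fun y => ambientCoframe e y a j) z - pd j (fun y => ambientCoframe e y a i) z =
      ∑ c, ∑ d, ambientCoframe e z c i * ambientCoframe e z d j *
        (nullAmbientConn E γ H K z d a c - nullAmbientConn E γ H K z c a d) := by
  have hhs : (splitForm α + Matrix.fromBlocks (H z) 0 0 0).transpose =
      splitForm α + Matrix.fromBlocks (H z) 0 0 0 := by
    simp [splitForm_transpose, Matrix.fromBlocks_transpose, hH.symm z hz]
  have hKs : (Matrix.fromBlocks (K z) 0 0 0 : Matrix (α ⊕ α) (α ⊕ α) ℝ).transpose =
      Matrix.fromBlocks (K z) 0 0 0 := by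
    simp [Matrix.fromBlocks_transpose, hH.symm_deriv z hz]
  have hC : ∀ a c d, (γ (xCoord z) d + nullDiff E γ H z d) a c
      - (γ (xCoord z) c + nullDiff E γ H z c) a d =
      γ (xCoord z) d a c - γ (xCoord z) c a d := by
    intro a c d
    rw [Matrix.add_apply, Matrix.add_apply, nullDiff_symm (nullNabla_symm N.isOpen hH hz) a c d]
    ring
  exact ambientCoframe_torsionFree
    (fun a k => diffAt_of_contDiffOn (N.smooth_coframe a k) N.isOpen hz.2.1)
    (N.torsionFree _ hz.2.1)
    (T := fun a c d => nullAmbientConn E γ H K z d a c - nullAmbientConn E γ H K z c a d)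
    (fun a c d => ambientConn_torsion hhs hKs hC a c d) a i j

/-- The Levi-Civita connection of `2 d(ϱt) dt + t² eᵀ (splitForm + H) e`. -/
theorem nullAmbient_isLeviCivitaFrame (N : IsNullFrame U J e E γ) (hH : IsNullFamily U J ε H K)
    (hG : ∀ z ∈ ambientSpace U ε,
      G z = (ambientCoframe e z).transpose * nullAmbientGram H z * ambientCoframe e z)
    (hdet : ∀ z ∈ ambientSpace U ε, IsUnit (G z).det) :
    IsLeviCivitaFrame (ambientSpace U ε) G (ambientCoframe e) (ambientFrame E)
      (nullAmbientGram H) (nullAmbientConn E γ H K) where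
  isOpen := isOpen_ambientSpace N.isOpen
  smooth_coframe := smooth_ambientCoframe N.smooth_coframe
  smooth_frame := smooth_ambientFrame N.smooth_frame
  smooth_gram := smooth_nullAmbientGram hH.basic
  smooth_conn := smooth_nullAmbientConn N hH
  frame_mul_coframe := fun _ hz => ambientFrame_mul_coframe (N.frame_mul_coframe _ hz.2.1)
  coframe_mul_frame := fun _ hz => ambientCoframe_mul_frame (N.coframe_mul_frame _ hz.2.1)
  metric_eq := hG
  gram_symm := fun z hz => ambientGram_transpose (by
    simp [splitForm_transpose, Matrix.fromBlocks_transpose, hH.symm z hz])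
  isUnit_det := hdet
  compatible := fun _ hz => nullAmbient_compatible N hH hz
  torsionFree := fun _ hz => nullAmbient_torsionFree N hH hz

/-- The only non-zero block of `nullDiff` maps the first half of the frame, in directions of the
first half, to the null half, so it is never met by the trace. This reflects that adding `H` does
not change the volume form. -/
theorem nullDiff_trace (z : AmbientIndex n → ℝ) (b : α ⊕ α) :
    ∑ c, nullDiff E γ H z c c b = 0 := by
  rcases b with b | b <;> simp [Fintype.sum_sum_type, nullDiff]

/-- The terms of the first half vanish because the null distribution is parallel. For the null half,
skewness converts `flat` into the vanishing of the corresponding entries. -/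
theorem IsNullFrame.trace_inr (N : IsNullFrame U J e E γ) {x : Fin n → ℝ} (hx : x ∈ U) (b : α) :
    ∑ c, γ x c c (.inr b) = 0 := by
  have h : ∀ a, γ x (.inr a) (.inr a) (.inr b) = 0 := by
    intro a
    have hs := congrFun (congrFun (N.skew x hx (.inr a)) (.inl a)) (.inr b)
    simpa [splitForm, Matrix.mul_apply, Fintype.sum_sum_type, Matrix.one_apply,
      N.flat x hx] using hs
  simp only [Fintype.sum_sum_type, N.parallel x hx, h, Finset.sum_const_zero, add_zero]

theorem IsNullFrame.basic_trace (N : IsNullFrame U J e E γ) (b : α ⊕ α) :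
    IsBasic U J fun x => ∑ c, γ x c c b :=
  IsBasic.sum N.isOpen fun c _ => N.basic_conn c c b

theorem sum_conn_add_nullDiff_trace (z : AmbientIndex n → ℝ) (b : α ⊕ α) :
    ∑ c, (γ (xCoord z) c + nullDiff E γ H z c) c b = ∑ c, γ (xCoord z) c c b := by
  simp only [Matrix.add_apply, Finset.sum_add_distrib, nullDiff_trace, add_zero]

theorem frameRicci_isNullFrame (N : IsNullFrame U J e E γ) {x : Fin n → ℝ} (hx : x ∈ U)
    (b d : α ⊕ α) : frameRicci E γ x b d =
      ∑ a, frameDeriv E (.inl a) (fun y => γ y d (.inl a) b) x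
        - frameDeriv E d (fun y => ∑ a, γ y a a b) x
        + ∑ c, (∑ a, γ x a a (.inl c)) * γ x d (.inl c) b
        - ∑ a, ∑ c, γ x a c d * γ x c a b := by
  simp only [frameRicci, Matrix.of_apply]
  rw [Fintype.sum_sum_type (α₁ := α), Fintype.sum_sum_type (α₁ := α) (fun c => (∑ a, γ x a a c) * _)]
  simp only [N.trace_inr hx, zero_mul, Finset.sum_const_zero]
  have : ∀ a, frameDeriv E (.inr a) (fun y => γ y d (.inr a) b) x = 0 := fun a =>
    (N.basic_conn d (.inr a) b).frameDeriv_inr hx fun k hk => N.frame_inr x hx k hk a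
  simp only [this, Finset.sum_const_zero]
  ring

/-- A non-zero entry of `nullDiff` in one factor has a non-null direction and a null row. The other
factor then has a null direction and a non-null row, and vanishes by `flat` and `parallel`. -/
theorem sum_nullDiff_sq (N : IsNullFrame U J e E γ) (hz : z ∈ ambientSpace U ε) (b d : α ⊕ α) :
    ∑ a, ∑ c, (γ (xCoord z) a + nullDiff E γ H z a) c d * (γ (xCoord z) c + nullDiff E γ H z c) a b
      = ∑ a, ∑ c, γ (xCoord z) a c d * γ (xCoord z) c a b := by
  refine Finset.sum_congr rfl fun a _ => Finset.sum_congr rfl fun c _ => ?_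
  have hf := N.flat _ hz.2.1
  have hp := N.parallel _ hz.2.1
  rcases a with a | a <;> rcases c with c | c <;> rcases b with b | b <;> rcases d with d | d <;>
  simp [nullDiff, hf, hp]

/-- The Ricci tensor of `2 d(ϱt) dt + t² eᵀ (splitForm + H) e` is `Ric₀ + ϱ H'' - (m - 1) H'`, where
`m` is half the dimension of the base. -/
theorem frameRicci_nullAmbientConn (N : IsNullFrame U J e E γ) (hH : IsNullFamily U J ε H K)
    (hz : z ∈ ambientSpace U ε) (b d : Unit ⊕ ((α ⊕ α) ⊕ Unit)) :
    frameRicci (ambientFrame E) (nullAmbientConn E γ H K) z b d =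
      match b, d with
      | .inr (.inl b), .inr (.inl d) => frameRicci E γ (xCoord z) b d
        + rhoCoord z * pd (.inr (.inr ()))
          (fun y => (Matrix.fromBlocks (K y) 0 0 0 : Matrix (α ⊕ α) (α ⊕ α) ℝ) d b) z
        - (Fintype.card α - 1) * (Matrix.fromBlocks (K z) 0 0 0 : Matrix (α ⊕ α) (α ⊕ α) ℝ) d b
      | _, _ => 0 := by
  have hΩ := isOpen_ambientSpace (ε := ε) N.isOpen
  have hf := N.flat _ hz.2.1
  have hp := N.parallel _ hz.2.1
  -- Nilpotency supplies the algebraic hypotheses: A = ½h⁻¹K equals ½ `splitForm` K, maps the first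
  -- half of the frame to the null half and kills the latter. Its divergence vanishes because its
  -- rows are differentiated along null vectors.
  have key := frameRicci_ambientConn (E := E) (z := z)
    (h := fun y => splitForm α + Matrix.fromBlocks (H y) 0 0 0)
    (K := fun y => (Matrix.fromBlocks (K y) 0 0 0 : Matrix (α ⊕ α) (α ⊕ α) ℝ))
    (A := fun y => (Matrix.fromBlocks 0 0 ((1 / 2 : ℝ) • K y) 0 : Matrix (α ⊕ α) (α ⊕ α) ℝ))
    (C := fun y c => γ (xCoord y) c + nullDiff E γ H y c) hΩ hz hz.1.ne'
    (by simp [splitForm_transpose, Matrix.fromBlocks_transpose, hH.symm z hz])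
    (by simp [Matrix.fromBlocks_transpose, hH.symm_deriv z hz])
    (by simp [splitForm, Matrix.fromBlocks_add, Matrix.fromBlocks_multiply,
      Matrix.fromBlocks_smul])
    (fun b => by
      simp only [sum_conn_add_nullDiff_trace]
      exact pd_comp_xCoord_t ((N.basic_trace b).diffAt N.isOpen hz.2.1))
    (fun b => by
      simp only [sum_conn_add_nullDiff_trace]
      exact pd_comp_xCoord_rho ((N.basic_trace b).diffAt N.isOpen hz.2.1))
    (fun b => by
      simp only [sum_conn_add_nullDiff_trace]
      rw [Fintype.sum_sum_type]
      simp only [N.trace_inr hz.2.1]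
      rcases b with b | b <;> simp)
    (fun y hy => by simp [Fintype.sum_sum_type])
    (by simp [Matrix.fromBlocks_multiply])
    (by simp [Fintype.sum_sum_type])
    (fun b => by rcases b with b | b <;> simp [Fintype.sum_sum_type, nullDiff, hf, hp])
    (fun b => by
      have : ∀ a b, frameDeriv (ambientFrame E) (.inr (.inl (.inr a)))
          (fun y => 2⁻¹ * K y a b) z = 0 := fun a b =>
        ((isBasic_const 2⁻¹).mul hΩ (hH.basic_deriv a b)).frameDeriv_inr hz
          (N.ambientFrame_inr hz a)
      rcases b with b | b <;> simp [Fintype.sum_sum_type, frameDeriv_const, this])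
    (fun a b => ((isBasic_const (splitForm α a b)).add hΩ
      (isBasic_fromBlocks hH.basic a b)).diffAt hΩ hz)
    (fun a b => (isBasic_fromBlocks hH.basic_deriv a b).diffAt hΩ hz)
    (fun a b => by
      have h1 := pd_add (F := fun _ => splitForm α a b) (.inr (.inr ())) (differentiableAt_const _)
        ((isBasic_fromBlocks hH.basic a b).diffAt hΩ hz)
      rw [pd_const, zero_add] at h1
      refine h1.trans ?_
      rcases a with a | a <;> rcases b with b | b
      · exact hH.deriv z hz a b
      all_goals exact pd_const _ _ _)
    (fun a b => (isBasic_fromBlocks hH.basic_deriv a b).pd_t hz)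
    b d
  refine key.trans ?_
  rcases b with b | b | b <;> rcases d with d | d | d
  all_goals try rfl
  simp only [sum_conn_add_nullDiff_trace]
  rw [sum_nullDiff_sq N hz, frameRicci_isNullFrame N hz.2.1,
    frameDeriv_comp_xCoord ((N.basic_trace b).diffAt N.isOpen hz.2.1)]
  have ht : ∑ c, (∑ a, γ (xCoord z) a a c) * (γ (xCoord z) d + nullDiff E γ H z d) c b =
      ∑ c, (∑ a, γ (xCoord z) a a (.inl c)) * γ (xCoord z) d (.inl c) b := by
    rw [Fintype.sum_sum_type]
    simp only [N.trace_inr hz.2.1, zero_mul, Finset.sum_const_zero, add_zero]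
    rcases d with d | d <;> rcases b with b | b <;> simp [nullDiff]
  -- `nullDiff` has entries only in null rows, which the divergence differentiates along null
  -- vectors; they contribute nothing.
  have hd : ∑ a, frameDeriv (ambientFrame E) (.inr (.inl a))
      (fun y => (γ (xCoord y) d + nullDiff E γ H y d) a b) z =
      ∑ a, frameDeriv E (.inl a) (fun y => γ y d (.inl a) b) (xCoord z) := by
    have hb : ∀ a, IsBasic (ambientSpace U ε) (ambientActive J)
        fun y => (γ (xCoord y) d + nullDiff E γ H y d) a b := fun a =>
      ((N.basic_conn d a b).comp_xCoord N.isOpen).add hΩ (isBasic_nullDiff N hH.basic d a b)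
    rw [Fintype.sum_sum_type]
    have h1 : ∀ a, frameDeriv (ambientFrame E) (.inr (.inl (.inr a)))
        (fun y => (γ (xCoord y) d + nullDiff E γ H y d) (.inr a) b) z = 0 := fun a =>
      (hb (.inr a)).frameDeriv_inr hz (N.ambientFrame_inr hz a)
    simp only [h1, Finset.sum_const_zero, add_zero]
    refine Finset.sum_congr rfl fun a _ => ?_
    rw [← frameDeriv_comp_xCoord ((N.basic_conn d (.inl a) b).diffAt N.isOpen hz.2.1)]
    congr 1
    ext y
    rcases d with d | d <;> rcases b with b | b <;> simp [nullDiff]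
  rw [hd, ht]
  simp only [Fintype.card_sum, Nat.cast_add]
  ring

end NullAmbientRicci

/-! ### Functions of (x¹, x³) as functions on ℝ⁶. -/

section Pullback

/-- The derivative of `φ` with respect to `x¹`. -/
noncomputable def d1 (φ : ℝ × ℝ → ℝ) (p : ℝ × ℝ) : ℝ := fderiv ℝ φ p (1, 0)

/-- The derivative of `φ` with respect to `x³`. -/
noncomputable def d3 (φ : ℝ × ℝ → ℝ) (p : ℝ × ℝ) : ℝ := fderiv ℝ φ p (0, 1)

/-- The projection `proj13` as a continuous linear map. -/
noncomputable def proj13L : (Fin 6 → ℝ) →L[ℝ] ℝ × ℝ :=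
  (ContinuousLinearMap.proj 0).prod (ContinuousLinearMap.proj 2)

theorem isOpen_image_proj13 {U : Set (Fin 6 → ℝ)} (hU : IsOpen U) : IsOpen (proj13 '' U) := by
  have h : Function.Surjective proj13L := by
    rintro ⟨a, b⟩
    exact ⟨![a, 0, b, 0, 0, 0], rfl⟩
  exact proj13L.isOpenMap h U hU

variable {W : Set (ℝ × ℝ)} {U : Set (Fin 6 → ℝ)} {φ ψ : ℝ × ℝ → ℝ}

theorem contDiffOn_d1 (hW : IsOpen W) (hφ : ContDiffOn ℝ ∞ φ W) : ContDiffOn ℝ ∞ (d1 φ) W :=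
  (hφ.fderiv_of_isOpen hW (m := ∞) (by simp)).clm_apply contDiffOn_const

theorem contDiffOn_d3 (hW : IsOpen W) (hφ : ContDiffOn ℝ ∞ φ W) : ContDiffOn ℝ ∞ (d3 φ) W :=
  (hφ.fderiv_of_isOpen hW (m := ∞) (by simp)).clm_apply contDiffOn_const

theorem d1_d3_comm (hW : IsOpen W) (hφ : ContDiffOn ℝ ∞ φ W) {p : ℝ × ℝ} (hp : p ∈ W) :
    d1 (d3 φ) p = d3 (d1 φ) p := by
  have h := hφ.contDiffAt (hW.mem_nhds hp)
  have hs : IsSymmSndFDerivAt ℝ φ p := h.isSymmSndFDerivAt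
    (by rw [minSmoothness_of_isRCLikeNormedField]; exact WithTop.coe_le_coe.2 (le_top : (2 : ℕ∞) ≤ ⊤))
  have hd : DifferentiableAt ℝ (fderiv ℝ φ) p :=
    (h.fderiv_right (m := ∞) (by simp)).differentiableAt (by simp)
  unfold d1 d3
  rw [fderiv_clm_apply hd (differentiableAt_const _), fderiv_clm_apply hd (differentiableAt_const _)]
  simpa using hs (1, 0) (0, 1)

theorem pd_pull13 {x : Fin 6 → ℝ} (hφ : DifferentiableAt ℝ φ (proj13 x)) (i : Fin 6) :
    pd i (pull13 φ) x =
      if i = 0 then d1 φ (proj13 x) else if i = 2 then d3 φ (proj13 x) else 0 := by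
  have h : fderiv ℝ (pull13 φ) x = (fderiv ℝ φ (proj13 x)).comp proj13L :=
    (hφ.hasFDerivAt.comp x proj13L.hasFDerivAt).fderiv
  rw [pd, h]
  have h2 : proj13L (Pi.single i 1) = ((if i = 0 then 1 else 0, if i = 2 then 1 else 0) : ℝ × ℝ) := by
    ext <;> simp [proj13L, Pi.single_apply, eq_comm]
  rw [ContinuousLinearMap.comp_apply, h2]
  split_ifs with h0 h2
  · subst h0; simp at h2
  · rfl
  · rfl
  · exact map_zero _

theorem isBasic_pull13 (hU : IsOpen U) (hφ : ContDiffOn ℝ ∞ φ (proj13 '' U)) :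
    IsBasic U {0, 2} (pull13 φ) := by
  refine ⟨hφ.comp proj13L.contDiff.contDiffOn fun x hx => ⟨x, hx, rfl⟩, fun x hx i hi => ?_⟩
  rw [pd_pull13 ((hφ.contDiffAt ((isOpen_image_proj13 hU).mem_nhds ⟨x, hx, rfl⟩)).differentiableAt
    (by simp))]
  simp only [Set.mem_insert_iff, Set.mem_singleton_iff, not_or] at hi
  rw [if_neg hi.1, if_neg hi.2]

end Pullback

/-! ### Bryant's coframe and its connection matrices. -/

section BryantFrame

/-- The coframe `(θ², θ⁴, θ⁶, θ⁵, θ¹, θ³)` at a point with coordinates `x¹ = x₁`, `x² = x₂`, where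
`f`, `f₃`, `f₁₃` and `f₃₃` take the values `f`, `u`, `p` and `q`. -/
noncomputable def bryantCoframe (x₁ x₂ f u p q : ℝ) : Matrix (Fin 3 ⊕ Fin 3) (Fin 6) ℝ :=
  Matrix.fromRows
    !![f, 0, 0, 0, 1, 0;
      3 / 2 * u ^ 2, 0, 0, 0, 0, 0;
      1 / 2 * p * f, 0, 3 / 2 * u ^ 2, 0, 1 / 2 * p, 0]
    !![0, 3 / 2 * u, -(1 / 2 * q * x₂), -(1 / 2 * q), 0, 0;
      0, 0, x₂, 1, 0, 0;
      0, x₁, 0, 0, 0, 1]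

/-- The frame dual to `bryantCoframe`, where `r = 1 / u`. -/
noncomputable def bryantFrame (x₁ x₂ f r p q : ℝ) : Matrix (Fin 6) (Fin 3 ⊕ Fin 3) ℝ :=
  Matrix.fromCols
    !![0, 2 / 3 * r ^ 2, 0;
      0, 0, 0;
      -(1 / 3 * r ^ 2 * p), 0, 2 / 3 * r ^ 2;
      1 / 3 * r ^ 2 * p * x₂, 0, -(2 / 3 * r ^ 2 * x₂);
      1, -(2 / 3 * r ^ 2 * f), 0;
      0, 0, 0]
    !![0, 0, 0;
      2 / 3 * r, 1 / 3 * r * q, 0;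
      0, 0, 0;
      0, 1, 0;
      0, 0, 0;
      -(2 / 3 * r * x₁), -(1 / 3 * r * q * x₁), 1]

/-- The first half of the connection matrices in the directions dual to `θ²`, `θ⁴`, `θ⁶`, where
`p = f₁₃`, `q = f₃₃`, `s = f₁₁₃`, `t = f₁₃₃`, `v = f₃₃₃`. -/
noncomputable def bryantConnB (r p q s t v : ℝ) : Fin 3 → Matrix (Fin 3) (Fin 3) ℝ :=
  ![!![-4 / 9 * p * q * r ^ 3, 5 / 9 * p * r ^ 3, 4 / 9 * q * r ^ 3;
      -2 / 9 * p * q ^ 2 * r ^ 3 + 1 / 6 * p * v * r ^ 2, 5 / 9 * p * q * r ^ 3 - 1 / 6 * t * r ^ 2,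
        2 / 9 * q ^ 2 * r ^ 3 - 1 / 6 * v * r ^ 2;
      0, 1 / 6 * s * r ^ 2 - 5 / 18 * p ^ 2 * r ^ 3, 1 / 6 * t * r ^ 2],
    !![1 / 3 * p * r ^ 3, 0, 2 / 9 * r ^ 3;
      -1 / 9 * p * q * r ^ 3 - 1 / 6 * t * r ^ 2, 0, 2 / 3 * q * r ^ 3;
      -1 / 6 * s * r ^ 2 + 5 / 18 * p ^ 2 * r ^ 3, 0, -5 / 9 * p * r ^ 3],
    !![4 / 9 * q * r ^ 3, -2 / 9 * r ^ 3, 0;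
      2 / 9 * q ^ 2 * r ^ 3 - 1 / 6 * v * r ^ 2, -2 / 3 * q * r ^ 3, 0;
      -1 / 6 * t * r ^ 2, 5 / 9 * p * r ^ 3, 0]]

/-- The antisymmetric matrix with the entries `a`, `b`, `c` above the diagonal. -/
def skewMat (a b c : ℝ) : Matrix (Fin 3) (Fin 3) ℝ := !![0, a, b; -a, 0, c; -b, -c, 0]

/-- The connection matrices in the directions dual to `θ⁵`, `θ¹`, `θ³`. -/
noncomputable def bryantConnC (r p q s t v : ℝ) : Fin 3 → Matrix (Fin 3) (Fin 3) ℝ :=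
  ![skewMat (1 / 3 * p * r ^ 3) (4 / 9 * q * r ^ 3) (-2 / 9 * r ^ 3),
    skewMat (4 / 9 * p * q * r ^ 3 - 1 / 6 * t * r ^ 2) (2 / 9 * q ^ 2 * r ^ 3 - 1 / 6 * v * r ^ 2)
      (4 / 9 * q * r ^ 3),
    skewMat (1 / 6 * s * r ^ 2 - 5 / 18 * p ^ 2 * r ^ 3) (1 / 6 * t * r ^ 2) (-5 / 9 * p * r ^ 3)]

/-- The Levi-Civita connection of Bryant's metric in the frame `bryantFrame`. -/
noncomputable def bryantConn (r p q s t v : ℝ) :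
    Fin 3 ⊕ Fin 3 → Matrix (Fin 3 ⊕ Fin 3) (Fin 3 ⊕ Fin 3) ℝ
  | .inl c => Matrix.fromBlocks (bryantConnB r p q s t v c) 0 0 (-(bryantConnB r p q s t v c).transpose)
  | .inr c => Matrix.fromBlocks 0 0 (bryantConnC r p q s t v c) 0

theorem bryantCoframe_mul_frame {x₁ x₂ f u r p q : ℝ} (h : u * r = 1) :
    bryantCoframe x₁ x₂ f u p q * bryantFrame x₁ x₂ f r p q = 1 := by
  have h2 : u ^ 2 * r ^ 2 = 1 := by rw [← mul_pow, h, one_pow]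
  ext (a | a) (b | b) <;> fin_cases a <;> fin_cases b <;>
  simp [bryantCoframe, bryantFrame, Matrix.mul_apply, Fin.sum_univ_six] <;>
  first
    | ring1
    | linear_combination h2
    | linear_combination (-1 / 2 * p) * h2
    | linear_combination h
    | linear_combination (1 / 2 * q) * h

theorem bryantFrame_mul_coframe {x₁ x₂ f u r p q : ℝ} (h : u * r = 1) :
    bryantFrame x₁ x₂ f r p q * bryantCoframe x₁ x₂ f u p q = 1 :=
  (Matrix.mul_eq_one_comm_of_card_eq _ _ _ (by simp)).1 (bryantCoframe_mul_frame h)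

end BryantFrame

/-! ### Structure equations of Bryant's coframe. -/

section BryantTorsion

/-- The derivative of `bryantCoframe` in a direction in which its arguments have the derivatives
`dx₁`, `dx₂`, `df`, `du`, `dp`, `dq`. -/
noncomputable def bryantCoframeDeriv (x₂ f u p q dx₁ dx₂ df du dp dq : ℝ) :
    Matrix (Fin 3 ⊕ Fin 3) (Fin 6) ℝ :=
  Matrix.fromRows
    !![df, 0, 0, 0, 0, 0;
      3 * u * du, 0, 0, 0, 0, 0;
      1 / 2 * (dp * f + p * df), 0, 3 * u * du, 0, 1 / 2 * dp, 0]
    !![0, 3 / 2 * du, -(1 / 2 * (dq * x₂ + q * dx₂)), -(1 / 2 * dq), 0, 0;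
      0, 0, dx₂, 0, 0, 0;
      0, dx₁, 0, 0, 0, 0]

theorem pd_bryantCoframe {x : Fin 6 → ℝ} {f u p q : (Fin 6 → ℝ) → ℝ}
    (hf : DifferentiableAt ℝ f x) (hu : DifferentiableAt ℝ u x)
    (hp : DifferentiableAt ℝ p x) (hq : DifferentiableAt ℝ q x) (i j : Fin 6) (a : Fin 3 ⊕ Fin 3) :
    pd i (fun y => bryantCoframe (y 0) (y 1) (f y) (u y) (p y) (q y) a j) x =
      bryantCoframeDeriv (x 1) (f x) (u x) (p x) (q x) (if i = 0 then 1 else 0)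
        (if i = 1 then 1 else 0) (pd i f x) (pd i u x) (pd i p x) (pd i q x) a j := by
  have hx1 : DifferentiableAt ℝ (fun y : Fin 6 → ℝ => y 1) x := differentiableAt_apply 1 x
  have e1 : pd i (fun y => 3 / 2 * u y ^ 2) x = 3 * u x * pd i u x := by
    simp only [pow_two]
    rw [pd_const_mul, pd_mul i hu hu]
    ring
  have e2 : pd i (fun y => 1 / 2 * p y * f y) x = 1 / 2 * (pd i p x * f x + p x * pd i f x) := by
    simp only [mul_assoc]
    rw [pd_const_mul, pd_mul i hp hf]
  have e3 : pd i (fun y => -(1 / 2 * q y * y 1)) x =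
      -(1 / 2 * (pd i q x * x 1 + q x * if i = 1 then 1 else 0)) := by
    simp only [mul_assoc]
    rw [pd_neg, pd_const_mul, pd_mul i hq hx1, pd_coord]
  have e4 : pd i (fun y => -(1 / 2 * q y)) x = -(1 / 2 * pd i q x) := by
    rw [pd_neg, pd_const_mul]
  have e5 : pd i (fun y => 3 / 2 * u y) x = 3 / 2 * pd i u x := pd_const_mul _ _
  have e6 : pd i (fun y => 1 / 2 * p y) x = 1 / 2 * pd i p x := pd_const_mul _ _
  have e0 : ∀ c : ℝ, pd i (fun _ => c) x = 0 := fun c => pd_const i c x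
  rcases a with a | a <;> fin_cases a <;> fin_cases j <;>
    first
      | exact e0 _
      | exact e1
      | exact e2
      | exact e3
      | exact e4
      | exact e5
      | exact e6
      | rfl
      | exact pd_coord _ _

/-- The exterior derivatives of the coframe `bryantCoframe`, evaluated on two vectors with
components `X` and `Y` in the frame. -/
theorem bryantConn_torsion (r p q s t v : ℝ) (X Y : Fin 3 ⊕ Fin 3 → ℝ) (a : Fin 3 ⊕ Fin 3) :
    ∑ c, ∑ d, X c * Y d * (bryantConn r p q s t v d a c - bryantConn r p q s t v c a d) =
      Sum.elim
        ![-2 / 9 * p * r ^ 3 * (X (.inl 0) * Y (.inl 1) - X (.inl 1) * Y (.inl 0))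
            - 4 / 9 * r ^ 3 * (X (.inl 1) * Y (.inl 2) - X (.inl 2) * Y (.inl 1)),
          -2 / 3 * p * q * r ^ 3 * (X (.inl 0) * Y (.inl 1) - X (.inl 1) * Y (.inl 0))
            - 4 / 3 * q * r ^ 3 * (X (.inl 1) * Y (.inl 2) - X (.inl 2) * Y (.inl 1)),
          (-1 / 3 * s * r ^ 2 + 5 / 9 * p ^ 2 * r ^ 3)
              * (X (.inl 0) * Y (.inl 1) - X (.inl 1) * Y (.inl 0))
            - 1 / 3 * t * r ^ 2 * (X (.inl 0) * Y (.inl 2) - X (.inl 2) * Y (.inl 0))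
            + 10 / 9 * p * r ^ 3 * (X (.inl 1) * Y (.inl 2) - X (.inl 2) * Y (.inl 1))]
        ![(2 / 9 * p * q ^ 2 * r ^ 3 - 1 / 6 * p * v * r ^ 2)
              * (X (.inr 1) * Y (.inl 0) - X (.inl 0) * Y (.inr 1))
            + (-1 / 3 * p * q * r ^ 3 + 1 / 3 * t * r ^ 2)
              * (X (.inr 1) * Y (.inl 1) - X (.inl 1) * Y (.inr 1))
            - 4 / 9 * p * q * r ^ 3 * (X (.inl 0) * Y (.inr 0) - X (.inr 0) * Y (.inl 0))
            + 2 / 3 * p * r ^ 3 * (X (.inl 1) * Y (.inr 0) - X (.inr 0) * Y (.inl 1))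
            + (-4 / 9 * q ^ 2 * r ^ 3 + 1 / 3 * v * r ^ 2)
              * (X (.inr 1) * Y (.inl 2) - X (.inl 2) * Y (.inr 1))
            - 8 / 9 * q * r ^ 3 * (X (.inr 0) * Y (.inl 2) - X (.inl 2) * Y (.inr 0)),
          -1 / 9 * p * q * r ^ 3 * (X (.inr 1) * Y (.inl 0) - X (.inl 0) * Y (.inr 1))
            + 2 / 9 * p * r ^ 3 * (X (.inl 0) * Y (.inr 0) - X (.inr 0) * Y (.inl 0))
            + 2 / 9 * q * r ^ 3 * (X (.inr 1) * Y (.inl 2) - X (.inl 2) * Y (.inr 1))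
            + 4 / 9 * r ^ 3 * (X (.inr 0) * Y (.inl 2) - X (.inl 2) * Y (.inr 0)),
          -2 / 9 * q * r ^ 3 * (X (.inr 1) * Y (.inl 1) - X (.inl 1) * Y (.inr 1))
            + 4 / 9 * r ^ 3 * (X (.inl 1) * Y (.inr 0) - X (.inr 0) * Y (.inl 1))] a := by
  rcases a with a | a <;> fin_cases a <;>
  simp [Fintype.sum_sum_type, Fin.sum_univ_three, bryantConn, bryantConnB, bryantConnC, skewMat] <;>
  ring

end BryantTorsion

section BryantTorsion

/-- The gradient of a function of `x¹`, `x³` with the partial derivatives `a`, `b`. -/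
def grad13 (a b : ℝ) (i : Fin 6) : ℝ := if i = 0 then a else if i = 2 then b else 0

variable {x₁ x₂ f f₁ u r p q s t v : ℝ}

-- With the double sum already evaluated by `bryantConn_torsion`, each component of the structure
-- equations is a rational identity in u = f₃. The gradients fed to the left side encode that p and
-- q have partial derivatives (s, t) and (t, v).
set_option maxHeartbeats 2000000 in
theorem bryantCoframe_torsionFree_of_lt (h : u * r = 1) (a : Fin 3 ⊕ Fin 3) {i j : Fin 6}
    (hij : i < j) :
    bryantCoframeDeriv x₂ f u p q (if i = 0 then 1 else 0) (if i = 1 then 1 else 0)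
        (grad13 f₁ u i) (grad13 p q i) (grad13 s t i) (grad13 t v i) a j -
      bryantCoframeDeriv x₂ f u p q (if j = 0 then 1 else 0) (if j = 1 then 1 else 0)
        (grad13 f₁ u j) (grad13 p q j) (grad13 s t j) (grad13 t v j) a i =
      ∑ c, ∑ d, bryantCoframe x₁ x₂ f u p q c i * bryantCoframe x₁ x₂ f u p q d j *
        (bryantConn r p q s t v d a c - bryantConn r p q s t v c a d) := by
  rw [bryantConn_torsion r p q s t v (fun c => bryantCoframe x₁ x₂ f u p q c i)
    (fun d => bryantCoframe x₁ x₂ f u p q d j)]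
  have hu : u ≠ 0 := left_ne_zero_of_mul_eq_one h
  obtain rfl : r = u⁻¹ := (inv_eq_of_mul_eq_one_right h).symm
  clear h
  rcases a with a | a <;> fin_cases a <;> fin_cases i <;> fin_cases j <;>
  first
    | exact absurd hij (by decide)
    | (simp [bryantCoframe, bryantCoframeDeriv, grad13]
       try first | ring1 | (field_simp; done) | (field_simp; ring1))

/-- Both sides are antisymmetric in i and j, so the case i < j suffices. -/
theorem bryantCoframe_torsionFree (h : u * r = 1) (a : Fin 3 ⊕ Fin 3) (i j : Fin 6) :
    bryantCoframeDeriv x₂ f u p q (if i = 0 then 1 else 0) (if i = 1 then 1 else 0)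
        (grad13 f₁ u i) (grad13 p q i) (grad13 s t i) (grad13 t v i) a j -
      bryantCoframeDeriv x₂ f u p q (if j = 0 then 1 else 0) (if j = 1 then 1 else 0)
        (grad13 f₁ u j) (grad13 p q j) (grad13 s t j) (grad13 t v j) a i =
      ∑ c, ∑ d, bryantCoframe x₁ x₂ f u p q c i * bryantCoframe x₁ x₂ f u p q d j *
        (bryantConn r p q s t v d a c - bryantConn r p q s t v c a d) := by
  rcases lt_trichotomy i j with hij | rfl | hij
  · exact bryantCoframe_torsionFree_of_lt h a hij
  · rw [sub_self, eq_comm, ← self_eq_neg, ← Finset.sum_neg_distrib]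
    conv_lhs => rw [Finset.sum_comm]
    simp only [← Finset.sum_neg_distrib]
    exact Finset.sum_congr rfl fun c _ => Finset.sum_congr rfl fun d _ => by ring
  · rw [← neg_sub, bryantCoframe_torsionFree_of_lt h a hij, Finset.sum_comm]
    simp only [← Finset.sum_neg_distrib]
    exact Finset.sum_congr rfl fun c _ => Finset.sum_congr rfl fun d _ => by ring

end BryantTorsion

/-! ### Bryant's coframe is a null frame. -/

section BryantNullFrame

theorem skewMat_transpose (a b c : ℝ) : (skewMat a b c).transpose = -skewMat a b c := by
  ext i j
  fin_cases i <;> fin_cases j <;> simp [skewMat]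

theorem bryantConnC_transpose (r p q s t v : ℝ) (c : Fin 3) :
    (bryantConnC r p q s t v c).transpose = -bryantConnC r p q s t v c := by
  fin_cases c <;> exact skewMat_transpose _ _ _

/-- A matrix with zero upper right block is skew for the split form exactly when its diagonal blocks
are B and -Bᵀ and its lower left block is skew-symmetric. -/
theorem bryantConn_skew (r p q s t v : ℝ) (c : Fin 3 ⊕ Fin 3) :
    splitForm (Fin 3) * bryantConn r p q s t v c +
      (bryantConn r p q s t v c).transpose * splitForm (Fin 3) = 0 := by
  rcases c with c | c <;>
  simp [splitForm, bryantConn, Matrix.fromBlocks_multiply, Matrix.fromBlocks_transpose,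
    Matrix.fromBlocks_add, bryantConnC_transpose]

section Smooth

variable {X : Type*} [NormedAddCommGroup X] [NormedSpace ℝ X] {W : Set X}
  {x₁ x₂ f u r p q s t v : X → ℝ}

theorem contDiffOn_bryantConnB (hr : ContDiffOn ℝ ∞ r W) (hp : ContDiffOn ℝ ∞ p W)
    (hq : ContDiffOn ℝ ∞ q W) (hs : ContDiffOn ℝ ∞ s W) (ht : ContDiffOn ℝ ∞ t W)
    (hv : ContDiffOn ℝ ∞ v W) (c a b : Fin 3) :
    ContDiffOn ℝ ∞ (fun y => bryantConnB (r y) (p y) (q y) (s y) (t y) (v y) c a b) W := by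
  fin_cases c <;> fin_cases a <;> fin_cases b <;> simp [bryantConnB] <;> fun_prop

theorem contDiffOn_skewMat (hr : ContDiffOn ℝ ∞ r W) (hp : ContDiffOn ℝ ∞ p W)
    (hq : ContDiffOn ℝ ∞ q W) (a b : Fin 3) :
    ContDiffOn ℝ ∞ (fun y => skewMat (r y) (p y) (q y) a b) W := by
  fin_cases a <;> fin_cases b <;> simp [skewMat] <;> fun_prop

theorem contDiffOn_bryantConnC (hr : ContDiffOn ℝ ∞ r W) (hp : ContDiffOn ℝ ∞ p W)
    (hq : ContDiffOn ℝ ∞ q W) (hs : ContDiffOn ℝ ∞ s W) (ht : ContDiffOn ℝ ∞ t W)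
    (hv : ContDiffOn ℝ ∞ v W) (c a b : Fin 3) :
    ContDiffOn ℝ ∞ (fun y => bryantConnC (r y) (p y) (q y) (s y) (t y) (v y) c a b) W := by
  fin_cases c <;>
  exact contDiffOn_skewMat (by fun_prop) (by fun_prop) (by fun_prop) a b

theorem contDiffOn_bryantConn (hr : ContDiffOn ℝ ∞ r W) (hp : ContDiffOn ℝ ∞ p W)
    (hq : ContDiffOn ℝ ∞ q W) (hs : ContDiffOn ℝ ∞ s W) (ht : ContDiffOn ℝ ∞ t W)
    (hv : ContDiffOn ℝ ∞ v W) (c a b : Fin 3 ⊕ Fin 3) :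
    ContDiffOn ℝ ∞ (fun y => bryantConn (r y) (p y) (q y) (s y) (t y) (v y) c a b) W := by
  rcases c with c | c <;> rcases a with a | a <;> rcases b with b | b
  · exact contDiffOn_bryantConnB hr hp hq hs ht hv c a b
  · exact contDiffOn_const
  · exact contDiffOn_const
  · exact (contDiffOn_bryantConnB hr hp hq hs ht hv c b a).neg
  · exact contDiffOn_const
  · exact contDiffOn_const
  · exact contDiffOn_bryantConnC hr hp hq hs ht hv c a b
  · exact contDiffOn_const

theorem contDiffOn_bryantCoframe (h₁ : ContDiffOn ℝ ∞ x₁ W) (h₂ : ContDiffOn ℝ ∞ x₂ W)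
    (hf : ContDiffOn ℝ ∞ f W) (hu : ContDiffOn ℝ ∞ u W) (hp : ContDiffOn ℝ ∞ p W)
    (hq : ContDiffOn ℝ ∞ q W) (a : Fin 3 ⊕ Fin 3) (i : Fin 6) :
    ContDiffOn ℝ ∞ (fun y => bryantCoframe (x₁ y) (x₂ y) (f y) (u y) (p y) (q y) a i) W := by
  rcases a with a | a <;> fin_cases a <;> fin_cases i <;> simp [bryantCoframe] <;> fun_prop

theorem contDiffOn_bryantFrame (h₁ : ContDiffOn ℝ ∞ x₁ W) (h₂ : ContDiffOn ℝ ∞ x₂ W)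
    (hf : ContDiffOn ℝ ∞ f W) (hr : ContDiffOn ℝ ∞ r W) (hp : ContDiffOn ℝ ∞ p W)
    (hq : ContDiffOn ℝ ∞ q W) (i : Fin 6) (a : Fin 3 ⊕ Fin 3) :
    ContDiffOn ℝ ∞ (fun y => bryantFrame (x₁ y) (x₂ y) (f y) (r y) (p y) (q y) i a) W := by
  rcases a with a | a <;> fin_cases a <;> fin_cases i <;> simp [bryantFrame] <;> fun_prop

end Smooth

/-- The coframe of Bryant's metric defined by `f(x¹, x³)`. -/
noncomputable def bryantE (f : ℝ × ℝ → ℝ) (x : Fin 6 → ℝ) : Matrix (Fin 3 ⊕ Fin 3) (Fin 6) ℝ :=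
  bryantCoframe (x 0) (x 1) (pull13 f x) (pull13 (d3 f) x) (pull13 (d1 (d3 f)) x)
    (pull13 (d3 (d3 f)) x)

/-- The frame dual to `bryantE`. -/
noncomputable def bryantV (f : ℝ × ℝ → ℝ) (x : Fin 6 → ℝ) : Matrix (Fin 6) (Fin 3 ⊕ Fin 3) ℝ :=
  bryantFrame (x 0) (x 1) (pull13 f x) (pull13 (d3 f)⁻¹ x) (pull13 (d1 (d3 f)) x)
    (pull13 (d3 (d3 f)) x)

/-- The Levi-Civita connection of Bryant's metric as a function of `x¹`, `x³`. -/
noncomputable def bryantΓ (f : ℝ × ℝ → ℝ) (y : ℝ × ℝ) (c : Fin 3 ⊕ Fin 3) :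
    Matrix (Fin 3 ⊕ Fin 3) (Fin 3 ⊕ Fin 3) ℝ :=
  bryantConn ((d3 f)⁻¹ y) (d1 (d3 f) y) (d3 (d3 f) y) (d1 (d1 (d3 f)) y) (d3 (d1 (d3 f)) y)
    (d3 (d3 (d3 f)) y) c

variable {U : Set (Fin 6 → ℝ)} {f : ℝ × ℝ → ℝ}

theorem diffAt_pull13 (hU : IsOpen U) {φ : ℝ × ℝ → ℝ} (hφ : ContDiffOn ℝ ∞ φ (proj13 '' U))
    {x : Fin 6 → ℝ} (hx : x ∈ U) : DifferentiableAt ℝ φ (proj13 x) :=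
  (hφ.contDiffAt ((isOpen_image_proj13 hU).mem_nhds ⟨x, hx, rfl⟩)).differentiableAt (by simp)

theorem pd_pull13_eq_grad13 (hU : IsOpen U) {φ : ℝ × ℝ → ℝ} (hφ : ContDiffOn ℝ ∞ φ (proj13 '' U))
    {x : Fin 6 → ℝ} (hx : x ∈ U) (i : Fin 6) :
    pd i (pull13 φ) x = grad13 (d1 φ (proj13 x)) (d3 φ (proj13 x)) i :=
  pd_pull13 (diffAt_pull13 hU hφ hx) i

theorem d3_ne_zero (hU : IsOpen U) (hf : ContDiffOn ℝ ∞ f (proj13 '' U))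
    (hf3 : ∀ x ∈ U, pd 2 (pull13 f) x ≠ 0) : ∀ y ∈ proj13 '' U, d3 f y ≠ 0 := by
  rintro _ ⟨x, hx, rfl⟩
  have h := hf3 x hx
  rwa [pd_pull13_eq_grad13 hU hf hx] at h

theorem isNullFrame_bryant (hU : IsOpen U) (hf : ContDiffOn ℝ ∞ f (proj13 '' U))
    (hf3 : ∀ y ∈ proj13 '' U, d3 f y ≠ 0) :
    IsNullFrame U {0, 2} (bryantE f) (bryantV f) (fun x => bryantΓ f (proj13 x)) := by
  have hW := isOpen_image_proj13 hU
  have hu := contDiffOn_d3 hW hf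
  have hp := contDiffOn_d1 hW hu
  have hq := contDiffOn_d3 hW hu
  have hr : ContDiffOn ℝ ∞ (d3 f)⁻¹ (proj13 '' U) := hu.inv hf3
  have hx : ∀ i : Fin 6, ContDiffOn ℝ ∞ (fun x : Fin 6 → ℝ => x i) U := fun i =>
    (contDiff_apply ℝ ℝ i).contDiffOn
  have hur : ∀ x ∈ U, pull13 (d3 f) x * pull13 (d3 f)⁻¹ x = 1 := fun x hx =>
    mul_inv_cancel₀ (hf3 _ ⟨x, hx, rfl⟩)
  refine
    { isOpen := hU
      smooth_coframe := contDiffOn_bryantCoframe (hx 0) (hx 1) (isBasic_pull13 hU hf).smooth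
        (isBasic_pull13 hU hu).smooth (isBasic_pull13 hU hp).smooth (isBasic_pull13 hU hq).smooth
      smooth_frame := contDiffOn_bryantFrame (hx 0) (hx 1) (isBasic_pull13 hU hf).smooth
        (isBasic_pull13 hU hr).smooth (isBasic_pull13 hU hp).smooth (isBasic_pull13 hU hq).smooth
      frame_mul_coframe := fun x hx => bryantFrame_mul_coframe (hur x hx)
      coframe_mul_frame := fun x hx => bryantCoframe_mul_frame (hur x hx)
      torsionFree := fun x hx a i j => ?_
      skew := fun x _ c => bryantConn_skew _ _ _ _ _ _ c
      parallel := fun x _ c a b => by rcases c with c | c <;> rfl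
      flat := fun x _ c a b => rfl
      basic_conn := fun c a b => isBasic_pull13 hU (contDiffOn_bryantConn hr hp hq
        (contDiffOn_d1 hW hp) (contDiffOn_d3 hW hp) (contDiffOn_d3 hW hq) c a b)
      basic_frame := ?_
      frame_inr := ?_ }
  · have hd := fun i j => pd_bryantCoframe (i := i) (j := j) (a := a)
      ((isBasic_pull13 hU hf).diffAt hU hx) ((isBasic_pull13 hU hu).diffAt hU hx)
      ((isBasic_pull13 hU hp).diffAt hU hx) ((isBasic_pull13 hU hq).diffAt hU hx)
    have ht := bryantCoframe_torsionFree (x₁ := x 0) (x₂ := x 1) (f := f (proj13 x))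
      (f₁ := d1 f (proj13 x)) (p := d1 (d3 f) (proj13 x)) (q := d3 (d3 f) (proj13 x))
      (s := d1 (d1 (d3 f)) (proj13 x)) (t := d3 (d1 (d3 f)) (proj13 x))
      (v := d3 (d3 (d3 f)) (proj13 x)) (hur x hx) a i j
    -- The derivatives of f₁₃ and f₃₃ share the third derivative f₁₃₃; its two expressions must be
    -- identified before the structure equations apply.
    have h13 : d1 (d3 (d3 f)) (proj13 x) = d3 (d1 (d3 f)) (proj13 x) :=
      d1_d3_comm hW hu ⟨x, hx, rfl⟩
    simp only [pd_pull13_eq_grad13 hU hf hx, pd_pull13_eq_grad13 hU hu hx,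
      pd_pull13_eq_grad13 hU hp hx, pd_pull13_eq_grad13 hU hq hx, h13] at hd
    exact (congrArg₂ _ (hd i j) (hd j i)).trans ht
  -- dx¹ is a multiple of θ⁴, and dx³ a combination of θ² and θ⁶. So the frame vectors dual to θ⁵,
  -- θ¹, θ³ have no components along x¹ and x³, and those of the other vectors are functions of (x¹,
  -- x³).
  · rintro k (rfl | rfl) c
    · fin_cases c
      · exact isBasic_const 0
      · exact isBasic_pull13 hU (contDiffOn_const.mul (hr.pow 2))
      · exact isBasic_const 0
    · fin_cases c
      · exact isBasic_pull13 hU ((contDiffOn_const.mul (hr.pow 2)).mul hp).neg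
      · exact isBasic_const 0
      · exact isBasic_pull13 hU (contDiffOn_const.mul (hr.pow 2))
  · rintro x - k (rfl | rfl) c <;> fin_cases c <;> rfl

end BryantNullFrame

/-! ### Ricci tensor of a null frame. -/

section NullRicci

variable {n : ℕ} {α : Type*} [Fintype α] [DecidableEq α] {U : Set (Fin n → ℝ)} {J : Set (Fin n)}
  {e : (Fin n → ℝ) → Matrix (α ⊕ α) (Fin n) ℝ} {E : (Fin n → ℝ) → Matrix (Fin n) (α ⊕ α) ℝ}
  {γ : (Fin n → ℝ) → α ⊕ α → Matrix (α ⊕ α) (α ⊕ α) ℝ} {x : Fin n → ℝ}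

/-- The possibly non-zero components of the Ricci tensor in a null frame. -/
noncomputable def nullRicci (E : (Fin n → ℝ) → Matrix (Fin n) (α ⊕ α) ℝ)
    (γ : (Fin n → ℝ) → α ⊕ α → Matrix (α ⊕ α) (α ⊕ α) ℝ) (x : Fin n → ℝ) : Matrix α α ℝ :=
  Matrix.of fun b d =>
    ∑ a, frameDeriv E (.inl a) (fun y => γ y (.inl d) (.inl a) (.inl b)) x
      - frameDeriv E (.inl d) (fun y => ∑ a, γ y a a (.inl b)) x
      + ∑ c, (∑ a, γ x a a (.inl c)) * γ x (.inl d) (.inl c) (.inl b)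
      - ∑ a, ∑ c, (γ x (.inl a) (.inl c) (.inl d) * γ x (.inl c) (.inl a) (.inl b)
        + γ x (.inr a) (.inr c) (.inl d) * γ x (.inr c) (.inr a) (.inl b))

theorem IsNullFrame.flat_inr (N : IsNullFrame U J e E γ) (hx : x ∈ U) (c a b : α) :
    γ x (.inr c) (.inr a) (.inr b) = 0 := by
  have hs := congrFun (congrFun (N.skew x hx (.inr c)) (.inl a)) (.inr b)
  simpa [splitForm, Matrix.mul_apply, Fintype.sum_sum_type, Matrix.one_apply,
    N.flat x hx] using hs

/-- If either argument is a null vector, every term contains an entry killed by `parallel`, by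
`flat` or its skew counterpart, a trace over a null index, or the derivative of a basic function
along a null vector. -/
theorem IsNullFrame.frameRicci_eq (N : IsNullFrame U J e E γ) (hx : x ∈ U) :
    frameRicci E γ x = Matrix.fromBlocks (nullRicci E γ x) 0 0 0 := by
  have hf := N.flat x hx
  have hp := N.parallel x hx
  have hf' := N.flat_inr hx
  have hz : ∀ c d a b, frameDeriv E c (fun y => γ y d (.inl a) (.inr b)) x = 0 := fun c d a b => by
    rw [frameDeriv_congr N.isOpen (fun y hy => N.parallel y hy d a b) hx, frameDeriv_const]
  have hz' : ∀ c d a b, frameDeriv E c (fun y => γ y (.inr d) (.inl a) (.inl b)) x = 0 :=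
    fun c d a b => by
      rw [frameDeriv_congr N.isOpen (fun y hy => N.flat y hy d a b) hx, frameDeriv_const]
  have hz'' : ∀ c b, frameDeriv E c (fun y => ∑ a, γ y a a (.inr b)) x = 0 := fun c b => by
    rw [frameDeriv_congr N.isOpen (fun y hy => N.trace_inr hy b) hx, frameDeriv_const]
  have hz3 : ∀ d b, frameDeriv E (.inr d) (fun y => ∑ a, γ y a a b) x = 0 := fun d b =>
    (N.basic_trace b).frameDeriv_inr hx fun k hk => N.frame_inr x hx k hk d
  have hs : ∀ b d, ∑ a, ∑ c, γ x a c d * γ x c a b = ∑ a, ∑ c,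
      (γ x (.inl a) (.inl c) d * γ x (.inl c) (.inl a) b
        + γ x (.inl a) (.inr c) d * γ x (.inr c) (.inl a) b
        + γ x (.inr a) (.inl c) d * γ x (.inl c) (.inr a) b
        + γ x (.inr a) (.inr c) d * γ x (.inr c) (.inr a) b) := fun b d => by
    simp only [Fintype.sum_sum_type, Finset.sum_add_distrib]
    ring
  ext (b | b) (d | d) <;> rw [frameRicci_isNullFrame N hx, hs] <;>
  simp only [hf, hp, hf', hz, hz', hz'', hz3, mul_zero, zero_mul, Finset.sum_const_zero, add_zero,
    sub_zero] <;>
  rfl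

end NullRicci

/-! ### Ricci tensor of Bryant's metric. -/

section BryantRicci

variable {U : Set (Fin 6 → ℝ)} {f : ℝ × ℝ → ℝ} {x : Fin 6 → ℝ}

theorem frameDeriv_bryantV (hU : IsOpen U) {φ : ℝ × ℝ → ℝ} (hφ : ContDiffOn ℝ ∞ φ (proj13 '' U))
    (hx : x ∈ U) (a : Fin 3) :
    frameDeriv (bryantV f) (.inl a) (fun y => φ (proj13 y)) x =
      ![-(1 / 3 * (d3 f)⁻¹ (proj13 x) ^ 2 * d1 (d3 f) (proj13 x) * d3 φ (proj13 x)),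
        2 / 3 * (d3 f)⁻¹ (proj13 x) ^ 2 * d1 φ (proj13 x),
        2 / 3 * (d3 f)⁻¹ (proj13 x) ^ 2 * d3 φ (proj13 x)] a := by
  have h : ∀ i, pd i (fun y => φ (proj13 y)) x =
      grad13 (d1 φ (proj13 x)) (d3 φ (proj13 x)) i := pd_pull13_eq_grad13 hU hφ hx
  unfold frameDeriv
  simp only [Fin.sum_univ_six]
  rw [h 0, h 1, h 2, h 3, h 4, h 5]
  fin_cases a <;> simp [grad13, bryantV, bryantFrame, pull13]

/-- The components of the Ricci tensor of Bryant's metric with respect to `θ²`, `θ⁴`, `θ⁶`. -/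
noncomputable def bryantRicci (r p q s t v : ℝ) : Matrix (Fin 3) (Fin 3) ℝ :=
  !![-4 / 27 * s * q ^ 2 * r ^ 5 + 1 / 9 * s * v * r ^ 4 + 20 / 27 * p ^ 2 * q ^ 2 * r ^ 6
        - 5 / 27 * p ^ 2 * v * r ^ 5 - 1 / 9 * t ^ 2 * r ^ 4,
      8 / 27 * s * q * r ^ 5 + 10 / 27 * p * t * r ^ 5 - 40 / 27 * p ^ 2 * q * r ^ 6,
      -40 / 27 * p * q ^ 2 * r ^ 6 + 10 / 27 * p * v * r ^ 5 + 8 / 27 * t * q * r ^ 5;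
    8 / 27 * s * q * r ^ 5 + 10 / 27 * p * t * r ^ 5 - 40 / 27 * p ^ 2 * q * r ^ 6,
      -4 / 3 * s * r ^ 5 + 80 / 27 * p ^ 2 * r ^ 6, 80 / 27 * p * q * r ^ 6 - 4 / 3 * t * r ^ 5;
    -40 / 27 * p * q ^ 2 * r ^ 6 + 10 / 27 * p * v * r ^ 5 + 8 / 27 * t * q * r ^ 5,
      80 / 27 * p * q * r ^ 6 - 4 / 3 * t * r ^ 5, 80 / 27 * q ^ 2 * r ^ 6 - 4 / 3 * v * r ^ 5]

/-- The divergences of the frame vectors dual to `θ²`, `θ⁴`, `θ⁶`. -/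
noncomputable def bryantTrace (r p q t : ℝ) : Fin 3 → ℝ :=
  ![-(p * q * r ^ 3) - 1 / 3 * t * r ^ 2, 2 * p * r ^ 3, 2 * q * r ^ 3]

theorem bryantConn_trace (r p q s t v : ℝ) (b : Fin 3) :
    ∑ c, bryantConn r p q s t v c c (.inl b) = bryantTrace r p q t b := by
  fin_cases b <;>
  simp [Fintype.sum_sum_type, Fin.sum_univ_three, bryantConn, bryantConnB, bryantConnC, skewMat,
    bryantTrace] <;>
  ring

theorem fderiv_inv_d3 {y : ℝ × ℝ} (hd : DifferentiableAt ℝ (d3 f) y) (h : d3 f y ≠ 0)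
    (w : ℝ × ℝ) : fderiv ℝ (d3 f)⁻¹ y w = -(d3 f)⁻¹ y ^ 2 * fderiv ℝ (d3 f) y w := by
  have := ((hasDerivAt_inv h).comp_hasFDerivAt y hd.hasFDerivAt).fderiv
  refine (congrArg (fun l => l w) this).trans ?_
  simp [inv_pow]

end BryantRicci

section BryantRicci

/-- The part of the Ricci tensor without derivatives of the connection. It is not symmetric by
itself; symmetry returns only once the derivative terms are added. -/
theorem bryantConn_quadratic (r p q s t v : ℝ) (b d : Fin 3) :
    ∑ c, bryantTrace r p q t c * bryantConnB r p q s t v d c b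
      - ∑ a, ∑ c, (bryantConnB r p q s t v a c d * bryantConnB r p q s t v c a b
        + bryantConnC r p q s t v a c d * bryantConnC r p q s t v c a b) =
    !![7 / 27 * p * q * t * r ^ 5 - 7 / 27 * p ^ 2 * q ^ 2 * r ^ 6 + 2 / 9 * p ^ 2 * v * r ^ 5
          - 1 / 9 * t ^ 2 * r ^ 4,
        -7 / 27 * p * t * r ^ 5 + 14 / 27 * p ^ 2 * q * r ^ 6 - 14 / 27 * q * s * r ^ 5,
        14 / 27 * p * q ^ 2 * r ^ 6 - 10 / 27 * p * v * r ^ 5 - 4 / 9 * q * t * r ^ 5;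
      -1 / 3 * p * t * r ^ 5 + 14 / 27 * p ^ 2 * q * r ^ 6 + 4 / 27 * q * s * r ^ 5,
        -28 / 27 * p ^ 2 * r ^ 6, -28 / 27 * p * q * r ^ 6 + 2 / 27 * t * r ^ 5;
      14 / 27 * p * q ^ 2 * r ^ 6 - 10 / 27 * p * v * r ^ 5 + 2 / 9 * q * t * r ^ 5,
        -28 / 27 * p * q * r ^ 6 - 2 / 27 * t * r ^ 5, -28 / 27 * q ^ 2 * r ^ 6] b d := by
  fin_cases b <;> fin_cases d <;>
  simp [bryantTrace, bryantConnB, bryantConnC, skewMat, Fin.sum_univ_three] <;>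
  ring

variable {r p q s t v : ℝ × ℝ → ℝ} {y : ℝ × ℝ}

/-- The derivatives in the directions dual to `θ²`, `θ⁴`, `θ⁶`, where `r = 1 / f₃`, `p = f₁₃`. -/
noncomputable def bryantD (r p : ℝ) (a : Fin 3) (φ : ℝ × ℝ → ℝ) (y : ℝ × ℝ) : ℝ :=
  ![-(1 / 3 * r ^ 2 * p * d3 φ y), 2 / 3 * r ^ 2 * d1 φ y, 2 / 3 * r ^ 2 * d3 φ y] a

-- The first-order relations express that r = 1/f₃ and that p, q, s, t, v are successive derivatives
-- of f₃. The last two are equalities of mixed fourth derivatives of f, by which all fourth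
-- derivatives cancel.
set_option maxHeartbeats 1000000 in
theorem bryantConn_linear
    (hr : DifferentiableAt ℝ r y) (hp : DifferentiableAt ℝ p y) (hq : DifferentiableAt ℝ q y)
    (hs : DifferentiableAt ℝ s y) (ht : DifferentiableAt ℝ t y) (hv : DifferentiableAt ℝ v y)
    (hr1 : fderiv ℝ r y (1, 0) = -r y ^ 2 * p y) (hr3 : fderiv ℝ r y (0, 1) = -r y ^ 2 * q y)
    (hp1 : fderiv ℝ p y (1, 0) = s y) (hp3 : fderiv ℝ p y (0, 1) = t y)
    (hq1 : fderiv ℝ q y (1, 0) = t y) (hq3 : fderiv ℝ q y (0, 1) = v y)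
    (hs3 : fderiv ℝ s y (0, 1) = fderiv ℝ t y (1, 0))
    (ht3 : fderiv ℝ t y (0, 1) = fderiv ℝ v y (1, 0)) (b d : Fin 3) :
    ∑ a, bryantD (r y) (p y) a
        (fun y => bryantConnB (r y) (p y) (q y) (s y) (t y) (v y) d a b) y
      - bryantD (r y) (p y) d (fun y => bryantTrace (r y) (p y) (q y) (t y) b) y
      + ∑ c, bryantTrace (r y) (p y) (q y) (t y) c
          * bryantConnB (r y) (p y) (q y) (s y) (t y) (v y) d c b
      - ∑ a, ∑ c, (bryantConnB (r y) (p y) (q y) (s y) (t y) (v y) a c d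
            * bryantConnB (r y) (p y) (q y) (s y) (t y) (v y) c a b
          + bryantConnC (r y) (p y) (q y) (s y) (t y) (v y) a c d
            * bryantConnC (r y) (p y) (q y) (s y) (t y) (v y) c a b) =
      bryantRicci (r y) (p y) (q y) (s y) (t y) (v y) b d := by
  rw [add_sub_assoc, bryantConn_quadratic, Fin.sum_univ_three]
  fin_cases d <;> fin_cases b <;>
  simp [bryantConnB, bryantTrace, bryantD, d1, d3, bryantRicci] <;>
  simp (disch := fun_prop) only [fderiv_fun_add, fderiv_fun_sub, fderiv_fun_mul, fderiv_fun_neg,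
    fderiv_fun_pow, fderiv_fun_const, Pi.zero_apply, add_apply, zero_apply,
    sub_apply, smul_apply, neg_apply, smul_eq_mul, hr1, hr3, hp1, hp3, hq1, hq3, hs3, ht3] <;>
  ring

end BryantRicci

/-! ### Schouten tensor of Bryant's metric. -/

section BryantSchouten

variable {U : Set (Fin 6 → ℝ)} {f : ℝ × ℝ → ℝ} {x : Fin 6 → ℝ}

/-- The components of the Ricci tensor of Bryant's metric as functions of `x¹`, `x³`. -/
noncomputable def bryantRic (f : ℝ × ℝ → ℝ) (y : ℝ × ℝ) : Matrix (Fin 3) (Fin 3) ℝ :=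
  bryantRicci ((d3 f)⁻¹ y) (d1 (d3 f) y) (d3 (d3 f) y) (d1 (d1 (d3 f)) y) (d3 (d1 (d3 f)) y)
    (d3 (d3 (d3 f)) y)

theorem contDiffOn_bryantRicci {W : Set (ℝ × ℝ)} {r p q s t v : ℝ × ℝ → ℝ}
    (hr : ContDiffOn ℝ ∞ r W) (hp : ContDiffOn ℝ ∞ p W) (hq : ContDiffOn ℝ ∞ q W)
    (hs : ContDiffOn ℝ ∞ s W) (ht : ContDiffOn ℝ ∞ t W) (hv : ContDiffOn ℝ ∞ v W) (a b : Fin 3) :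
    ContDiffOn ℝ ∞ (fun y => bryantRicci (r y) (p y) (q y) (s y) (t y) (v y) a b) W := by
  fin_cases a <;> fin_cases b <;> simp [bryantRicci] <;> fun_prop

theorem nullRicci_bryant (hU : IsOpen U) (hf : ContDiffOn ℝ ∞ f (proj13 '' U))
    (hf3 : ∀ y ∈ proj13 '' U, d3 f y ≠ 0) (hx : x ∈ U) :
    nullRicci (bryantV f) (fun x => bryantΓ f (proj13 x)) x = bryantRic f (proj13 x) := by
  have hW := isOpen_image_proj13 hU
  have hy : proj13 x ∈ proj13 '' U := ⟨x, hx, rfl⟩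
  have hu := contDiffOn_d3 hW hf
  have hr : ContDiffOn ℝ ∞ (d3 f)⁻¹ (proj13 '' U) := hu.inv hf3
  have hp := contDiffOn_d1 hW hu
  have hq := contDiffOn_d3 hW hu
  have hs := contDiffOn_d1 hW hp
  have ht := contDiffOn_d3 hW hp
  have hv := contDiffOn_d3 hW hq
  have hqt : Set.EqOn (d1 (d3 (d3 f))) (d3 (d1 (d3 f))) (proj13 '' U) := fun y hy =>
    d1_d3_comm hW hu hy
  -- Both sides are f₁₃₃₃; the equality of f₃₃₁ and f₁₃₃ holds on an open set, so it may be
  -- differentiated.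
  have ht3 : d3 (d3 (d1 (d3 f))) (proj13 x) = d1 (d3 (d3 (d3 f))) (proj13 x) := by
    rw [d1_d3_comm hW hq hy]
    exact congrArg (fun l : ℝ × ℝ →L[ℝ] ℝ => l (0, 1)) (hqt.eventuallyEq_of_mem (hW.mem_nhds hy)).fderiv_eq.symm
  have key := fun b d => bryantConn_linear (diffAt_pull13 hU hr hx) (diffAt_pull13 hU hp hx)
    (diffAt_pull13 hU hq hx) (diffAt_pull13 hU hs hx) (diffAt_pull13 hU ht hx)
    (diffAt_pull13 hU hv hx) (fderiv_inv_d3 (diffAt_pull13 hU hu hx) (hf3 _ hy) _)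
    (fderiv_inv_d3 (diffAt_pull13 hU hu hx) (hf3 _ hy) _) rfl rfl (hqt hy) rfl
    (d1_d3_comm hW hp hy).symm ht3 b d
  ext b d
  refine Eq.trans ?_ (key b d)
  simp only [nullRicci, Matrix.of_apply]
  congr 1
  congr 1
  · congr 1
    · refine Finset.sum_congr rfl fun a _ => ?_
      exact frameDeriv_bryantV hU (φ := fun y => bryantΓ f y (.inl d) (.inl a) (.inl b))
        (contDiffOn_bryantConn hr hp hq hs ht hv _ _ _) hx a
    · have hτ : ContDiffOn ℝ ∞ (fun y => bryantTrace ((d3 f)⁻¹ y) (d1 (d3 f) y) (d3 (d3 f) y)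
          (d3 (d1 (d3 f)) y) b) (proj13 '' U) := by
        refine ContDiffOn.congr (f := fun y => ∑ c, bryantΓ f y c c (.inl b)) (ContDiffOn.sum
          fun c _ => contDiffOn_bryantConn hr hp hq hs ht hv _ _ _) fun y _ => ?_
        exact (bryantConn_trace _ _ _ _ _ _ b).symm
      simp only [bryantΓ, bryantConn_trace]
      exact frameDeriv_bryantV hU hτ hx d
  · refine Finset.sum_congr rfl fun c _ => ?_
    simp only [bryantΓ, bryantConn_trace]
    rfl

/-- For a function of (x¹, x³), the terms of `theta6` beyond dx³ and θ² all contain a derivative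
with respect to x² and vanish. -/
theorem bryantE_rows (hU : IsOpen U) (hf : ContDiffOn ℝ ∞ f (proj13 '' U)) (hx : x ∈ U) :
    (bryantE f x (.inl 0) = theta2 (pull13 f) x ∧ bryantE f x (.inl 1) = theta4 (pull13 f) x ∧
      bryantE f x (.inl 2) = theta6 (pull13 f) x) ∧
    bryantE f x (.inr 0) = theta5 (pull13 f) x ∧ bryantE f x (.inr 1) = theta1 x ∧
      bryantE f x (.inr 2) = theta3 x := by
  have hu := contDiffOn_d3 (isOpen_image_proj13 hU) hf
  have h := fun x hx i => pd_pull13_eq_grad13 (x := x) hU hf hx i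
  have h2 : ∀ i, pd i (pd 2 (pull13 f)) x =
      grad13 (d1 (d3 f) (proj13 x)) (d3 (d3 f) (proj13 x)) i := fun i =>
    (pd_congr hU (fun y hy => h y hy 2) hx i).trans (pd_pull13_eq_grad13 hU hu hx i)
  have h1 : pd 0 (pd 1 (pull13 f)) x = 0 := by
    rw [pd_congr hU (fun y hy => h y hy 1) hx]
    exact pd_const 0 0 x
  refine ⟨⟨?_, ?_, ?_⟩, ?_, ?_, ?_⟩ <;>
  ext j <;> fin_cases j <;>
  simp [bryantE, bryantCoframe, theta1, theta2, theta3, theta4, theta5, theta6, dc, h x hx, h2, h1,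
    grad13, pull13]

theorem transpose_mul_splitForm_mul_apply {α ι : Type*} [Fintype α] [DecidableEq α] [Fintype ι]
    (e : Matrix (α ⊕ α) ι ℝ) (i j : ι) : (e.transpose * splitForm α * e) i j =
      ∑ a, (e (.inl a) i * e (.inr a) j + e (.inr a) i * e (.inl a) j) := by
  simp [splitForm, Matrix.mul_apply, Fintype.sum_sum_type, Matrix.one_apply, Finset.sum_add_distrib]
  ring

theorem transpose_mul_fromBlocks_mul_apply {α ι : Type*} [Fintype α] [Fintype ι]
    (e : Matrix (α ⊕ α) ι ℝ) (q : Matrix α α ℝ) (i j : ι) :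
    (e.transpose * (Matrix.fromBlocks q 0 0 0 : Matrix (α ⊕ α) (α ⊕ α) ℝ) * e) i j =
      ∑ a, ∑ b, q a b * (e (.inl a) i * e (.inl b) j) := by
  simp only [Matrix.mul_apply, Fintype.sum_sum_type, Matrix.transpose_apply,
    Matrix.fromBlocks_apply₁₁, Matrix.fromBlocks_apply₁₂, Matrix.fromBlocks_apply₂₁,
    Matrix.fromBlocks_apply₂₂, Matrix.zero_apply, mul_zero, zero_mul, Finset.sum_const_zero,
    add_zero, Finset.sum_mul]
  rw [Finset.sum_comm]
  exact Finset.sum_congr rfl fun a _ => Finset.sum_congr rfl fun b _ => by ring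

theorem bryantMetric_eq (hU : IsOpen U) (hf : ContDiffOn ℝ ∞ f (proj13 '' U)) (hx : x ∈ U) :
    bryantMetric (pull13 f) x = (bryantE f x).transpose * splitForm (Fin 3) * bryantE f x := by
  obtain ⟨⟨h2, h4, h6⟩, h5, h1, h3⟩ := bryantE_rows hU hf hx
  ext i j
  rw [transpose_mul_splitForm_mul_apply, Fin.sum_univ_three, h1, h2, h3, h4, h5, h6]
  simp [bryantMetric, twoSym, Matrix.vecMulVec_apply]
  ring

theorem tensor246_eq (hU : IsOpen U) (hf : ContDiffOn ℝ ∞ f (proj13 '' U)) (hx : x ∈ U)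
    (q : Matrix (Fin 3) (Fin 3) ℝ) : tensor246 (pull13 f) q x =
      (bryantE f x).transpose * (Matrix.fromBlocks q 0 0 0 : Matrix (Fin 3 ⊕ Fin 3) (Fin 3 ⊕ Fin 3) ℝ)
        * bryantE f x := by
  obtain ⟨⟨h2, h4, h6⟩, -⟩ := bryantE_rows hU hf hx
  have h : ∀ a, bryantE f x (.inl a) = theta246 (pull13 f) x a := fun a => by
    fin_cases a <;> assumption
  ext i j
  rw [transpose_mul_fromBlocks_mul_apply]
  simp [tensor246, Matrix.sum_apply, Matrix.vecMulVec_apply, h]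

/-- Raising an index moves the only block off the diagonal, so the endomorphism g⁻¹Ric has trace
zero. -/
theorem scalar_eq_zero_of_nilpotent {α ι : Type*} [Fintype α] [DecidableEq α] [Fintype ι]
    [DecidableEq ι] {e : Matrix (α ⊕ α) ι ℝ} {E : Matrix ι (α ⊕ α) ℝ} (hEe : E * e = 1)
    (heE : e * E = 1) (R : Matrix α α ℝ) :
    ∑ i, ∑ j, (e.transpose * splitForm α * e)⁻¹ i j *
      (e.transpose * (Matrix.fromBlocks R 0 0 0 : Matrix (α ⊕ α) (α ⊕ α) ℝ) * e) i j = 0 := by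
  have hs : splitForm α * splitForm α = 1 := by simp [splitForm, Matrix.fromBlocks_multiply]
  have hinv : (e.transpose * splitForm α * e)⁻¹ = E * splitForm α * E.transpose := by
    refine Matrix.inv_eq_left_inv ?_
    calc E * splitForm α * E.transpose * (e.transpose * splitForm α * e)
        = E * (splitForm α * ((e * E).transpose * splitForm α)) * e := by
          simp only [Matrix.transpose_mul, Matrix.mul_assoc]
      _ = 1 := by rw [heE, Matrix.transpose_one, Matrix.one_mul, hs, Matrix.mul_one, hEe]
  have htr : ∀ A B : Matrix ι ι ℝ, ∑ i, ∑ j, A i j * B i j = (A.transpose * B).trace := by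
    intro A B
    simp only [Matrix.trace, Matrix.diag, Matrix.mul_apply, Matrix.transpose_apply]
    exact Finset.sum_comm
  rw [htr, hinv]
  have h : (E * splitForm α * E.transpose).transpose *
      (e.transpose * (Matrix.fromBlocks R 0 0 0 : Matrix (α ⊕ α) (α ⊕ α) ℝ) * e) =
      E * (splitForm α * (Matrix.fromBlocks R 0 0 0 : Matrix (α ⊕ α) (α ⊕ α) ℝ) * e) := by
    calc _ = E * ((splitForm α).transpose * ((e * E).transpose * ((Matrix.fromBlocks R 0 0 0 : Matrix (α ⊕ α) (α ⊕ α) ℝ) * e))) := by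
          simp only [Matrix.transpose_mul, Matrix.mul_assoc, Matrix.transpose_transpose]
      _ = _ := by
          rw [heE, Matrix.transpose_one, Matrix.one_mul, splitForm_transpose, Matrix.mul_assoc]
  rw [h, Matrix.trace_mul_comm, Matrix.mul_assoc, heE, Matrix.mul_one]
  simp [splitForm, Matrix.fromBlocks_multiply, Matrix.trace, Fintype.sum_sum_type]

theorem ricci_bryantMetric (hU : IsOpen U) (hf : ContDiffOn ℝ ∞ f (proj13 '' U))
    (hf3 : ∀ y ∈ proj13 '' U, d3 f y ≠ 0) (hx : x ∈ U) :
    ricci (bryantMetric (pull13 f)) x =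
      (bryantE f x).transpose * (Matrix.fromBlocks (bryantRic f (proj13 x)) 0 0 0
        : Matrix (Fin 3 ⊕ Fin 3) (Fin 3 ⊕ Fin 3) ℝ) * bryantE f x := by
  have N := isNullFrame_bryant hU hf hf3
  rw [(N.isLeviCivitaFrame (finSumFinEquiv (m := 3) (n := 3)).symm fun x hx => bryantMetric_eq hU hf hx).ricci_eq hx,
    N.frameRicci_eq hx, nullRicci_bryant hU hf hf3 hx]

/-- The coefficients of the Schouten tensor of Bryant's metric with respect to `θ²`, `θ⁴`, `θ⁶`. -/
noncomputable def bryantP (f : ℝ × ℝ → ℝ) (y : ℝ × ℝ) : Matrix (Fin 3) (Fin 3) ℝ :=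
  (1 / 4 : ℝ) • bryantRic f y

/-- With vanishing scalar curvature, the Schouten tensor in dimension 6 is Ric/4. -/
theorem schouten_bryantMetric (hU : IsOpen U) (hf : ContDiffOn ℝ ∞ f (proj13 '' U))
    (hf3 : ∀ y ∈ proj13 '' U, d3 f y ≠ 0) (hx : x ∈ U) :
    schouten (bryantMetric (pull13 f)) x =
      (bryantE f x).transpose * (Matrix.fromBlocks (bryantP f (proj13 x)) 0 0 0
        : Matrix (Fin 3 ⊕ Fin 3) (Fin 3 ⊕ Fin 3) ℝ) * bryantE f x := by
  have N := isNullFrame_bryant hU hf hf3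
  have hs : scalarCurvature (bryantMetric (pull13 f)) x = 0 := by
    rw [scalarCurvature, ricci_bryantMetric hU hf hf3 hx, bryantMetric_eq hU hf hx]
    exact scalar_eq_zero_of_nilpotent (N.frame_mul_coframe x hx) (N.coframe_mul_frame x hx) _
  have hb : Matrix.fromBlocks (bryantP f (proj13 x)) 0 0 0 =
      (1 / 4 : ℝ) • (Matrix.fromBlocks (bryantRic f (proj13 x)) 0 0 0 :
        Matrix (Fin 3 ⊕ Fin 3) (Fin 3 ⊕ Fin 3) ℝ) := by
    rw [Matrix.fromBlocks_smul, smul_zero, bryantP]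
  rw [schouten, hs, ricci_bryantMetric hU hf hf3 hx, hb]
  simp only [zero_div, zero_smul, sub_zero, Matrix.mul_smul, Matrix.smul_mul, Fintype.card_fin]
  norm_num

theorem isSmoothCoeff_bryantP (hU : IsOpen U) (hf : ContDiffOn ℝ ∞ f (proj13 '' U))
    (hf3 : ∀ y ∈ proj13 '' U, d3 f y ≠ 0) : IsSmoothCoeff (proj13 '' U) (bryantP f) := by
  have hW := isOpen_image_proj13 hU
  have hu := contDiffOn_d3 hW hf
  have hr : ContDiffOn ℝ ∞ (d3 f)⁻¹ (proj13 '' U) := hu.inv hf3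
  have hp := contDiffOn_d1 hW hu
  have hq := contDiffOn_d3 hW hu
  have hs := contDiffOn_d1 hW hp
  have ht := contDiffOn_d3 hW hp
  have hv := contDiffOn_d3 hW hq
  refine ⟨fun y _ => ?_, fun a b => ?_⟩
  · ext a b
    fin_cases a <;> fin_cases b <;> rfl
  · exact contDiffOn_const.mul (contDiffOn_bryantRicci hr hp hq hs ht hv a b)

end BryantSchouten

/-! ### Functions of (x¹, x³, ϱ) on the ambient space. -/

section AmbientPullback

/-- The coordinates `((x¹, x³), ϱ)` on the ambient space. -/
def ambientProj (z : AmbientIndex 6 → ℝ) : (ℝ × ℝ) × ℝ := (proj13 (xCoord z), rhoCoord z)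

/-- The projection `ambientProj` as a continuous linear map. -/
noncomputable def ambientProjL : (AmbientIndex 6 → ℝ) →L[ℝ] (ℝ × ℝ) × ℝ :=
  ((ContinuousLinearMap.proj (.inr (.inl 0))).prod (ContinuousLinearMap.proj (.inr (.inl 2)))).prod
    (ContinuousLinearMap.proj (.inr (.inr ())))

variable {U : Set (Fin 6 → ℝ)} {ε : ℝ} {ψ : (ℝ × ℝ) × ℝ → ℝ} {z : AmbientIndex 6 → ℝ}

theorem ambientProj_mem (hz : z ∈ ambientSpace U ε) :
    ambientProj z ∈ (proj13 '' U) ×ˢ Set.Ioo (-ε) ε :=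
  ⟨⟨xCoord z, hz.2.1, rfl⟩, hz.2.2⟩

theorem isOpen_image_prod_Ioo (hU : IsOpen U) : IsOpen ((proj13 '' U) ×ˢ Set.Ioo (-ε) ε) :=
  (isOpen_image_proj13 hU).prod isOpen_Ioo

theorem differentiableAt_of_mem (hU : IsOpen U)
    (hψ : ContDiffOn ℝ ∞ ψ ((proj13 '' U) ×ˢ Set.Ioo (-ε) ε)) {q : (ℝ × ℝ) × ℝ}
    (hq : q ∈ (proj13 '' U) ×ˢ Set.Ioo (-ε) ε) : DifferentiableAt ℝ ψ q :=
  (hψ.contDiffAt ((isOpen_image_prod_Ioo hU).mem_nhds hq)).differentiableAt (by simp)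

theorem pd_ambientProj (hψ : DifferentiableAt ℝ ψ (ambientProj z)) (i : AmbientIndex 6) :
    pd i (fun z => ψ (ambientProj z)) z =
      fderiv ℝ ψ (ambientProj z) (ambientProjL (Pi.single i 1)) := by
  have h : fderiv ℝ (fun z => ψ (ambientProj z)) z = (fderiv ℝ ψ (ambientProj z)).comp ambientProjL :=
    (hψ.hasFDerivAt.comp z ambientProjL.hasFDerivAt).fderiv
  rw [pd, h, ContinuousLinearMap.comp_apply]

theorem isBasic_ambientProj (hU : IsOpen U)
    (hψ : ContDiffOn ℝ ∞ ψ ((proj13 '' U) ×ˢ Set.Ioo (-ε) ε)) :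
    IsBasic (ambientSpace U ε) (ambientActive {0, 2}) fun z => ψ (ambientProj z) := by
  refine ⟨hψ.comp ambientProjL.contDiff.contDiffOn fun z hz => ambientProj_mem hz,
    fun z hz i hi => ?_⟩
  rw [pd_ambientProj (differentiableAt_of_mem hU hψ (ambientProj_mem hz))]
  have h : ∀ j ∈ ambientActive {0, 2}, (Pi.single i 1 : AmbientIndex 6 → ℝ) j = 0 := fun j hj =>
    Pi.single_eq_of_ne (fun h : j = i => hi (by rwa [← h])) 1
  have : ambientProjL (Pi.single i 1) = 0 :=
    Prod.ext (Prod.ext (h (.inr (.inl 0)) (Or.inr ⟨0, by simp, rfl⟩))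
      (h (.inr (.inl 2)) (Or.inr ⟨2, by simp, rfl⟩))) (h _ (Or.inl rfl))
  rw [this, map_zero]

theorem deriv_eq_fderiv {p : ℝ × ℝ} {ρ : ℝ} (hψ : DifferentiableAt ℝ ψ (p, ρ)) :
    deriv (fun r => ψ (p, r)) ρ = fderiv ℝ ψ (p, ρ) (0, 1) :=
  (hψ.hasFDerivAt.comp_hasDerivAt ρ ((hasDerivAt_const ρ p).prodMk (hasDerivAt_id ρ))).deriv

theorem pd_rho_ambientProj (hψ : DifferentiableAt ℝ ψ (ambientProj z)) :
    pd (.inr (.inr ())) (fun z => ψ (ambientProj z)) z =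
      deriv (fun r => ψ (proj13 (xCoord z), r)) (rhoCoord z) := by
  rw [pd_ambientProj hψ, deriv_eq_fderiv hψ]
  congr 1

theorem contDiffOn_deriv_rho (hU : IsOpen U)
    (hψ : ContDiffOn ℝ ∞ ψ ((proj13 '' U) ×ˢ Set.Ioo (-ε) ε)) :
    ContDiffOn ℝ ∞ (fun q : (ℝ × ℝ) × ℝ => deriv (fun r => ψ (q.1, r)) q.2)
      ((proj13 '' U) ×ˢ Set.Ioo (-ε) ε) := by
  refine ContDiffOn.congr (f := fun q => fderiv ℝ ψ q (0, 1)) ?_ fun q hq =>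
    deriv_eq_fderiv (differentiableAt_of_mem hU hψ hq)
  exact (hψ.fderiv_of_isOpen (isOpen_image_prod_Ioo hU) (m := ∞) (by simp)).clm_apply
    contDiffOn_const

end AmbientPullback

/-! ### The ambient metrics and their Ricci-flatness. -/

section BryantAmbientMetric

variable {U : Set (Fin 6 → ℝ)} {f : ℝ × ℝ → ℝ} {ε : ℝ}
  {S : ℝ × ℝ → ℝ → Matrix (Fin 3) (Fin 3) ℝ} {z : AmbientIndex 6 → ℝ}

/-- The coefficients of `2 ϱ P + S`. -/
noncomputable def bryantH (f : ℝ × ℝ → ℝ) (S : ℝ × ℝ → ℝ → Matrix (Fin 3) (Fin 3) ℝ)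
    (z : AmbientIndex 6 → ℝ) : Matrix (Fin 3) (Fin 3) ℝ :=
  (2 * (ambientProj z).2) • bryantP f (ambientProj z).1 + S (ambientProj z).1 (ambientProj z).2

/-- The coefficients of the derivative of `2 ϱ P + S` with respect to `ϱ`. -/
noncomputable def bryantK (f : ℝ × ℝ → ℝ) (S : ℝ × ℝ → ℝ → Matrix (Fin 3) (Fin 3) ℝ)
    (z : AmbientIndex 6 → ℝ) : Matrix (Fin 3) (Fin 3) ℝ :=
  Matrix.of fun a b => 2 * bryantP f (ambientProj z).1 a b
    + deriv (fun r => S (ambientProj z).1 r a b) (ambientProj z).2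

theorem isNullFamily_bryant (hU : IsOpen U) (hf : ContDiffOn ℝ ∞ f (proj13 '' U))
    (hf3 : ∀ y ∈ proj13 '' U, d3 f y ≠ 0) (hS : IsSmoothFamily (proj13 '' U) ε S) :
    IsNullFamily U {0, 2} ε (bryantH f S) (bryantK f S) := by
  obtain ⟨hPs, hP⟩ := isSmoothCoeff_bryantP hU hf hf3
  have hP' : ∀ a b, ContDiffOn ℝ ∞ (fun q : (ℝ × ℝ) × ℝ => bryantP f q.1 a b)
      ((proj13 '' U) ×ˢ Set.Ioo (-ε) ε) := fun a b =>
    (hP a b).comp contDiffOn_fst fun q hq => hq.1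
  have hH : ∀ a b, ContDiffOn ℝ ∞ (fun q : (ℝ × ℝ) × ℝ => 2 * q.2 * bryantP f q.1 a b
      + S q.1 q.2 a b) ((proj13 '' U) ×ˢ Set.Ioo (-ε) ε) := fun a b =>
    ((contDiffOn_const.mul contDiffOn_snd).mul (hP' a b)).add (hS.2 a b)
  refine ⟨fun a b => isBasic_ambientProj hU (hH a b), fun a b => isBasic_ambientProj hU
    ((contDiffOn_const.mul (hP' a b)).add (contDiffOn_deriv_rho hU (hS.2 a b))),
    fun z hz => ?_, fun z hz => ?_, fun z hz a b => ?_⟩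
  · have h := ambientProj_mem hz
    rw [bryantH, Matrix.transpose_add, Matrix.transpose_smul, hPs _ h.1, hS.1 _ h.1 _ h.2]
  · have h := ambientProj_mem hz
    ext a b
    have h1 : bryantP f (ambientProj z).1 b a = bryantP f (ambientProj z).1 a b :=
      (hPs _ h.1).apply a b
    have h2 : deriv (fun r => S (ambientProj z).1 r b a) (ambientProj z).2 =
        deriv (fun r => S (ambientProj z).1 r a b) (ambientProj z).2 :=
      Filter.EventuallyEq.deriv_eq ((isOpen_Ioo.eventually_mem h.2).mono fun r hr =>
        (hS.1 _ h.1 r hr).apply a b)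
    simp only [bryantK, Matrix.transpose_apply, Matrix.of_apply, h1, h2]
  · have h := ambientProj_mem hz
    have hd : DifferentiableAt ℝ (fun r => S (ambientProj z).1 r a b) (ambientProj z).2 :=
      (differentiableAt_of_mem hU (hS.2 a b) h).comp (ambientProj z).2
        ((differentiableAt_const _).prodMk differentiableAt_id)
    refine (pd_rho_ambientProj (differentiableAt_of_mem hU (hH a b) h)).trans ?_
    have hl : HasDerivAt (fun r : ℝ => 2 * r * bryantP f (ambientProj z).1 a b)
        (2 * bryantP f (ambientProj z).1 a b) (ambientProj z).2 := by
      simpa using ((hasDerivAt_id (ambientProj z).2).const_mul 2).mul_const _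
    exact (hl.add hd.hasDerivAt).deriv

theorem ambientOf_eq (hU : IsOpen U) (hf : ContDiffOn ℝ ∞ f (proj13 '' U))
    (hf3 : ∀ y ∈ proj13 '' U, d3 f y ≠ 0) (hz : z ∈ ambientSpace U ε) :
    ambientOf f S z = (ambientCoframe (bryantE f) z).transpose * nullAmbientGram (bryantH f S) z
      * ambientCoframe (bryantE f) z := by
  refine ambientForm_eq ?_
  have h : splitForm (Fin 3) + Matrix.fromBlocks (bryantH f S z) 0 0 0 =
      splitForm (Fin 3) + (2 * rhoCoord z) • Matrix.fromBlocks (bryantP f (proj13 (xCoord z))) 0 0 0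
        + Matrix.fromBlocks (S (proj13 (xCoord z)) (rhoCoord z)) 0 0 0 := by
    rw [Matrix.fromBlocks_smul, add_assoc, Matrix.fromBlocks_add]
    simp [bryantH, ambientProj]
  rw [h, bryantMetric_eq hU hf hz.2.1, schouten_bryantMetric hU hf hf3 hz.2.1,
    tensor246_eq hU hf hz.2.1]
  simp only [Matrix.mul_add, Matrix.add_mul, Matrix.mul_smul, Matrix.smul_mul]

theorem hasIndex_ambientOf (hU : IsOpen U) (hf : ContDiffOn ℝ ∞ f (proj13 '' U))
    (hf3 : ∀ y ∈ proj13 '' U, d3 f y ≠ 0) (hS : IsSmoothFamily (proj13 '' U) ε S)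
    (hz : z ∈ ambientSpace U ε) : HasIndex (ambientOf f S z) 4 := by
  rw [ambientOf_eq hU hf hf3 hz]
  exact hasIndex_ambientGram ((isNullFrame_bryant hU hf hf3).coframe_mul_frame _ hz.2.1)
    (finSumFinEquiv (m := 3) (n := 3)).symm hz.1 ((isNullFamily_bryant hU hf hf3 hS).symm z hz)

theorem isLeviCivitaFrame_ambientOf (hU : IsOpen U) (hf : ContDiffOn ℝ ∞ f (proj13 '' U))
    (hf3 : ∀ y ∈ proj13 '' U, d3 f y ≠ 0) (hS : IsSmoothFamily (proj13 '' U) ε S) :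
    IsLeviCivitaFrame (ambientSpace U ε) (ambientOf f S) (ambientCoframe (bryantE f))
      (ambientFrame (bryantV f)) (nullAmbientGram (bryantH f S))
      (nullAmbientConn (bryantV f) (fun x => bryantΓ f (proj13 x)) (bryantH f S) (bryantK f S)) :=
  nullAmbient_isLeviCivitaFrame (isNullFrame_bryant hU hf hf3) (isNullFamily_bryant hU hf hf3 hS)
    (fun _ hz => ambientOf_eq hU hf hf3 hz)
    fun _ hz => (hasIndex_ambientOf hU hf hf3 hS hz).isUnit_det

theorem isSemiRiemannian_ambientOf (hU : IsOpen U) (hf : ContDiffOn ℝ ∞ f (proj13 '' U))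
    (hf3 : ∀ y ∈ proj13 '' U, d3 f y ≠ 0) (hS : IsSmoothFamily (proj13 '' U) ε S) :
    IsSemiRiemannian (ambientOf f S) (ambientSpace U ε) := by
  have L := isLeviCivitaFrame_ambientOf hU hf hf3 hS
  refine ⟨fun i j => ?_, fun z hz => ?_, 4, fun z hz => hasIndex_ambientOf hU hf hf3 hS hz⟩
  · exact (((L.smooth_coframe.transpose.mul L.smooth_gram).mul L.smooth_coframe) i j).congr
      fun z hz => by rw [L.metric_eq z hz]
  · rw [Matrix.IsSymm, L.metric_eq z hz, Matrix.transpose_mul, Matrix.transpose_mul,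
      Matrix.transpose_transpose, L.gram_symm z hz, Matrix.mul_assoc]

/-- The only possibly non-zero Ricci components are Ric + ϱ H'' - 2 H' with H' = 2P + S' and H'' =
S''. Since Ric = 4P, the terms in P cancel. -/
theorem ricci_ambientOf_eq_zero_iff (hU : IsOpen U) (hf : ContDiffOn ℝ ∞ f (proj13 '' U))
    (hf3 : ∀ y ∈ proj13 '' U, d3 f y ≠ 0) (hS : IsSmoothFamily (proj13 '' U) ε S)
    (hz : z ∈ ambientSpace U ε) : ricci (ambientOf f S) z = 0 ↔
      ∀ a b, rhoCoord z * deriv (deriv fun r => S (proj13 (xCoord z)) r a b) (rhoCoord z)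
        - 2 * deriv (fun r => S (proj13 (xCoord z)) r a b) (rhoCoord z) = 0 := by
  have N := isNullFrame_bryant hU hf hf3
  have F := isNullFamily_bryant hU hf hf3 hS
  have L := isLeviCivitaFrame_ambientOf hU hf hf3 hS
  have hR := frameRicci_nullAmbientConn N F hz
  have hp := ambientProj_mem hz
  have hK : ∀ a b, pd (.inr (.inr ())) (fun y => bryantK f S y a b) z =
      deriv (deriv fun r => S (proj13 (xCoord z)) r a b) (rhoCoord z) := by
    intro a b
    have hP' : ContDiffOn ℝ ∞ (fun q : (ℝ × ℝ) × ℝ => 2 * bryantP f q.1 a b)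
        ((proj13 '' U) ×ˢ Set.Ioo (-ε) ε) := contDiffOn_const.mul
      (((isSmoothCoeff_bryantP hU hf hf3).2 a b).comp contDiffOn_fst fun q hq => hq.1)
    refine (pd_rho_ambientProj (differentiableAt_of_mem hU
      (hP'.add (contDiffOn_deriv_rho hU (hS.2 a b))) hp)).trans ?_
    exact deriv_const_add (f := deriv fun r => S (proj13 (xCoord z)) r a b)
      (2 * bryantP f (proj13 (xCoord z)) a b)
  have hsymm : ∀ b d, bryantRic f (proj13 (xCoord z)) b d = 4 * bryantP f (proj13 (xCoord z)) d b := by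
    intro b d
    have h : bryantP f (proj13 (xCoord z)) d b = bryantP f (proj13 (xCoord z)) b d :=
      ((isSmoothCoeff_bryantP hU hf hf3).1 _ hp.1).apply b d
    rw [h]
    simp [bryantP]
  have hRic : ∀ b d, frameRicci (ambientFrame (bryantV f)) (nullAmbientConn (bryantV f)
      (fun x => bryantΓ f (proj13 x)) (bryantH f S) (bryantK f S)) z (.inr (.inl (.inl b)))
        (.inr (.inl (.inl d))) =
      rhoCoord z * deriv (deriv fun r => S (proj13 (xCoord z)) r d b) (rhoCoord z)
        - 2 * deriv (fun r => S (proj13 (xCoord z)) r d b) (rhoCoord z) := by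
    intro b d
    rw [hR]
    simp only [N.frameRicci_eq hz.2.1, nullRicci_bryant hU hf hf3 hz.2.1, Matrix.fromBlocks_apply₁₁,
      hK, hsymm, Fintype.card_fin]
    simp only [bryantK, Matrix.of_apply, ambientProj]
    norm_num
    ring
  rw [L.ricci_eq hz]
  constructor
  · intro h a b
    -- The coframe is invertible, so the coordinate Ricci tensor vanishes only if its frame
    -- components do.
    have h0 : frameRicci (ambientFrame (bryantV f)) (nullAmbientConn (bryantV f)
        (fun x => bryantΓ f (proj13 x)) (bryantH f S) (bryantK f S)) z = 0 := by
      have := congrArg (fun A => (ambientFrame (bryantV f) z).transpose * A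
        * ambientFrame (bryantV f) z) h
      have hce := L.coframe_mul_frame z hz
      have hce' : (ambientFrame (bryantV f) z).transpose * (ambientCoframe (bryantE f) z).transpose
          = 1 := by rw [← Matrix.transpose_mul, hce, Matrix.transpose_one]
      simpa [Matrix.mul_assoc, hce, ← Matrix.mul_assoc (ambientFrame (bryantV f) z).transpose,
        hce'] using this
    rw [← hRic b a, h0]
    rfl
  · intro h
    have h0 : frameRicci (ambientFrame (bryantV f)) (nullAmbientConn (bryantV f)
        (fun x => bryantΓ f (proj13 x)) (bryantH f S) (bryantK f S)) z = 0 := by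
      ext (b | (b | b) | b) (d | (d | d) | d)
      case inr.inl.inl.inr.inl.inl => exact (hRic b d).trans (h d b)
      all_goals
        rw [hR]
        simp only [N.frameRicci_eq hz.2.1, Matrix.fromBlocks_apply₁₂, Matrix.fromBlocks_apply₂₁,
          Matrix.fromBlocks_apply₂₂, Matrix.zero_apply, pd_const, mul_zero, add_zero, sub_zero]
    rw [h0, Matrix.mul_zero, Matrix.zero_mul]

theorem isRicciFlat_ambientOf_iff (hU : IsOpen U) (hf : ContDiffOn ℝ ∞ f (proj13 '' U))
    (hf3 : ∀ y ∈ proj13 '' U, d3 f y ≠ 0) (hS : IsSmoothFamily (proj13 '' U) ε S) :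
    IsRicciFlat (ambientOf f S) (ambientSpace U ε) ↔ SolvesPDE (proj13 '' U) ε S := by
  constructor
  · rintro h a b _ ⟨x, hx, rfl⟩ ρ hρ
    -- The equation does not involve t, so it can be read off at t = 1.
    have hz : (Sum.elim (fun _ => 1) (Sum.elim x fun _ => ρ) : AmbientIndex 6 → ℝ) ∈
        ambientSpace U ε := ⟨one_pos, hx, hρ⟩
    exact (ricci_ambientOf_eq_zero_iff hU hf hf3 hS hz).1 (h _ hz) a b
  · intro h z hz
    exact (ricci_ambientOf_eq_zero_iff hU hf hf3 hS hz).2 fun a b =>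
      h a b _ (ambientProj_mem hz).1 _ hz.2.2

end BryantAmbientMetric

/-! ### Solutions of the ordinary differential equation in ϱ. -/

section CubicSolutions

theorem eq_zero_of_mul_eq_zero_of_continuousOn {ε : ℝ} {g : ℝ → ℝ}
    (hg : ContinuousOn g (Set.Ioo (-ε) ε)) (h : ∀ ρ ∈ Set.Ioo (-ε) ε, ρ * g ρ = 0) :
    ∀ ρ ∈ Set.Ioo (-ε) ε, g ρ = 0 := by
  intro ρ hρ
  by_cases h0 : ρ = 0
  · subst h0
    have h1 : Filter.Tendsto g (nhdsWithin 0 {0}ᶜ) (nhds (g 0)) :=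
      (hg.continuousAt (isOpen_Ioo.mem_nhds hρ)).tendsto.mono_left nhdsWithin_le_nhds
    have h2 : Filter.Tendsto g (nhdsWithin 0 {0}ᶜ) (nhds 0) := by
      refine tendsto_const_nhds.congr' ?_
      filter_upwards [self_mem_nhdsWithin, nhdsWithin_le_nhds (isOpen_Ioo.mem_nhds hρ)] with r hr hr'
      exact ((mul_eq_zero.1 (h r hr')).resolve_left hr).symm
    exact tendsto_nhds_unique h1 h2
  · exact (mul_eq_zero.1 (h ρ hρ)).resolve_left h0

/-- Differentiating ϱh'' = 2h' gives ϱh''' = h'' and then ϱh'''' = 0, so h''' is constant on the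
whole interval. Smoothness across ϱ = 0 is essential: |ρ|³ also satisfies the equation, but is only
C². -/
theorem exists_cubic_of_ode {ε : ℝ} (hε : 0 < ε) {h : ℝ → ℝ}
    (hh : ContDiffOn ℝ ∞ h (Set.Ioo (-ε) ε))
    (hode : ∀ ρ ∈ Set.Ioo (-ε) ε, ρ * deriv (deriv h) ρ - 2 * deriv h ρ = 0) (h0 : h 0 = 0) :
    ∃ c, ∀ ρ ∈ Set.Ioo (-ε) ε, h ρ = ρ ^ 3 * c := by
  have hI : IsOpen (Set.Ioo (-ε) ε) := isOpen_Ioo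
  have hc : IsPreconnected (Set.Ioo (-ε) ε) := isPreconnected_Ioo
  have h0I : (0 : ℝ) ∈ Set.Ioo (-ε) ε := ⟨by linarith, hε⟩
  have s1 : ContDiffOn ℝ ∞ (deriv h) _ := hh.deriv_of_isOpen hI (by simp)
  have s2 : ContDiffOn ℝ ∞ (deriv (deriv h)) _ := s1.deriv_of_isOpen hI (by simp)
  have s3 : ContDiffOn ℝ ∞ (deriv (deriv (deriv h))) _ := s2.deriv_of_isOpen hI (by simp)
  have s4 : ContDiffOn ℝ ∞ (deriv (deriv (deriv (deriv h)))) _ := s3.deriv_of_isOpen hI (by simp)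
  have dd : ∀ {g : ℝ → ℝ}, ContDiffOn ℝ ∞ g (Set.Ioo (-ε) ε) → ∀ ρ ∈ Set.Ioo (-ε) ε,
      HasDerivAt g (deriv g ρ) ρ := fun hg ρ hρ =>
    ((hg.contDiffAt (hI.mem_nhds hρ)).differentiableAt (by simp)).hasDerivAt
  have dmul : ∀ {g k : ℝ → ℝ}, ContDiffOn ℝ ∞ g (Set.Ioo (-ε) ε) →
      ContDiffOn ℝ ∞ k (Set.Ioo (-ε) ε) → (∀ ρ ∈ Set.Ioo (-ε) ε, ρ * g ρ = k ρ) →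
      ∀ ρ ∈ Set.Ioo (-ε) ε, g ρ + ρ * deriv g ρ = deriv k ρ := by
    intro g k hg hk hgk ρ hρ
    have h1 : HasDerivAt (fun r => r * g r) (1 * g ρ + ρ * deriv g ρ) ρ :=
      (hasDerivAt_id ρ).mul (dd hg ρ hρ)
    have h2 : (fun r => r * g r) =ᶠ[nhds ρ] k := (hI.eventually_mem hρ).mono hgk
    rw [← h2.deriv_eq, h1.deriv, one_mul]
  have e1 : ∀ ρ ∈ Set.Ioo (-ε) ε, ρ * deriv (deriv h) ρ = 2 * deriv h ρ := fun ρ hρ =>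
    sub_eq_zero.1 (hode ρ hρ)
  have e2 : ∀ ρ ∈ Set.Ioo (-ε) ε, ρ * deriv (deriv (deriv h)) ρ = deriv (deriv h) ρ := by
    intro ρ hρ
    have := dmul s2 (contDiffOn_const.mul s1) e1 ρ hρ
    rw [((dd s1 ρ hρ).const_mul 2).deriv] at this
    linarith
  have e3 : ∀ ρ ∈ Set.Ioo (-ε) ε, deriv (deriv (deriv (deriv h))) ρ = 0 :=
    eq_zero_of_mul_eq_zero_of_continuousOn s4.continuousOn fun ρ hρ => by
      linarith [dmul s3 s2 e2 ρ hρ]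
  have e4 : ∀ ρ ∈ Set.Ioo (-ε) ε, deriv (deriv (deriv h)) ρ = deriv (deriv (deriv h)) 0 :=
    fun ρ hρ => hI.is_const_of_deriv_eq_zero hc (s3.differentiableOn (by simp)) e3 hρ h0I
  set c := deriv (deriv (deriv h)) 0 with hcdef
  have hd : ∀ ρ ∈ Set.Ioo (-ε) ε, HasDerivAt (fun r => h r - r ^ 3 * (c / 6)) 0 ρ := by
    intro ρ hρ
    -- The first two relations give h' = ½ϱh'' = ½ϱ²h''', and h''' is the constant c.
    have h1 : deriv h ρ = 3 * ρ ^ 2 * (c / 6) := by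
      have a1 := e1 ρ hρ
      rw [← e2 ρ hρ, e4 ρ hρ] at a1
      linarith
    have h2 := (dd hh ρ hρ).sub ((hasDerivAt_pow 3 ρ).mul_const (c / 6))
    rw [h1] at h2
    exact h2.congr_deriv (by norm_num)
  refine ⟨c / 6, fun ρ hρ => ?_⟩
  have := hI.is_const_of_deriv_eq_zero hc
    (fun r hr => (hd r hr).differentiableAt.differentiableWithinAt) (fun r hr => (hd r hr).deriv)
    hρ h0I
  simp only [h0] at this
  linarith

variable {U : Set (Fin 6 → ℝ)} {ε : ℝ} {S : ℝ × ℝ → ℝ → Matrix (Fin 3) (Fin 3) ℝ}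
  {Q : ℝ × ℝ → Matrix (Fin 3) (Fin 3) ℝ} {W : Set (ℝ × ℝ)}

theorem exists_cubic_of_solvesPDE (hε : 0 < ε) (hS : IsSmoothFamily W ε S)
    (hpde : SolvesPDE W ε S) (h0 : VanishesInitially W S) :
    ∃ Q, IsSmoothCoeff W Q ∧ ∀ p ∈ W, ∀ ρ ∈ Set.Ioo (-ε) ε, S p ρ = ρ ^ 3 • Q p := by
  have hε2 : ε / 2 ∈ Set.Ioo (-ε) ε := ⟨by linarith, by linarith⟩
  -- The coefficient of ϱ³ is recovered from the value at ϱ = ε/2. This choice makes its smoothness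
  -- and symmetry in p immediate.
  refine ⟨fun p => ((ε / 2) ^ 3)⁻¹ • S p (ε / 2), ⟨fun p hp => ?_, fun a b => ?_⟩,
    fun p hp ρ hρ => ?_⟩
  · exact (hS.1 p hp _ hε2).smul _
  · exact contDiffOn_const.mul ((hS.2 a b).comp (contDiffOn_id.prodMk contDiffOn_const)
      fun p hp => ⟨hp, hε2⟩)
  · ext a b
    obtain ⟨c, hc⟩ := exists_cubic_of_ode hε (h := fun r => S p r a b)
      ((hS.2 a b).comp (contDiffOn_const.prodMk contDiffOn_id) fun r hr => ⟨hp, hr⟩)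
      (hpde a b p hp) (by simp [h0 p hp])
    simp only [Matrix.smul_apply, smul_eq_mul]
    rw [hc ρ hρ, hc _ hε2]
    have : (ε / 2) ^ 3 ≠ 0 := by positivity
    field_simp

theorem solvesPDE_of_cubic (h : ∀ p ∈ W, ∀ ρ ∈ Set.Ioo (-ε) ε, S p ρ = ρ ^ 3 • Q p) :
    SolvesPDE W ε S := by
  intro a b p hp ρ hρ
  have h1 : ∀ r ∈ Set.Ioo (-ε) ε, deriv (fun r => S p r a b) r = 3 * r ^ 2 * Q p a b := by
    intro r hr
    have he : (fun r => S p r a b) =ᶠ[nhds r] fun r => r ^ 3 * Q p a b :=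
      (isOpen_Ioo.eventually_mem hr).mono fun s hs => by simp [h p hp s hs]
    rw [he.deriv_eq, ((hasDerivAt_pow 3 r).mul_const _).deriv]
    norm_num
  have h2 : deriv (deriv fun r => S p r a b) ρ = 6 * ρ * Q p a b := by
    have he : deriv (fun r => S p r a b) =ᶠ[nhds ρ] fun r => 3 * r ^ 2 * Q p a b :=
      (isOpen_Ioo.eventually_mem hρ).mono h1
    rw [he.deriv_eq, (((hasDerivAt_pow 2 ρ).const_mul 3).mul_const _).deriv]
    push_cast
    ring
  rw [h1 ρ hρ, h2]
  ring

theorem vanishesInitially_of_cubic (hε : 0 < ε)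
    (h : ∀ p ∈ W, ∀ ρ ∈ Set.Ioo (-ε) ε, S p ρ = ρ ^ 3 • Q p) : VanishesInitially W S := by
  intro p hp
  rw [h p hp 0 ⟨by linarith, hε⟩]
  simp

theorem isSmoothFamily_cubic (hQ : IsSmoothCoeff W Q) :
    IsSmoothFamily W ε fun p ρ => ρ ^ 3 • Q p :=
  ⟨fun p hp _ _ => (hQ.1 p hp).smul _, fun a b => (contDiffOn_snd.pow 3).mul
    ((hQ.2 a b).comp contDiffOn_fst fun _ hq => hq.1)⟩

end CubicSolutions

/-! ### Ambient metrics for the conformal class. -/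

section ConformalClass

variable {U : Set (Fin 6 → ℝ)} {f : ℝ × ℝ → ℝ} {ε : ℝ}
  {S : ℝ × ℝ → ℝ → Matrix (Fin 3) (Fin 3) ℝ}

theorem isAmbientMetric_ambientOf (hU : IsOpen U) (hf : ContDiffOn ℝ ∞ f (proj13 '' U))
    (hf3 : ∀ y ∈ proj13 '' U, d3 f y ≠ 0) (hS : IsSmoothFamily (proj13 '' U) ε S)
    (hpde : SolvesPDE (proj13 '' U) ε S) (h0 : VanishesInitially (proj13 '' U) S) :
    IsAmbientMetric U ε (bryantMetric (pull13 f)) (ambientOf f S) where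
  semiRiemannian := isSemiRiemannian_ambientOf hU hf hf3 hS
  form := ⟨_, fun _ _ => rfl, fun x hx => by simp [h0 _ ⟨x, hx, rfl⟩, tensor246]⟩
  ricciFlat := (isRicciFlat_ambientOf_iff hU hf hf3 hS).2 hpde

/-- Compare blocks in the frame: `q` does not touch the block pairing the two halves, so that block
forces c = 1, and the first diagonal block then gives q = 0. -/
theorem eq_zero_of_splitForm_add_eq_smul {α ι : Type*} [Fintype α] [DecidableEq α] [Nonempty α]
    [Fintype ι] [DecidableEq ι] {e : Matrix (α ⊕ α) ι ℝ} {E : Matrix ι (α ⊕ α) ℝ} (heE : e * E = 1)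
    {q : Matrix α α ℝ} {c : ℝ}
    (h : e.transpose * splitForm α * e
      + e.transpose * (Matrix.fromBlocks q 0 0 0 : Matrix (α ⊕ α) (α ⊕ α) ℝ) * e =
        c • (e.transpose * splitForm α * e)) : q = 0 := by
  have hEe : E.transpose * e.transpose = 1 := by rw [← Matrix.transpose_mul, heE, Matrix.transpose_one]
  have hcan : ∀ A : Matrix (α ⊕ α) (α ⊕ α) ℝ, E.transpose * (e.transpose * A * e) * E = A := by
    intro A
    calc E.transpose * (e.transpose * A * e) * E
        = (E.transpose * e.transpose) * A * (e * E) := by simp only [Matrix.mul_assoc]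
      _ = A := by rw [hEe, heE, Matrix.one_mul, Matrix.mul_one]
  have h2 := congrArg (fun A => E.transpose * A * E) h
  simp only [Matrix.mul_add, Matrix.add_mul, Matrix.mul_smul, Matrix.smul_mul, hcan] at h2
  obtain ⟨a⟩ := ‹Nonempty α›
  have hc : 1 = c := by
    simpa [splitForm] using congrFun (congrFun h2 (.inl a)) (.inr a)
  subst hc
  ext b d
  simpa [splitForm] using congrFun (congrFun h2 (.inl b)) (.inl d)

theorem vanishesInitially_of_isPreAmbientMetric (hU : IsOpen U)
    (hf : ContDiffOn ℝ ∞ f (proj13 '' U)) (hf3 : ∀ y ∈ proj13 '' U, d3 f y ≠ 0) (hε : 0 < ε)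
    {φ : (Fin 6 → ℝ) → ℝ} (h : IsPreAmbientMetric U ε
      (fun x => Real.exp (2 * φ x) • bryantMetric (pull13 f) x) (ambientOf f S)) :
    VanishesInitially (proj13 '' U) S := by
  rintro _ ⟨x, hx, rfl⟩
  obtain ⟨g, hg, hg0⟩ := h.form
  -- At t = 1 and ϱ = 0 the factor t² and the term 2ϱP disappear, leaving g + S = e^{2φ} g.
  have hz : (Sum.elim (fun _ => 1) (Sum.elim x fun _ => 0) : AmbientIndex 6 → ℝ) ∈
      ambientSpace U ε := ⟨one_pos, hx, by constructor <;> simp [rhoCoord, hε]⟩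
  have hm : bryantMetric (pull13 f) x + tensor246 (pull13 f) (S (proj13 x) 0) x =
      Real.exp (2 * φ x) • bryantMetric (pull13 f) x := by
    rw [← hg0 x hx]
    ext i j
    have h1 := congrFun (congrFun (hg _ hz) (.inr (.inl i))) (.inr (.inl j))
    have hx' : xCoord (Sum.elim (fun _ => 1) (Sum.elim x fun _ => 0) : AmbientIndex 6 → ℝ) = x := rfl
    simpa [ambientOf, ambientForm, hx', tCoord, rhoCoord] using h1
  rw [tensor246_eq hU hf hx, bryantMetric_eq hU hf hx] at hm
  exact eq_zero_of_splitForm_add_eq_smul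
    ((isNullFrame_bryant hU hf hf3).coframe_mul_frame x hx) hm

end ConformalClass

end BryantAmbient

theorem mainTheorem11
    (U : Set (Fin 6 → ℝ)) (hU : IsOpen U)
    (f : ℝ × ℝ → ℝ)
    (hf : ContDiffOn ℝ ∞ f (BryantAmbient.proj13 '' U))
    (hf3 : ∀ x ∈ U, BryantAmbient.pd 2 (BryantAmbient.pull13 f) x ≠ 0) :
    -- the Schouten tensor lies in the span of the `θ^i θ^j`, `i, j ∈ {2, 4, 6}`
    (∃ p : ℝ × ℝ → Matrix (Fin 3) (Fin 3) ℝ,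
      BryantAmbient.IsSmoothCoeff (BryantAmbient.proj13 '' U) p ∧
      ∀ x ∈ U, BryantAmbient.schouten (BryantAmbient.bryantMetric (BryantAmbient.pull13 f)) x =
        BryantAmbient.tensor246 (BryantAmbient.pull13 f) (p (BryantAmbient.proj13 x)) x) ∧
    ∀ ε : ℝ, 0 < ε →
      (∀ S : ℝ × ℝ → ℝ → Matrix (Fin 3) (Fin 3) ℝ,
        BryantAmbient.IsSmoothFamily (BryantAmbient.proj13 '' U) ε S →
        -- `g̃_{f,S}` is a metric, and it is Ricci-flat iff all `S_{ij}` satisfy the PDE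
        BryantAmbient.IsSemiRiemannian (BryantAmbient.ambientOf f S)
          (BryantAmbient.ambientSpace U ε) ∧
        (BryantAmbient.IsRicciFlat (BryantAmbient.ambientOf f S)
            (BryantAmbient.ambientSpace U ε) ↔
          BryantAmbient.SolvesPDE (BryantAmbient.proj13 '' U) ε S) ∧
        -- it is an ambient metric for the conformal class of `g_{D_f}` iff moreover `S|_{ϱ=0} = 0`
        (BryantAmbient.IsAmbientMetricForClass U ε
            (BryantAmbient.bryantMetric (BryantAmbient.pull13 f)) (BryantAmbient.ambientOf f S) ↔
          BryantAmbient.SolvesPDE (BryantAmbient.proj13 '' U) ε S ∧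
          BryantAmbient.VanishesInitially (BryantAmbient.proj13 '' U) S) ∧
        -- the general solution with `S|_{ϱ=0} = 0` is `S = ϱ³ Q` with `Q` arbitrary
        (BryantAmbient.SolvesPDE (BryantAmbient.proj13 '' U) ε S ∧
          BryantAmbient.VanishesInitially (BryantAmbient.proj13 '' U) S ↔
          ∃ Q : ℝ × ℝ → Matrix (Fin 3) (Fin 3) ℝ,
            BryantAmbient.IsSmoothCoeff (BryantAmbient.proj13 '' U) Q ∧
            ∀ p ∈ BryantAmbient.proj13 '' U, ∀ ρ ∈ Set.Ioo (-ε) ε, S p ρ = ρ ^ 3 • Q p)) ∧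
      -- every `Q` gives an ambient metric for `g_{D_f}`
      (∀ Q : ℝ × ℝ → Matrix (Fin 3) (Fin 3) ℝ,
        BryantAmbient.IsSmoothCoeff (BryantAmbient.proj13 '' U) Q →
        BryantAmbient.IsAmbientMetric U ε (BryantAmbient.bryantMetric (BryantAmbient.pull13 f))
          (BryantAmbient.ambientOf f fun p ρ => ρ ^ 3 • Q p)) := by
  have h3 := BryantAmbient.d3_ne_zero hU hf hf3
  refine ⟨⟨BryantAmbient.bryantP f, BryantAmbient.isSmoothCoeff_bryantP hU hf h3, fun x hx => ?_⟩,
    fun ε hε => ⟨fun S hS => ⟨BryantAmbient.isSemiRiemannian_ambientOf hU hf h3 hS,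
      BryantAmbient.isRicciFlat_ambientOf_iff hU hf h3 hS, ⟨?_, fun h => ?_⟩,
      fun h => BryantAmbient.exists_cubic_of_solvesPDE hε hS h.1 h.2, ?_⟩, fun Q hQ => ?_⟩⟩
  · rw [BryantAmbient.schouten_bryantMetric hU hf h3 hx, BryantAmbient.tensor246_eq hU hf hx]
  · rintro ⟨φ, -, h⟩
    exact ⟨(BryantAmbient.isRicciFlat_ambientOf_iff hU hf h3 hS).1 h.ricciFlat,
      BryantAmbient.vanishesInitially_of_isPreAmbientMetric hU hf h3 hε h.toIsPreAmbientMetric⟩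
  · refine ⟨fun _ => 0, contDiffOn_const, ?_⟩
    simpa using BryantAmbient.isAmbientMetric_ambientOf hU hf h3 hS h.1 h.2
  · rintro ⟨Q, -, h⟩
    exact ⟨BryantAmbient.solvesPDE_of_cubic h, BryantAmbient.vanishesInitially_of_cubic hε h⟩
  · exact BryantAmbient.isAmbientMetric_ambientOf hU hf h3 (BryantAmbient.isSmoothFamily_cubic hQ)
      (BryantAmbient.solvesPDE_of_cubic fun _ _ _ _ => rfl)
      (BryantAmbient.vanishesInitially_of_cubic hε fun _ _ _ _ => rfl)
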